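/- **Notation.** For integers $0\le b\le a$ let ${a\brack b}=\frac{(q)_a}{(q)_b(q)_{a-b}}$ with $(q)_n=\prod_{k=1}^n(1-q^k)$; otherwise ${a\brack b}=0$. All identities below except the last two statements are identities between Laurent polynomials with integer coefficients in fractional powers of the indeterminate $q$. For integers $p,p'\ge1$, $r,s$ and $M_1,L_1,M_2,L_2$, with $M_{12}=M_1-M_2$, put $$X^{(p,p')}_{r,s}(M_1,L_1,M_2,L_2)=\sum_{j\in\mathbb Z}\Big\{q^{j(pp'j+p'(M_{12}+r)-ps)}{M_1+L_1-(p'-p)j\brack M_1+pj}{M_2+L_2+(p'-p)j\brack M_2-pj}$$ $$\qquad-q^{(pj+M_{12}+r)(p'j+s)}{M_1+L_1-(p'-p)j+r-s\brack M_1+pj+r}{M_2+L_2+(p'-p)j-r+s\brack M_2-pj-r}\Big\}$$ and $X^{(p,p')}_{r,s}(M,L)=X^{(p,p')}_{r,s}(M,L,M,L)$. Let $C^{(k)}$ be the Cartan matrix of $A_k$, $\mathcal I^{(k)}=2I-C^{(k)}$, and $e_1,\dots,e_k$ the standard unit vectors. Let $N\ge1$ and $\sigma\in\{0,1\}$, and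 write $C=C^{(N-1)}$, $\mathcal I=\mathcal I^{(N-1)}$. For integers $A,B$ and numbers $t_1,t_2$ put $$Y_{N,\sigma}(A,B;t_1,t_2)=\sum_{\eta}q^{\eta C^{-1}\eta}\prod_{k=1}^{N-1}{\mu_k+\eta_k\brack\eta_k}\;{t_1-\frac12(B-\mu_1)\brack A}{t_2-\frac12(A-\mu_{N-1})\brack B},$$ where the sum is over $\eta\in\mathbb Z^{N-1}$ with $\frac{A-B+\sigma N}{2N}+(C^{-1}\eta)_1\in\mathbb Z$ and $\mu$ is determined by $\mu+\eta=\frac12(\mathcal I\mu+Ae_1+Be_{N-1})$ (for $N=1$ there is no sum, $\mu_1$ is read as $B$, $\mu_{N-1}$ as $A$, and $(C^{-1}\eta)_1$ as $0$). The level-$N$ polynomials are $$X^{(p,p'),N}_{r,s,\sigma}(M,L)=\sum_{j\in\mathbb Z}q^{\frac jN(pp'j+p'r-ps)}\,Y_{N,\sigma}\!\Big(M+pj,\,M-pj;\;M+L-\tfrac{(p'-p)j}N,\;M+L+\tfrac{(p'-p)j}N\Big)$$ $$\qquad-\sum_{j\in\mathbb Z}q^{\frac1N(pj+r)(p'j+s)}\,Y_{N,\sigma}\!\Big(M+pj+r,\,M-pj-r;\;M+L-\tfrac{(p'-p)j-r+s}N,\;M+L+\tfrac{(p'-p)j-r+s}N\Big).$$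 **Statement.** First, $X^{(1,2)}_{0,1}(M,L)=\delta_{L,0}$ for all integers $M\ge0$ and $L$. Next, let $N\ge1$, $\sigma\in\{0,1\}$, $M$ and $L+\frac\sigma2$ be integers with $\sigma N$ even. Then: 1. $$X^{(1,2N+1),N}_{0,N,\sigma}(M,L)=q^{L^2}\sum_{m}q^{\frac14mTm}{L+M-\frac12m_1\brack 2L}\prod_{k=1}^{N-1}{m_k+n_k\brack m_k},\qquad m+n=\tfrac12(\mathcal I_Tm+2Le_1),$$ where $(\mathcal I_T)_{i,j}=\delta_{|i-j|,1}+\delta_{i,j}\delta_{i,1}$ $(1\le i,j\le N-1)$ is the incidence matrix of the tadpole graph, $T=2I-\mathcal I_T$, and the sum is over $m\in\mathbb Z^{N-1}$ with $m_k\equiv\sigma$ for odd $k$ and $m_k\equiv0\pmod 2$ for even $k$ (for $N=1$ read $m_1=0$). 2. $$X^{(2,N+2),N}_{1,1,\sigma}(M,L)={2L+M\brack 2L}\delta_{\sigma,0}.$$ 3. $$X^{(3,N+3),N}_{1,1,\sigma}(M,L)=\sum_{m}q^{\frac14mC^{(N)}m}{2L+M-\frac12m_1\brack 2L}\prod_{k=1}^{N}{m_k+n_k\brack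 m_k},\qquad m+n=\tfrac12(\mathcal I^{(N)}m+2Le_1),$$ where the sum is over $m\in\mathbb Z^{N}$ with $m_k\equiv\sigma$ for even $k$ and $m_k\equiv0\pmod2$ for odd $k$. 4. $$X^{(2,3N+2),N}_{1,N+1,\sigma}(M,L)=\sum_{i=0}^Mq^{i^2/N}{2L+M-i\brack2L}\sum_nq^{nC^{-1}n}\prod_{k=1}^{N-1}{m_k+n_k\brack n_k}\;{2L-i+m_1\brack i},$$ where the inner sum is over $n\in\mathbb Z^{N-1}$ with $\frac{2i+\sigma N}{2N}+(C^{-1}n)_1\in\mathbb Z$ and $m+n=\frac12(\mathcal Im+2ie_1)$ (for $N=1$ the inner sum has one term, and $m_1$ and $(C^{-1}n)_1$ are read as $0$). For $N=2$ the fourth family becomes $$X^{(2,8),2}_{1,3,\sigma}(M,L)=\sum_{i=0}^M\;\sum_{\substack{0\le n\le i\\ n+i+\sigma\text{ even}}}q^{(i^2+n^2)/2}{2L+M-i\brack2L}{i\brack n}{2L-n\brack i}.$$ This is a doubly bounded version of Slater's identity $$S(x):=\sum_{n=0}^\infty\frac{x^{n^2}(-x;x^2)_n}{(x^2;x^2)_n}=\prod_{j=1}^\infty\frac1{(1-x^{8j-1})(1-x^{8j-4})(1-x^{8j-7})}\qquad(|x|<1,\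 x\in\mathbb R)$$ in the following sense: this identity holds (sum and product converge), and for $\sigma\in\{0,1\}$ and $0<x<1$, at $q=x^2$ and with $M,K\to\infty$ through the non-negative integers, $$\lim_{M,K\to\infty}X^{(2,8),2}_{1,3,\sigma}\big(M,K+\tfrac\sigma2\big)=\frac{S(x)+(-1)^\sigma S(-x)}{2\,(x^2;x^2)_\infty}.$$ -/

import Mathlib

open scoped Matrix

noncomputable section

/-- The ring `ℤ[q^a : a ∈ ℚ]` of Laurent polynomials in fractional powers of the formal variable `q`. -/
abbrev QPoly : Type := AddMonoidAlgebra ℤ ℚ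

/-- The monomial `q^a`. -/
def qPow (a : ℚ) : QPoly := AddMonoidAlgebra.single a 1

/-- The `q`-factorial `(q)_n = (1 - q)(1 - q^2) ⋯ (1 - q^n)`. -/
def qFac (n : ℕ) : QPoly := ∏ k ∈ Finset.range n, (1 - qPow ((k : ℚ) + 1))

/-- The Gaussian polynomial with top entry `n` and bottom entry `k`, given by the `q`-Pascal rule.
The theorem `gauss_mul_qFac` shows that it is the quotient `(q)_n / ((q)_k (q)_{n-k})`. -/
def gauss : ℕ → ℕ → QPoly
  | _, 0 => 1
  | 0, _ + 1 => 0
  | n + 1, k + 1 => gauss n k + qPow ((k : ℚ) + 1) * gauss n (k + 1)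

theorem qPow_add (a b : ℚ) : qPow (a + b) = qPow a * qPow b := by
  simp [qPow, AddMonoidAlgebra.single_mul_single]

theorem qFac_succ (n : ℕ) : qFac (n + 1) = qFac n * (1 - qPow ((n : ℚ) + 1)) := by
  simp [qFac, Finset.prod_range_succ]

theorem gauss_eq_zero_of_lt : ∀ (n k : ℕ), n < k → gauss n k = 0
  | 0, _ + 1, _ => by simp [gauss]
  | n + 1, k + 1, h => by
      rw [gauss, gauss_eq_zero_of_lt n k (by omega), gauss_eq_zero_of_lt n (k + 1) (by omega)]
      simp

theorem gauss_mul_qFac : ∀ (m n : ℕ), gauss (m + n) m * (qFac m * qFac n) = qFac (m + n)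
  | 0, n => by simp [gauss, qFac]
  | m + 1, 0 => by
      have h1 := gauss_mul_qFac m 0
      have h2 := gauss_eq_zero_of_lt m (m + 1) (by omega)
      simp only [Nat.add_zero] at h1 ⊢
      rw [gauss, h2, qFac_succ, mul_zero, add_zero]
      linear_combination (1 - qPow ((m : ℚ) + 1)) * h1
  | m + 1, n + 1 => by
      have h1 := gauss_mul_qFac m (n + 1)
      have h2 := gauss_mul_qFac (m + 1) n
      have e1 : m + 1 + (n + 1) = (m + (n + 1)) + 1 := by omega
      have e2 : m + 1 + n = m + (n + 1) := by omega
      rw [e2] at h2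
      have h3 : qPow (((m + (n + 1) : ℕ) : ℚ) + 1)
          = qPow ((m : ℚ) + 1) * qPow ((n : ℚ) + 1) := by
        rw [← qPow_add]; congr 1; push_cast; ring
      rw [e1, gauss, qFac_succ (m + (n + 1)), h3]
      have h4 := qFac_succ m
      have h5 := qFac_succ n
      linear_combination (1 - qPow ((m : ℚ) + 1)) * h1
        + qPow ((m : ℚ) + 1) * (1 - qPow ((n : ℚ) + 1)) * h2
        + gauss (m + (n + 1)) m * qFac (n + 1) * h4
        + qPow ((m : ℚ) + 1) * gauss (m + (n + 1)) (m + 1) * qFac (m + 1) * h5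

/-- The `q`-binomial coefficient with top entry `a` and bottom entry `b`: it is
`(q)_a / ((q)_b (q)_{a-b})` for integers `0 ≤ b ≤ a`, and zero otherwise.  The entries are rational
because they are written with fractions; in all the sums below they are integers wherever the
remaining factors of the summand do not vanish. -/
def qBinom (a b : ℚ) : QPoly :=
  if a.den = 1 ∧ b.den = 1 ∧ 0 ≤ b ∧ b ≤ a then gauss a.num.toNat b.num.toNat else 0

/-- The Cartan matrix of the Dynkin diagram `A_n`, with rational entries. -/
def cartanA (n : ℕ) : Matrix (Fin n) (Fin n) ℚ := (CartanMatrix.A n).map (fun z : ℤ => (z : ℚ))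

/-- The incidence matrix `2I - C` of the Dynkin diagram `A_n`. -/
def incA (n : ℕ) : Matrix (Fin n) (Fin n) ℚ := (2 : ℚ) • (1 : Matrix (Fin n) (Fin n) ℚ) - cartanA n

/-- The incidence matrix of the tadpole graph with `n` nodes:
`δ_{|i-j|,1} + δ_{i,j} δ_{i,1}`, the labels being `1, …, n`. -/
def incT (n : ℕ) : Matrix (Fin n) (Fin n) ℚ :=
  incA n + Matrix.of fun i j => if i = j ∧ i.val + 1 = 1 then 1 else 0

/-- The Cartan-like matrix `2I - I_T` of the tadpole graph with `n` nodes. -/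
def cartanT (n : ℕ) : Matrix (Fin n) (Fin n) ℚ :=
  (2 : ℚ) • (1 : Matrix (Fin n) (Fin n) ℚ) - incT n

/-- The standard unit vector `e_k`, where the coordinates have the labels `1, …, n`. -/
def unitVec (n k : ℕ) : Fin n → ℚ := fun i => if i.val + 1 = k then 1 else 0

/-- The coordinate `v_k` of `v`, where the coordinates have the labels `1, …, n`; for a label out of
this range the value is `d`. -/
def coord {n : ℕ} (v : Fin n → ℚ) (k : ℕ) (d : ℚ) : ℚ :=
  if h : 1 ≤ k ∧ k ≤ n then v ⟨k - 1, by omega⟩ else d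

/-- The rational vector underlying an integer vector. -/
def ratVec {n : ℕ} (v : Fin n → ℤ) : Fin n → ℚ := fun i => (v i : ℚ)

theorem cartanA_mulVec {n : ℕ} (v : Fin n → ℚ) (i : Fin n) :
    (cartanA n *ᵥ v) i = 2 * v i - coord v i.val 0 - coord v (i.val + 2) 0 := by
  have hsplit : ∀ k : Fin n, cartanA n i k * v k
      = (if k = i then 2 * v i else 0) - (if k.val + 1 = i.val then coord v i.val 0 else 0)
        - (if k.val = i.val + 1 then coord v (i.val + 2) 0 else 0) := by
    intro k
    simp only [cartanA, CartanMatrix.A, Matrix.map_apply, Matrix.of_apply]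
    have hi := i.isLt
    have hk := k.isLt
    by_cases h1 : k = i
    · subst h1; simp
    · have h1' : ¬ i = k := fun h => h1 h.symm
      have h1v : k.val ≠ i.val := fun h => h1 (Fin.ext h)
      by_cases h2 : k.val + 1 = i.val
      · have h3 : ¬ k.val = i.val + 1 := by omega
        have : coord v i.val 0 = v k := by
          rw [coord, dif_pos ⟨by omega, by omega⟩]; congr 1; ext; simp; omega
        simp [h1, h1', h2, h3, this]
      · by_cases h3 : k.val = i.val + 1
        · have : coord v (i.val + 2) 0 = v k := by
            rw [coord, dif_pos ⟨by omega, by omega⟩]; congr 1; ext; simp; omega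
          have h4 : ¬ (i.val + 1 + 1 = i.val) := by omega
          simp [h1, h1', h3, h4, this]
        · have h4 : ¬ (i.val + 1 = k.val) := by omega
          simp [h1, h1', h2, h3, h4]
  have hlow : ∑ k : Fin n, (if k.val + 1 = i.val then coord v i.val 0 else 0)
      = coord v i.val 0 := by
    by_cases h : 1 ≤ i.val
    · have hlt : i.val - 1 < n := by have := i.isLt; omega
      rw [Finset.sum_eq_single (⟨i.val - 1, hlt⟩ : Fin n)]
      · rw [if_pos (by simp; omega)]
      · intro k _ hk
        rw [if_neg]
        intro h'
        exact hk (Fin.ext (by simp; omega))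
      · simp
    · have : coord v i.val 0 = 0 := by rw [coord, dif_neg (by omega)]
      simp [this]
  have hup : ∑ k : Fin n, (if k.val = i.val + 1 then coord v (i.val + 2) 0 else 0)
      = coord v (i.val + 2) 0 := by
    by_cases h : i.val + 1 < n
    · rw [Finset.sum_eq_single (⟨i.val + 1, h⟩ : Fin n)]
      · rw [if_pos rfl]
      · intro k _ hk
        rw [if_neg]
        intro h'
        exact hk (Fin.ext h')
      · simp
    · have : coord v (i.val + 2) 0 = 0 := by rw [coord, dif_neg (by omega)]
      simp [this]
  rw [Matrix.mulVec, dotProduct, Finset.sum_congr rfl (fun k _ => hsplit k),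
    Finset.sum_sub_distrib, Finset.sum_sub_distrib, hlow, hup]
  simp

theorem isUnit_det_cartanA (n : ℕ) : IsUnit (cartanA n).det := by
  rw [isUnit_iff_ne_zero]
  intro hdet
  obtain ⟨v, hv0, hv⟩ := Matrix.exists_mulVec_eq_zero_iff.mpr hdet
  have hrec : ∀ k : ℕ, k < n → coord v (k + 2) 0 = 2 * coord v (k + 1) 0 - coord v k 0 := by
    intro k hk
    have h := congrFun hv ⟨k, hk⟩
    rw [cartanA_mulVec] at h
    have hc : coord v (k + 1) 0 = v ⟨k, hk⟩ := by
      rw [coord, dif_pos ⟨by omega, by omega⟩]; rfl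
    simp only [Pi.zero_apply] at h
    rw [hc]; linarith
  have hlin : ∀ k : ℕ, k ≤ n →
      coord v k 0 = k * coord v 1 0 ∧ coord v (k + 1) 0 = (k + 1) * coord v 1 0 := by
    intro k
    induction k with
    | zero => intro _; simp [coord]
    | succ k ih =>
      intro hk
      obtain ⟨h1, h2⟩ := ih (by omega)
      refine ⟨by push_cast; exact h2, ?_⟩
      rw [hrec k (by omega), h1, h2]; push_cast; ring
  have h1 : coord v 1 0 = 0 := by
    have h := (hlin n le_rfl).2
    rw [coord, dif_neg (by omega)] at h
    have hn : (n : ℚ) + 1 ≠ 0 := by positivity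
    rcases mul_eq_zero.mp h.symm with h' | h'
    · exact absurd h' hn
    · exact h'
  apply hv0
  funext i
  have h := (hlin (i.val + 1) i.isLt).1
  rw [h1, mul_zero, coord, dif_pos ⟨by omega, i.isLt⟩] at h
  exact h

/-- The vector `μ` which is determined by `η` through the system `μ + η = (1/2) (I μ + b)`, where
`I` is the incidence matrix of `A_n`; see `solveA_spec`. -/
def solveA {n : ℕ} (b η : Fin n → ℚ) : Fin n → ℚ := (cartanA n)⁻¹ *ᵥ (b - (2 : ℚ) • η)

theorem solveA_spec {n : ℕ} (b η : Fin n → ℚ) :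
    solveA b η + η = (1 / 2 : ℚ) • (incA n *ᵥ solveA b η + b) := by
  have h : cartanA n *ᵥ solveA b η = b - (2 : ℚ) • η := by
    rw [solveA, Matrix.mulVec_mulVec, Matrix.mul_nonsing_inv _ (isUnit_det_cartanA n),
      Matrix.one_mulVec]
  have h2 : incA n *ᵥ solveA b η = (2 : ℚ) • solveA b η - (b - (2 : ℚ) • η) := by
    rw [incA, Matrix.sub_mulVec, h, Matrix.smul_mulVec, Matrix.one_mulVec]
  rw [h2]
  funext i
  simp only [Pi.add_apply, Pi.smul_apply, Pi.sub_apply, smul_eq_mul]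
  ring

/-- Burge's polynomial `X_{r,s}^{(p,p')}(M₁, L₁, M₂, L₂)`. -/
def burgeX (p p' r s M₁ L₁ M₂ L₂ : ℤ) : QPoly :=
  ∑ᶠ j : ℤ,
    (qPow (j * (p * p' * j + p' * (M₁ - M₂ + r) - p * s))
        * qBinom (M₁ + L₁ - (p' - p) * j) (M₁ + p * j)
        * qBinom (M₂ + L₂ + (p' - p) * j) (M₂ - p * j)
      - qPow ((p * j + (M₁ - M₂) + r) * (p' * j + s))
        * qBinom (M₁ + L₁ - (p' - p) * j + r - s) (M₁ + p * j + r)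
        * qBinom (M₂ + L₂ + (p' - p) * j - r + s) (M₂ - p * j - r))

/-- The set of `n ∈ ℤ^{N-1}` with `(ℓ + σ N)/(2N) + (C⁻¹ n)_1 ∈ ℤ`, where `C` is the Cartan matrix
of `A_{N-1}` (for `N = 1` the term `(C⁻¹ n)_1` is absent). -/
def restrictedSet (N σ : ℕ) (ℓ : ℤ) : Set (Fin (N - 1) → ℤ) :=
  {n | ∃ z : ℤ, ((ℓ : ℚ) + σ * N) / (2 * N) + coord ((cartanA (N - 1))⁻¹ *ᵥ ratVec n) 1 0 = z}

/-- The exponent `n C⁻¹ n`, where `C` is the Cartan matrix of `A_k`. -/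
def invForm {k : ℕ} (n : Fin k → ℤ) : ℚ := ratVec n ⬝ᵥ ((cartanA k)⁻¹ *ᵥ ratVec n)

/-- The sum over `η` in the definition of `levelX`, as a function of the lower entries `A`, `B` of
its two last `q`-binomials: the sum over `η ∈ ℤ^{N-1}` with
`(A - B + σ N)/(2N) + (C⁻¹ η)_1 ∈ ℤ` of
`q^{η C⁻¹ η} [μ + η; η] [t₁ - (B - μ_1)/2; A] [t₂ - (A - μ_{N-1})/2; B]`, where
`μ + η = (1/2) (I μ + A e_1 + B e_{N-1})`.  For `N = 1` one has to read `μ_1 = B` and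
`μ_{N-1} = μ_0 = A`. -/
def levelInner (N σ : ℕ) (A B : ℤ) (t₁ t₂ : ℚ) : QPoly :=
  ∑ᶠ η ∈ restrictedSet N σ (A - B),
    let μ : Fin (N - 1) → ℚ :=
      solveA ((A : ℚ) • unitVec (N - 1) 1 + (B : ℚ) • unitVec (N - 1) (N - 1)) (ratVec η)
    qPow (invForm η) * (∏ k, qBinom (μ k + η k) (η k))
      * qBinom (t₁ - (B - coord μ 1 B) / 2) A
      * qBinom (t₂ - (A - coord μ (N - 1) A) / 2) B

/-- The level-`N` polynomial `X_{r,s,σ}^{(p,p'),N}(M₁, L₁, M₂, L₂)`. -/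
def levelX (N : ℕ) (p p' r s : ℤ) (σ : ℕ) (M₁ : ℤ) (L₁ : ℚ) (M₂ : ℤ) (L₂ : ℚ) : QPoly :=
  (∑ᶠ j : ℤ, qPow ((j : ℚ) / N * (p * p' * j + p' * (M₁ - M₂ + r) - p * s))
      * levelInner N σ (M₁ + p * j) (M₂ - p * j)
          (M₁ + L₁ - (p' - p) * j / N) (M₂ + L₂ + (p' - p) * j / N))
  - ∑ᶠ j : ℤ, qPow (1 / N * (p * j + (M₁ - M₂) + r) * (p' * j + s))
      * levelInner N σ (M₁ + p * j + r) (M₂ - p * j - r)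
          (M₁ + L₁ - ((p' - p) * j - r + s) / N) (M₂ + L₂ + ((p' - p) * j - r + s) / N)

/-- The symmetric case `X_{r,s,σ}^{(p,p'),N}(M, L) = X_{r,s,σ}^{(p,p'),N}(M, L, M, L)`. -/
def levelXsymm (N : ℕ) (p p' r s : ℤ) (σ : ℕ) (M : ℤ) (L : ℚ) : QPoly :=
  levelX N p p' r s σ M L M L

/-- The fermionic form attached to the tadpole graph with `N - 1` nodes:
`q^{L²} ∑_m q^{m T m / 4} [L + M - m_1/2; 2L] [m + n; m]` with
`m + n = (1/2) (I_T m + 2L e_1)`, over `m ∈ ℤ^{N-1}` with `m_k ≡ σ (mod 2)` for the odd labels `k`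
and `m_k ≡ 0 (mod 2)` for the even labels `k` (for `N = 1` one has to read `m_1 = 0`). -/
def tadpoleForm (N σ : ℕ) (M : ℤ) (L : ℚ) : QPoly :=
  qPow (L ^ 2) *
    ∑ᶠ m ∈ {m : Fin (N - 1) → ℤ |
        ∀ k, m k ≡ (if Odd (k.val + 1) then (σ : ℤ) else 0) [ZMOD 2]},
      let n : Fin (N - 1) → ℚ :=
        (1 / 2 : ℚ) • (incT (N - 1) *ᵥ ratVec m + (2 * L) • unitVec (N - 1) 1) - ratVec m
      qPow (1 / 4 * (ratVec m ⬝ᵥ (cartanT (N - 1) *ᵥ ratVec m)))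
        * qBinom (L + M - coord (ratVec m) 1 0 / 2) (2 * L)
        * ∏ k, qBinom (m k + n k) (m k)

/-- The fermionic form attached to `A_N`:
`∑_m q^{m C m / 4} [2L + M - m_1/2; 2L] [m + n; m]` with `m + n = (1/2) (I m + 2L e_1)`, over
`m ∈ ℤ^N` with `m_k ≡ σ (mod 2)` for the even labels `k` and `m_k ≡ 0 (mod 2)` for the odd
labels `k`. -/
def typeAForm (N σ : ℕ) (M : ℤ) (L : ℚ) : QPoly :=
  ∑ᶠ m ∈ {m : Fin N → ℤ | ∀ k, m k ≡ (if Even (k.val + 1) then (σ : ℤ) else 0) [ZMOD 2]},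
    let n : Fin N → ℚ :=
      (1 / 2 : ℚ) • (incA N *ᵥ ratVec m + (2 * L) • unitVec N 1) - ratVec m
    qPow (1 / 4 * (ratVec m ⬝ᵥ (cartanA N *ᵥ ratVec m)))
      * qBinom (2 * L + M - coord (ratVec m) 1 0 / 2) (2 * L)
      * ∏ k, qBinom (m k + n k) (m k)

/-- The form `∑_{i=0}^M q^{i²/N} [2L+M-i; 2L] ∑_n q^{n C⁻¹ n} [m + n; n] [2L - i + m_1; i]`, where
`C` is the Cartan matrix of `A_{N-1}`, the inner sum is over `n ∈ ℤ^{N-1}` with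
`(2i + σ N)/(2N) + (C⁻¹ n)_1 ∈ ℤ`, and `m + n = (1/2) (I m + 2i e_1)` (for `N = 1` one has to read
`m_1 = 0`). -/
def gordonForm (N σ : ℕ) (M : ℤ) (L : ℚ) : QPoly :=
  ∑ i ∈ Finset.Icc (0 : ℤ) M, qPow ((i : ℚ) ^ 2 / N) * qBinom (2 * L + M - i) (2 * L) *
    ∑ᶠ n ∈ restrictedSet N σ (2 * i),
      let m : Fin (N - 1) → ℚ := solveA ((2 * (i : ℚ)) • unitVec (N - 1) 1) (ratVec n)
      qPow (invForm n) * (∏ k, qBinom (m k + n k) (n k))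
        * qBinom (2 * L - i + coord m 1 0) i

/-- The double sum `∑_{i=0}^M ∑_{n=0, n+i+σ even}^i q^{(i²+n²)/2} [2L+M-i; 2L] [i; n] [2L-n; i]`. -/
def slaterForm (σ : ℕ) (M : ℤ) (L : ℚ) : QPoly :=
  ∑ i ∈ Finset.Icc (0 : ℤ) M, ∑ n ∈ (Finset.Icc (0 : ℤ) i).filter (fun n => Even (n + i + σ)),
    qPow (((i : ℚ) ^ 2 + (n : ℚ) ^ 2) / 2)
      * qBinom (2 * L + M - i) (2 * L) * qBinom i n * qBinom (2 * L - n) i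

/-- The value of an element of `ℤ[q^a : a ∈ ℚ]` at a positive real number `q = x`. -/
def evalAt (x : ℝ) (f : QPoly) : ℝ := f.coeff.sum fun a c => (c : ℝ) * x ^ (a : ℝ)

/-- The summand `x^{n²} (-x; x²)_n / (x²; x²)_n` of Slater's sum. -/
def slaterTerm (x : ℝ) (n : ℕ) : ℝ :=
  x ^ (n ^ 2) * (∏ k ∈ Finset.range n, (1 + x ^ (2 * k + 1)))
    / ∏ k ∈ Finset.range n, (1 - x ^ (2 * k + 2))

/-- The factor of Slater's product with the number `j + 1`:
`1 / ((1 - x^{8(j+1)-1}) (1 - x^{8(j+1)-4}) (1 - x^{8(j+1)-7}))`. -/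
def slaterFactor (x : ℝ) (j : ℕ) : ℝ :=
  1 / ((1 - x ^ (8 * j + 7)) * (1 - x ^ (8 * j + 4)) * (1 - x ^ (8 * j + 1)))

end

/-! All four families come from one transform, which expresses a level-`N` polynomial through
level-one polynomials; it is applied to four level-one polynomials that have closed forms.

Chains. In the sum over `η`, pass to `μ` and put `μ_0 = A`, `μ_N = B`. Then `2η` is the second
difference of `μ`, so `η C⁻¹ η` is a discrete Dirichlet sum: it equals `∑ (μ_k - μ_{k+1})²/4 - (A -
B)²/(4N)`. The congruence on `(C⁻¹η)_1` says that `μ_1 ≡ A + σ (mod 2)`. The Gaussian factors become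
`[(μ_{k-1} + μ_{k+1})/2; μ_k]`; they force chains with a non-zero contribution to be non-negative
and convex, which gives all finiteness statements (`finsum_restrictedSet`, `chain_congr`).

The transform. `chain_transform` rewrites a chain sum from `A` to `B`, with one binomial at each
end, as a sum over `m` of chain sums from `m` to `0` with two binomials at `μ_1`. It is proved by
induction on the length. The inductive step moves the variable `m` through one link of the chain by
`gz_kernel`, which is the product formula `gz_mul_gz` (of `q`-Saalschütz type) used once forwards
and once backwards. With `m = 2i`, the two binomials at `μ_1` are those of a level-one polynomial
with arguments `i` and `L - i + μ_1/2`, and the factor `q^{-(A-B)²/(4N)}` corrects the exponents.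
Summing over `j` gives `levelXsymm_eq_burge`: the parameters `(p, p', r, s)` at level one become
`(p, Np'+p, r, Ns+r)` at level `N`.

Closed forms. `X^{(1,2)}_{0,1}(M, L)` is multiplied by `q^{2L}` when `M` grows by one, hence equals
`δ_{L,0}`. The symmetry of the Gaussian polynomials exchanges `(p, r, M)` with `(p', s, L)`
(`burgeX_dual`). This duality and the case `N = 1` of the transform give `(2,1)`, `(1,3)`, `(3,1)`
and `(2,3)`. The level-`N` transforms of `(1,2)`, `(2,1)`, `(3,1)` and `(2,3)` are the four
families.

Slater's identity. A finite `q`-Gauss sum (`sum_mixedPoch`) yields both Bailey's lemma and a finite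
triple product. Two Bailey steps from the unit Bailey pair give `slater_finite`; letting `M → ∞` and
using the triple product again gives the identity. The double limit is dominated convergence, since
`S(x) + (-1)^σ S(-x)` selects the parity class of `n + i + σ` in the double sum. -/

/-! ### Monomials and `q`-factorials. -/

theorem qPow_zero : qPow 0 = 1 := rfl

theorem qPow_ne_zero (a : ℚ) : qPow a ≠ 0 := by
  intro h
  have h1 : qPow a * qPow (-a) = 1 := by rw [← qPow_add, add_neg_cancel, qPow_zero]
  rw [h, zero_mul] at h1
  exact zero_ne_one h1

theorem qPow_inj {a b : ℚ} : qPow a = qPow b ↔ a = b := by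
  constructor
  · intro h
    have := congrArg (fun f : QPoly => f.coeff) h
    simpa [qPow, Finsupp.single_left_inj] using this
  · rintro rfl; rfl

theorem one_sub_qPow_ne_zero {a : ℚ} (ha : a ≠ 0) : 1 - qPow a ≠ 0 := by
  rw [sub_ne_zero, ← qPow_zero]
  exact fun h => ha (qPow_inj.mp h).symm

theorem qFac_ne_zero (n : ℕ) : qFac n ≠ 0 :=
  Finset.prod_ne_zero_iff.mpr fun k _ => one_sub_qPow_ne_zero (by positivity)

/-! ### Gaussian polynomials with integer top entries. -/

/-- The falling product `(1 - q^n)(1 - q^{n-1}) ⋯ (1 - q^{n-k+1})`. -/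
noncomputable def qFall (n : ℤ) (k : ℕ) : QPoly :=
  ∏ i ∈ Finset.range k, (1 - qPow ((n : ℚ) - i))

theorem qFall_succ (n : ℤ) (k : ℕ) : qFall n (k + 1) = qFall n k * (1 - qPow ((n : ℚ) - k)) := by
  simp [qFall, Finset.prod_range_succ]

theorem qFall_succ' (n : ℤ) (k : ℕ) :
    qFall (n + 1) (k + 1) = qFall n k * (1 - qPow ((n : ℚ) + 1)) := by
  rw [qFall, Finset.prod_range_succ', qFall]
  congr 1
  · refine Finset.prod_congr rfl fun i _ => ?_
    congr 2; push_cast; ring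
  · push_cast; simp

theorem qFall_add (n : ℤ) (j k : ℕ) : qFall n (j + k) = qFall n j * qFall (n - j) k := by
  rw [qFall, Finset.prod_range_add, qFall, qFall]
  congr 1
  refine Finset.prod_congr rfl fun i _ => ?_
  congr 2; push_cast; ring

theorem gauss_mul_qFac_eq_qFall : ∀ n k : ℕ, gauss n k * qFac k = qFall n k
  | n, 0 => by cases n <;> simp [gauss, qFac, qFall]
  | 0, k + 1 => by
      simp only [gauss, zero_mul, qFall]
      rw [Finset.prod_eq_zero (Finset.mem_range.mpr k.succ_pos)]
      simp [qPow_zero]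
  | n + 1, k + 1 => by
      have h1 := gauss_mul_qFac_eq_qFall n k
      have h2 := gauss_mul_qFac_eq_qFall n (k + 1)
      have h3 : qPow ((n : ℚ) + 1) = qPow ((k : ℚ) + 1) * qPow ((n : ℚ) - k) := by
        rw [← qPow_add]; congr 1; ring
      have h4 := qFall_succ' n k
      rw [qFall_succ] at h2
      push_cast at h2 h4 ⊢
      rw [h4, gauss, h3]
      linear_combination gauss n k * qFac_succ k + (1 - qPow ((k : ℚ) + 1)) * h1
        + qPow ((k : ℚ) + 1) * h2

/-- The Gaussian polynomial with an integer top entry of either sign, in the polynomial convention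
`(1 - q^n) ⋯ (1 - q^{n-k+1}) / (q)_k`; it is zero for negative bottom entries. -/
noncomputable def gz (n k : ℤ) : QPoly :=
  if k < 0 then 0
  else if 0 ≤ n then gauss n.toNat k.toNat
  else (-1) ^ k.toNat * qPow (n * k - k * (k - 1) / 2) * gauss (k - n - 1).toNat k.toNat

theorem gz_of_neg {n k : ℤ} (h : k < 0) : gz n k = 0 := by rw [gz, if_pos h]

theorem gz_natCast (n k : ℕ) : gz n k = gauss n k := by
  rw [gz, if_neg (by omega), if_pos (by omega)]; simp

theorem qFall_neg (n : ℤ) (k : ℕ) :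
    qFall n k = (-1) ^ k * qPow (n * k - k * (k - 1) / 2) * qFall (k - n - 1) k := by
  have h1 : qFall (k - n - 1) k = ∏ i ∈ Finset.range k, (1 - qPow ((i : ℚ) - n)) := by
    rw [qFall, ← Finset.prod_range_reflect]
    refine Finset.prod_congr rfl fun i hi => ?_
    have : i + 1 ≤ k := Finset.mem_range.mp hi
    rw [show k - 1 - i = k - (i + 1) by omega, Nat.cast_sub this]
    congr 2; push_cast; ring
  rw [h1]
  clear h1
  induction k with
  | zero => simp [qFall, qPow_zero]
  | succ k ih =>
    have e : qPow ((n : ℚ) * ((k + 1 : ℕ) : ℚ) - ((k + 1 : ℕ) : ℚ) * (((k + 1 : ℕ) : ℚ) - 1) / 2)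
        = qPow (n * k - k * (k - 1) / 2) * qPow (n - k) := by
      rw [← qPow_add]; congr 1; push_cast; ring
    have e2 : qPow ((n : ℚ) - k) * qPow ((k : ℚ) - n) = 1 := by
      rw [← qPow_add, ← qPow_zero]; congr 1; ring
    rw [qFall_succ, ih, e, Finset.prod_range_succ, pow_succ]
    linear_combination (-1) * (-1) ^ k * qPow (n * k - k * (k - 1) / 2)
      * (∏ i ∈ Finset.range k, (1 - qPow ((i : ℚ) - n))) * e2

theorem gz_mul_qFac (n : ℤ) (k : ℕ) : gz n k * qFac k = qFall n k := by
  rw [gz, if_neg (by omega)]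
  split_ifs with h
  · obtain ⟨m, rfl⟩ := Int.eq_ofNat_of_zero_le h
    simpa using gauss_mul_qFac_eq_qFall m k
  · have h2 := gauss_mul_qFac_eq_qFall ((k : ℤ) - n - 1).toNat k
    rw [Int.toNat_of_nonneg (by omega)] at h2
    rw [qFall_neg, ← h2]
    simp only [Int.toNat_natCast, Int.cast_natCast]
    ring

theorem gz_zero_right (n : ℤ) : gz n 0 = 1 := by
  have := gz_mul_qFac n 0
  simpa [qFac, qFall] using this

theorem gz_eq_zero_of_lt {n k : ℤ} (hn : 0 ≤ n) (h : n < k) : gz n k = 0 := by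
  obtain ⟨m, rfl⟩ := Int.eq_ofNat_of_zero_le hn
  obtain ⟨l, rfl⟩ := Int.eq_ofNat_of_zero_le (hn.trans h.le)
  rw [gz_natCast, gauss_eq_zero_of_lt _ _ (by omega)]

theorem gz_pascal (n k : ℤ) : gz (n + 1) (k + 1) = gz n k + qPow (k + 1) * gz n (k + 1) := by
  rcases lt_trichotomy k (-1) with h | rfl | h
  · simp [gz_of_neg, show k < 0 by omega, show k + 1 < 0 by omega]
  · simp [gz_of_neg, gz_zero_right, qPow_zero]
  · obtain ⟨k, rfl⟩ := Int.eq_ofNat_of_zero_le (show 0 ≤ k by omega)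
    apply mul_right_cancel₀ (qFac_ne_zero (k + 1))
    have h0 := gz_mul_qFac (n + 1) (k + 1)
    have h1 := gz_mul_qFac n (k + 1)
    have h2 := gz_mul_qFac n k
    have h3 : qPow ((n : ℚ) + 1) = qPow ((k : ℚ) + 1) * qPow ((n : ℚ) - k) := by
      rw [← qPow_add]; congr 1; ring
    rw [qFall_succ'] at h0
    rw [qFall_succ] at h1
    push_cast at *
    rw [h0, h3]
    linear_combination (-1) * gz n k * qFac_succ k - (1 - qPow ((k : ℚ) + 1)) * h2
      - qPow ((k : ℚ) + 1) * h1

theorem gz_pascal' (n k : ℤ) : gz (n + 1) (k + 1) = qPow (n - k) * gz n k + gz n (k + 1) := by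
  rcases lt_trichotomy k (-1) with h | rfl | h
  · simp [gz_of_neg, show k < 0 by omega, show k + 1 < 0 by omega]
  · simp [gz_of_neg, gz_zero_right]
  · obtain ⟨k, rfl⟩ := Int.eq_ofNat_of_zero_le (show 0 ≤ k by omega)
    apply mul_right_cancel₀ (qFac_ne_zero (k + 1))
    have h0 := gz_mul_qFac (n + 1) (k + 1)
    have h1 := gz_mul_qFac n (k + 1)
    have h2 := gz_mul_qFac n k
    have h3 : qPow ((n : ℚ) + 1) = qPow ((k : ℚ) + 1) * qPow ((n : ℚ) - k) := by
      rw [← qPow_add]; congr 1; ring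
    rw [qFall_succ'] at h0
    rw [qFall_succ] at h1
    push_cast at *
    rw [h0, h3]
    linear_combination (-1) * qPow ((n : ℚ) - k) * gz n k * qFac_succ k
      - qPow ((n : ℚ) - k) * (1 - qPow ((k : ℚ) + 1)) * h2 - h1

theorem gz_add_mul_gz (n : ℤ) (j k : ℕ) :
    gz n (j + k : ℕ) * gz (j + k : ℕ) j = gz n j * gz (n - j) k := by
  apply mul_right_cancel₀ (mul_ne_zero (qFac_ne_zero j) (qFac_ne_zero k))
  have h1 := gz_mul_qFac n (j + k)
  have h2 := gauss_mul_qFac j k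
  have h3 := gz_mul_qFac n j
  have h4 := gz_mul_qFac (n - j) k
  rw [qFall_add] at h1
  rw [gz_natCast]
  linear_combination gz n (j + k : ℕ) * h2 + h1 - gz (n - j) k * qFac k * h3 - qFall n j * h4

theorem gz_symm {n : ℤ} (hn : 0 ≤ n) (k : ℤ) : gz n (n - k) = gz n k := by
  rcases lt_or_ge k 0 with h | h
  · rw [gz_of_neg h, gz_eq_zero_of_lt hn (by omega)]
  rcases lt_or_ge n k with h' | h'
  · rw [gz_of_neg (by omega), gz_eq_zero_of_lt hn h']
  obtain ⟨k, rfl⟩ := Int.eq_ofNat_of_zero_le h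
  obtain ⟨l, rfl⟩ : ∃ l : ℕ, n = k + l := ⟨(n - k).toNat, by simp at *; omega⟩
  simp only [add_sub_cancel_left]
  rw [← Nat.cast_add, gz_natCast, gz_natCast]
  apply mul_right_cancel₀ (mul_ne_zero (qFac_ne_zero k) (qFac_ne_zero l))
  have h1 := gauss_mul_qFac k l
  have h2 := gauss_mul_qFac l k
  rw [add_comm l k] at h2
  linear_combination h2 - h1

/-! ### `q`-Vandermonde, `q`-Saalschütz and the kernel identity. -/

/-- The recurrence determines row `n + 1` from row `n`. It also runs backwards, one column at a
time, because the power of `q` in front of `F n (k + 1)` can be cancelled; so the row `0` and the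
column `0` fix everything. -/
theorem pascal_unique {F G : ℤ → ℕ → QPoly}
    (hF : ∀ n k, F (n + 1) (k + 1) = F n k + qPow ((k : ℚ) + 1) * F n (k + 1))
    (hG : ∀ n k, G (n + 1) (k + 1) = G n k + qPow ((k : ℚ) + 1) * G n (k + 1))
    (hF0 : ∀ n, F n 0 = 1) (hG0 : ∀ n, G n 0 = 1) (h : ∀ k, F 0 k = G 0 k) (n : ℤ) (k : ℕ) :
    F n k = G n k := by
  induction n using Int.induction_on generalizing k with
  | zero => exact h k
  | succ n ih =>
    cases k with
    | zero => rw [hF0, hG0]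
    | succ k => rw [hF, hG, ih, ih]
  | pred n ih =>
    induction k with
    | zero => rw [hF0, hG0]
    | succ k ihk =>
      have h1 := hF (-n - 1) k
      have h2 := hG (-n - 1) k
      rw [sub_add_cancel, ih, ihk] at h1
      rw [sub_add_cancel] at h2
      exact mul_left_cancel₀ (qPow_ne_zero _) (add_left_cancel (h1.symm.trans h2))

/-- The `q`-Vandermonde sum for integer top entries. -/
theorem gz_vandermonde (n m : ℤ) (t : ℕ) :
    gz (n + m) t = ∑ k ∈ Finset.range (t + 1),
      qPow (((t : ℚ) - k) * (n - k)) * gz n k * gz m ((t : ℤ) - k) := by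
  refine pascal_unique (F := fun n t => gz (n + m) t) (G := fun n t => ∑ k ∈ Finset.range (t + 1),
      qPow (((t : ℚ) - k) * (n - k)) * gz n k * gz m ((t : ℤ) - k)) ?_ ?_ ?_ ?_ ?_ n t
  · intro n k
    have := gz_pascal (n + m) k
    rw [show n + 1 + m = n + m + 1 by ring]
    push_cast at this ⊢
    exact this
  · intro n t
    rw [Finset.sum_range_succ', Finset.sum_range_succ' _ (t + 1), mul_add, Finset.mul_sum,
      ← add_assoc, ← Finset.sum_add_distrib]
    congr 1
    · refine Finset.sum_congr rfl fun k _ => ?_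
      have := gz_pascal n k
      have e : qPow ((((t + 1 : ℕ) : ℚ) - (k + 1 : ℕ)) * ((n + 1 : ℤ) - (k + 1 : ℕ)))
          = qPow (((t : ℚ) - k) * (n - k)) := by congr 1; push_cast; ring
      have e2 : qPow (((t : ℚ) - k) * (n - k)) * qPow ((k : ℚ) + 1)
          = qPow ((t : ℚ) + 1) * qPow ((((t + 1 : ℕ) : ℚ) - (k + 1 : ℕ)) * (n - (k + 1 : ℕ))) := by
        rw [← qPow_add, ← qPow_add]; congr 1; push_cast; ring
      have e3 : ((t + 1 : ℕ) : ℤ) - (k + 1 : ℕ) = t - k := by push_cast; ring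
      rw [e, e3]
      push_cast at this e2 ⊢
      rw [this]
      linear_combination gz n (k + 1) * gz m (t - k) * e2
    · simp only [Nat.cast_zero, gz_zero_right, mul_one, ← mul_assoc, ← qPow_add]
      congr 2; push_cast; ring
  · intro n; simp [gz_zero_right]
  · intro n; simp [gz_zero_right, qPow_zero]
  · intro t
    rw [Finset.sum_range_succ', Finset.sum_eq_zero]
    · simp [gz_zero_right, qPow_zero]
    · intro k _
      rw [gz_eq_zero_of_lt le_rfl (by push_cast; omega)]
      simp

theorem gz_vandermonde' (n m : ℤ) (t : ℕ) :
    gz (n + m) t = ∑ k ∈ Finset.range (t + 1),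
      qPow ((k : ℚ) * (m - t + k)) * gz n k * gz m ((t : ℤ) - k) := by
  rw [add_comm, gz_vandermonde, ← Finset.sum_range_reflect]
  refine Finset.sum_congr rfl fun k hk => ?_
  have hk' : k ≤ t := by simpa [Nat.lt_succ_iff] using hk
  rw [show t + 1 - 1 - k = t - k by omega, Nat.cast_sub hk', Nat.cast_sub hk']
  simp only [sub_sub_cancel]
  rw [mul_right_comm]
  congr 3; ring

theorem sum_range_extend {M : Type*} [AddCommMonoid M] {f : ℕ → M} {s t : ℕ} (h : s ≤ t)
    (hf : ∀ k, s < k → f k = 0) :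
    ∑ k ∈ Finset.range (s + 1), f k = ∑ k ∈ Finset.range (t + 1), f k :=
  Finset.sum_subset (Finset.range_subset_range.mpr (by omega))
    fun k _ hk => hf k (by simpa [Nat.lt_succ_iff] using hk)

/-- Vandermonde with a range that does not depend on `k`: the extra terms have `j > k` and vanish.
This allows an interchange with an outer sum over `k`. -/
theorem gz_add_natCast (x T : ℤ) {k t : ℕ} (hk : k ≤ t) :
    gz (x + k) T = ∑ j ∈ Finset.range (t + 1),
      qPow ((j : ℚ) * (x - T + j)) * gz k j * gz x (T - j) := by
  rcases lt_or_ge T 0 with h | h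
  · rw [gz_of_neg h, Finset.sum_eq_zero]
    intro j _
    rw [gz_of_neg (show T - j < 0 by omega), mul_zero]
  obtain ⟨T, rfl⟩ := Int.eq_ofNat_of_zero_le h
  rw [add_comm, gz_vandermonde' k x T, sum_range_extend (le_max_left T t),
    ← sum_range_extend (le_max_right T t)]
  · push_cast; rfl
  · intro j hj
    rw [gz_eq_zero_of_lt (n := k) (by omega) (by omega)]; simp
  · intro j hj
    rw [gz_of_neg (show (T : ℤ) - j < 0 by omega), mul_zero]

/-- The `q`-analogue of Nanjundiah's product formula (a form of the `q`-Pfaff–Saalschütz sum). -/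
theorem gz_mul_gz (x y s : ℤ) {t T : ℕ} (hT : t ≤ T) :
    gz x s * gz y t = ∑ k ∈ Finset.range (T + 1),
      qPow (((t : ℚ) - k) * (s - x + y - k)) * gz (s - x + y) k * gz (t + x - y) ((t : ℤ) - k)
        * gz (x + k) (s + t) := by
  rw [← sum_range_extend hT fun k hk => by
    rw [gz_of_neg (show (t : ℤ) - k < 0 by omega)]; simp]
  set n := s - x + y with hn
  -- Trinomial revision, to be applied after `[y; t]` has been expanded by Vandermonde with `y = n +
  -- (x - s)`.
  have hrev : ∀ j ∈ Finset.range (t + 1),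
      gz x s * gz (x - s) ((t : ℤ) - j) = gz x (s + t - j) * gz (s + t - j) ((t : ℤ) - j) := by
    intro j hj
    have hj' : j ≤ t := by simpa [Nat.lt_succ_iff] using hj
    rcases lt_or_ge s 0 with h | h
    · rw [gz_of_neg h, zero_mul]
      rcases lt_or_ge (s + t - j) 0 with h2 | h2
      · rw [gz_of_neg h2, zero_mul]
      · rw [gz_eq_zero_of_lt h2 (by omega), mul_zero]
    · obtain ⟨s', rfl⟩ := Int.eq_ofNat_of_zero_le h
      have h1 := gz_add_mul_gz x s' (t - j)
      have h2 := gz_symm (n := ((s' + (t - j) : ℕ) : ℤ)) (by omega) s'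
      push_cast [Nat.cast_sub hj'] at h1 h2 ⊢
      rw [← h1, ← h2]
      rw [show (s' : ℤ) + t - j = s' + (t - j) by ring]
      congr 2; ring
  have hL : gz x s * gz y t = ∑ j ∈ Finset.range (t + 1), qPow ((j : ℚ) * (x - s - t + j))
      * gz n j * (gz x (s + t - j) * gz (s + t - j) ((t : ℤ) - j)) := by
    rw [show y = n + (x - s) by rw [hn]; ring, gz_vandermonde', Finset.mul_sum]
    refine Finset.sum_congr rfl fun j hj => ?_
    rw [← hrev j hj]
    push_cast; ring
  rw [hL]
  -- On the right the factor `[x + k; s + t]` is expanded over `j`, and `[n; k][k; j]` is revised so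
  -- that the `k`-sum for fixed `j` becomes a Vandermonde sum.
  have hR : ∀ k ∈ Finset.range (t + 1),
      qPow (((t : ℚ) - k) * (s - x + y - k)) * gz n k * gz (t + x - y) ((t : ℤ) - k)
        * gz (x + k) (s + t)
      = ∑ j ∈ Finset.range (t + 1), qPow ((j : ℚ) * (x - s - t + j)) * gz n j * gz x (s + t - j)
        * (qPow (((t : ℚ) - k) * (s - x + y - k)) * gz (n - j) ((k : ℤ) - j)
          * gz (t + x - y) ((t : ℤ) - k)) := by
    intro k hk
    rw [gz_add_natCast x (s + t) (show k ≤ t by simpa [Nat.lt_succ_iff] using hk), Finset.mul_sum]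
    refine Finset.sum_congr rfl fun j _ => ?_
    have : gz n k * gz k j = gz n j * gz (n - j) ((k : ℤ) - j) := by
      rcases le_or_gt j k with h | h
      · have := gz_add_mul_gz n j (k - j)
        rw [Nat.add_sub_cancel' h, Nat.cast_sub h] at this
        exact this
      · rw [gz_eq_zero_of_lt (n := k) (by omega) (by omega), gz_of_neg (n := n - j) (by omega)]
        simp
    have e : qPow ((j : ℚ) * (x - (s + t : ℤ) + j)) = qPow ((j : ℚ) * (x - s - t + j)) := by
      congr 1; push_cast; ring
    rw [e]
    linear_combination qPow (((t : ℚ) - k) * (s - x + y - k)) * gz (t + x - y) ((t : ℤ) - k)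
      * qPow ((j : ℚ) * (x - s - t + j)) * gz x (s + t - j) * this
  rw [Finset.sum_congr rfl hR, Finset.sum_comm]
  refine Finset.sum_congr rfl fun j hj => ?_
  have hj' : j ≤ t := by simpa [Nat.lt_succ_iff] using hj
  rw [← mul_assoc, ← Finset.mul_sum]
  congr 1
  have hv := gz_vandermonde (n - j) (t + x - y) (t - j)
  rw [show n - j + (t + x - y) = s + t - j by rw [hn]; ring, Nat.cast_sub hj'] at hv
  rw [hv, ← Finset.sum_range_add_sum_Ico _ (show j ≤ t + 1 by omega),
    Finset.sum_eq_zero (s := Finset.range j), zero_add, Finset.sum_Ico_eq_sum_range,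
      show t + 1 - j = t - j + 1 by omega]
  · refine Finset.sum_congr rfl fun k _ => ?_
    have e : (((t - j : ℕ) : ℚ) - k) * ((n - j : ℤ) - k)
        = ((t : ℚ) - (j + k : ℕ)) * (s - x + y - (j + k : ℕ)) := by
      rw [Nat.cast_sub hj', hn]; push_cast; ring
    rw [e, show ((j + k : ℕ) : ℤ) - j = k by push_cast; ring,
      show (t : ℤ) - (j + k : ℕ) = t - j - k by push_cast; ring]
  · intro k hk
    rw [gz_of_neg (show (k : ℤ) - j < 0 by have := Finset.mem_range.mp hk; omega)]; simp

set_option maxHeartbeats 1000000 in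
/-- The transformation which moves the summation variable through a chain of `q`-binomials. -/
theorem gz_kernel (A : ℕ) (B m p r v : ℤ) :
    ∑ i ∈ Finset.range (A + 1), qPow ((2 * i - A + B - m) ^ 2 / 4)
        * gz (p + r - m + A - i) (A - i) * gz p i * gz r (i + B - A) * gz (i + v) m
      = ∑ k ∈ Finset.range (A + 1), qPow ((A + B - 2 * k - m) ^ 2 / 4) * gz (r + k) B
        * gz (p - m + B) k * gz (p - m - k + A + v) (A - k) * gz v (m + k - A) := by
  have h1 : ∀ i ∈ Finset.range (A + 1), qPow (((2 : ℚ) * i - A + B - m) ^ 2 / 4)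
        * gz (p + r - m + A - i) (A - i) * gz p i * gz r (i + B - A) * gz (i + v) m
      = ∑ k ∈ Finset.range (A + 1), qPow (((A : ℚ) + B - 2 * k - m) ^ 2 / 4) * gz (r + k) B
        * gz (p - m + B) k * (qPow (((A : ℚ) - k - i) * (p - i)) * gz p i
          * gz (m - p) ((A : ℤ) - k - i) * gz (v + i) m) := by
    intro i hi
    have hi' : i ≤ A := by simpa [Nat.lt_succ_iff] using hi
    -- Forward use: the two binomials with `r` in the top entry are linearized in `k`, so that `i`
    -- remains only in factors matching the right side of the same formula.
    have h := gz_mul_gz r (p + r - m + A - i) (i + B - A) (Nat.sub_le A i)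
    rw [Nat.cast_sub hi'] at h
    have : ∀ a b c d e : QPoly, a * b * c * d * e = a * c * e * (d * b) := by intros; ring
    rw [this, h, Finset.mul_sum]
    refine Finset.sum_congr rfl fun k _ => ?_
    rw [show (i : ℤ) + B - A - r + (p + r - m + A - i) = p - m + B by ring,
      show (A : ℤ) - i + r - (p + r - m + A - i) = m - p by ring,
      show (i : ℤ) + B - A + (A - i) = B by ring, add_comm (i : ℤ) v,
      show (A : ℤ) - k - i = A - i - k by ring]
    have e : qPow (((2 : ℚ) * i - A + B - m) ^ 2 / 4) * qPow ((((A - i : ℕ) : ℚ) - k)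
          * ((i + B - A : ℤ) - r + (p + r - m + A - i : ℤ) - k))
        = qPow (((A : ℚ) + B - 2 * k - m) ^ 2 / 4) * qPow (((A : ℚ) - k - i) * (p - i)) := by
      rw [← qPow_add, ← qPow_add, Nat.cast_sub hi']; congr 1; push_cast; ring
    linear_combination gz p i * gz (v + i) m * gz (p - m + B) k * gz (m - p) ((A : ℤ) - i - k)
      * gz (r + k) B * e
  rw [Finset.sum_congr rfl h1, Finset.sum_comm]
  refine Finset.sum_congr rfl fun k hk => ?_
  have hk' : k ≤ A := by simpa [Nat.lt_succ_iff] using hk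
  -- Backward use: for fixed `k` the sum over `i` is the expansion of a product of two binomials.
  have h := gz_mul_gz v (p - m - k + A + v) (m + k - A) (Nat.sub_le A k)
  rw [Nat.cast_sub hk'] at h
  have h2 : ∀ a b c d e : QPoly, a * b * c * d * e = a * b * c * (e * d) := by intros; ring
  rw [← Finset.mul_sum, h2, h]
  congr 1
  refine Finset.sum_congr rfl fun i _ => ?_
  rw [show m + k - A - v + (p - m - k + A + v) = p by ring,
    show (A : ℤ) - k + v - (p - m - k + A + v) = m - p by ring,
    show m + k - A + ((A : ℤ) - k) = m by ring]
  congr 4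
  push_cast [Nat.cast_sub hk']; ring

/-! ### Half-integral entries and chain sums. -/

/-- The Gaussian polynomial with top entry `n/2` and bottom entry `k/2`, zero unless both are
integers. -/
noncomputable def hb (n k : ℤ) : QPoly := if Even n ∧ Even k then gz (n / 2) (k / 2) else 0

theorem hb_two_mul (a b : ℤ) : hb (2 * a) (2 * b) = gz a b := by
  rw [hb, if_pos ⟨even_two_mul a, even_two_mul b⟩]; simp

theorem exists_of_hb_ne_zero {n k : ℤ} (h : hb n k ≠ 0) :
    ∃ a b, n = 2 * a ∧ k = 2 * b ∧ 0 ≤ b ∧ (0 ≤ a → b ≤ a) := by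
  rw [hb] at h
  split_ifs at h with h'
  · obtain ⟨⟨a, rfl⟩, ⟨b, rfl⟩⟩ := h'
    refine ⟨a, b, by ring, by ring, ?_, fun ha => ?_⟩
    · by_contra hb
      exact h (gz_of_neg (by omega))
    · by_contra hb
      exact h (gz_eq_zero_of_lt (by omega) (by omega))
  · exact absurd rfl h

theorem hb_zero_right {n : ℤ} (h : Even n) : hb n 0 = 1 := by
  rw [hb, if_pos ⟨h, by simp⟩]; simp [gz_zero_right]

/-- The sum over chains `A = μ_0, μ_1, …, μ_n, μ_{n+1} = B` with `0 ≤ μ_k ≤ K` of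
`q^{∑ (μ_k - μ_{k+1})² / 4} ∏ [(μ_{k-1} + μ_{k+1}) / 2; μ_k] f(μ_1) g(μ_n)`. -/
noncomputable def chain (K : ℤ) : ℕ → ℤ → ℤ → (ℤ → QPoly) → (ℤ → QPoly) → QPoly
  | 0, A, B, f, g => qPow ((A - B) ^ 2 / 4) * f B * g A
  | n + 1, A, B, f, g => ∑ c ∈ Finset.Icc 0 K,
      qPow ((B - c) ^ 2 / 4) * g c * chain K n A c f (fun d => hb (d + B) (2 * c))

theorem chain_mul_left (K : ℤ) (n : ℕ) (A B : ℤ) (a : QPoly) (f g : ℤ → QPoly) :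
    chain K n A B (fun d => a * f d) g = a * chain K n A B f g := by
  induction n generalizing B g with
  | zero => simp only [chain]; ring
  | succ n ih =>
    simp only [chain, ih, Finset.mul_sum]
    exact Finset.sum_congr rfl fun _ _ => by ring

theorem chain_sum_left {ι : Type*} (s : Finset ι) (K : ℤ) (n : ℕ) (A B : ℤ)
    (F : ι → ℤ → QPoly) (g : ℤ → QPoly) :
    chain K n A B (fun d => ∑ i ∈ s, F i d) g = ∑ i ∈ s, chain K n A B (F i) g := by
  induction n generalizing B g with
  | zero => simp only [chain, Finset.sum_mul, Finset.mul_sum]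
  | succ n ih =>
    simp only [chain, ih, Finset.mul_sum]
    exact Finset.sum_comm

theorem chain_sub_left (K : ℤ) (n : ℕ) (A B : ℤ) (f f' g : ℤ → QPoly) :
    chain K n A B (fun d => f d - f' d) g = chain K n A B f g - chain K n A B f' g := by
  induction n generalizing B g with
  | zero => simp only [chain]; ring
  | succ n ih =>
    simp only [chain, ih, ← Finset.sum_sub_distrib]
    exact Finset.sum_congr rfl fun _ _ => by ring

theorem chain_succ_left (K : ℤ) (n : ℕ) (A B : ℤ) (f g : ℤ → QPoly) :
    chain K (n + 1) A B f g = ∑ c ∈ Finset.Icc 0 K,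
      qPow ((A - c) ^ 2 / 4) * f c * chain K n c B (fun d => hb (A + d) (2 * c)) g := by
  induction n generalizing B g with
  | zero =>
    simp only [chain]
    exact Finset.sum_congr rfl fun _ _ => by ring_nf
  | succ n ih =>
    rw [chain]
    simp only [ih]
    simp only [chain, Finset.mul_sum]
    rw [Finset.sum_comm]
    exact Finset.sum_congr rfl fun _ _ => Finset.sum_congr rfl fun _ _ => by ring

theorem chain_flip (K : ℤ) (n : ℕ) (A B : ℤ) (f g : ℤ → QPoly) :
    chain K n A B f g = chain K n B A g f := by
  induction n generalizing B g with
  | zero =>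
    simp only [chain, show ((A : ℚ) - B) ^ 2 = (B - A) ^ 2 by ring]; ring
  | succ n ih =>
    rw [chain, chain_succ_left]
    refine Finset.sum_congr rfl fun c _ => ?_
    rw [ih]
    simp only [add_comm]

/-- A chain sum depends only on the values of `f(μ_1) g(μ_n)` which are compatible with the
convexity of the chain. -/
theorem chain_congr {K : ℤ} {n : ℕ} {A B : ℤ} {f g f' g' : ℤ → QPoly} (hA : 0 ≤ A) (hB : 0 ≤ B)
    (h : ∀ x y, 0 ≤ x → x ≤ max A B → 0 ≤ y → y ≤ max A B → x + y ≤ A + B →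
      f x * g y = f' x * g' y) : chain K n A B f g = chain K n A B f' g' := by
  induction n generalizing B f g f' g' with
  | zero =>
    simp only [chain, mul_assoc]
    rw [h B A hB (le_max_right _ _) hA (le_max_left _ _) (by omega)]
  | succ n ih =>
    rw [chain, chain]
    refine Finset.sum_congr rfl fun c hc => ?_
    rw [mul_assoc, mul_assoc, ← chain_mul_left (a := g c), ← chain_mul_left (a := g' c)]
    congr 1
    refine ih (Finset.mem_Icc.mp hc).1 fun x y hx hx' hy hy' hxy => ?_
    by_cases h0 : hb (y + B) (2 * c) = 0
    · simp [h0]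
    · obtain ⟨a, b, h1, h2, h3, h4⟩ := exists_of_hb_ne_zero h0
      have h5 := h4 (by omega)
      have := h x c hx (by omega) (Finset.mem_Icc.mp hc).1 (by omega) (by omega)
      linear_combination hb (y + B) (2 * c) * this

theorem chain_eq_zero {K : ℤ} {n : ℕ} {A B : ℤ} {f g : ℤ → QPoly} (hA : 0 ≤ A) (hB : 0 ≤ B)
    (h : ∀ x y, 0 ≤ x → x ≤ max A B → 0 ≤ y → y ≤ max A B → x + y ≤ A + B →
      f x * g y = 0) : chain K n A B f g = 0 := by
  rw [chain_congr (f' := fun _ => 0 * 0) (g' := g) hA hB (by simpa using h), chain_mul_left,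
    zero_mul]

/-! ### The transformation of chains. -/

theorem sum_Icc_eq_sum_range {M : Type*} [AddCommMonoid M] (F : ℤ → M) (lo hi e : ℤ) (A : ℕ)
    (h1 : ∀ x, lo ≤ x → x ≤ hi → F x ≠ 0 → ∃ i : ℕ, i ≤ A ∧ x = 2 * i + e)
    (h2 : ∀ i : ℕ, i ≤ A → F (2 * i + e) ≠ 0 → lo ≤ 2 * i + e ∧ 2 * i + e ≤ hi) :
    ∑ x ∈ Finset.Icc lo hi, F x = ∑ i ∈ Finset.range (A + 1), F (2 * i + e) := by
  symm
  refine Finset.sum_bij_ne_zero (fun i _ _ => 2 * (i : ℤ) + e) ?_ ?_ ?_ ?_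
  · intro i hi h
    exact Finset.mem_Icc.mpr (h2 i (by simpa [Nat.lt_succ_iff] using hi) h)
  · intro i _ _ j _ _ h
    omega
  · intro x hx h
    obtain ⟨i, hi, rfl⟩ := h1 x (Finset.mem_Icc.mp hx).1 (Finset.mem_Icc.mp hx).2 h
    exact ⟨i, by simpa [Nat.lt_succ_iff] using hi, h, rfl⟩
  · intro i _ _; rfl

/-- This is `gz_kernel` with the parity conditions built into the summands. It exchanges the
variable `x` on the left of `m` in a chain for the variable `c` at the other end. -/
theorem hb_kernel {A B m n : ℤ} (α β : ℤ) (hA : 0 ≤ A) (hAB : A ≤ B) (hn : 0 ≤ n) (hnm : n ≤ m) :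
    ∑ x ∈ Finset.Icc 0 (A + B), hb (α + β + A + B - x) (A + B - x) * (qPow ((x - m) ^ 2 / 4)
        * (hb (α + m) (x + A - B) * hb (β + m) (x - A + B)) * hb (x + n) (2 * m))
      = ∑ c ∈ Finset.Icc 0 B, qPow ((B - c) ^ 2 / 4) * hb (β + A + c) (2 * B)
        * (hb (α + 2 * B - m) (A + c - m)
          * (hb (α + B - c + n) (m + A - c) * hb (n - A + B) (m - A + c))) := by
  -- A non-zero term on either side forces these three parities, so without them both sums vanish.
  -- With them the variables run through `x = 2i + B - A` and `c = 2k + m - A`.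
  by_cases hpar : Even (α + m) ∧ Even (β + m) ∧ Even (n - A + B)
  · obtain ⟨A, rfl⟩ := Int.eq_ofNat_of_zero_le hA
    obtain ⟨⟨p, hp⟩, ⟨r, hr⟩, ⟨v, hv⟩⟩ := hpar
    obtain rfl : α = 2 * p - m := by omega
    obtain rfl : β = 2 * r - m := by omega
    obtain rfl : n = 2 * v + A - B := by omega
    rw [sum_Icc_eq_sum_range _ 0 (A + B) (B - A) A, sum_Icc_eq_sum_range _ 0 B (m - A) A]
    · have h := gz_kernel A B m p r v
      refine Eq.trans (Eq.trans (Finset.sum_congr rfl fun i _ => ?_) h)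
        (Finset.sum_congr rfl fun k _ => ?_)
      · rw [show 2 * p - m + (2 * r - m) + A + B - (2 * i + (B - A)) = 2 * (p + r - m + A - i) by
            ring, show (A : ℤ) + B - (2 * i + (B - A)) = 2 * (A - i) by ring,
          show 2 * p - m + m = 2 * p by ring, show 2 * r - m + m = 2 * r by ring,
          show 2 * (i : ℤ) + (B - A) + A - B = 2 * i by ring,
          show 2 * (i : ℤ) + (B - A) - A + B = 2 * (i + B - A) by ring,
          show 2 * (i : ℤ) + (B - A) + (2 * v + A - B) = 2 * (i + v) by ring]
        simp only [hb_two_mul]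
        rw [show (((2 * (i : ℤ) + (B - A) : ℤ) : ℚ) - m) ^ 2 / 4 = (2 * i - A + B - m) ^ 2 / 4 by
          push_cast; ring]
        ring
      · rw [show 2 * r - m + A + (2 * k + (m - A)) = 2 * (r + k) by ring,
          show 2 * p - m + 2 * B - m = 2 * (p - m + B) by ring,
          show (A : ℤ) + (2 * k + (m - A)) - m = 2 * k by ring,
          show 2 * p - m + B - (2 * k + (m - A)) + (2 * v + A - B) = 2 * (p - m - k + A + v) by
            ring,
          show m + A - (2 * (k : ℤ) + (m - A)) = 2 * (A - k) by ring,
          show 2 * v + A - B - A + B = 2 * v by ring,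
          show m - A + (2 * (k : ℤ) + (m - A)) = 2 * (m + k - A) by ring]
        simp only [hb_two_mul]
        rw [show ((B : ℚ) - (2 * (k : ℤ) + (m - A) : ℤ)) ^ 2 / 4 = (A + B - 2 * k - m) ^ 2 / 4 by
          push_cast; ring]
        ring
    · intro c h0 h1 hne
      obtain ⟨a1, b1, h11, h12, h13, h14⟩ := exists_of_hb_ne_zero
        (left_ne_zero_of_mul (right_ne_zero_of_mul hne))
      obtain ⟨a2, b2, h21, h22, h23, h24⟩ := exists_of_hb_ne_zero
        (left_ne_zero_of_mul (right_ne_zero_of_mul (right_ne_zero_of_mul hne)))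
      exact ⟨b1.toNat, by omega, by omega⟩
    · intro k hk hne
      obtain ⟨a2, b2, h21, h22, h23, h24⟩ := exists_of_hb_ne_zero
        (right_ne_zero_of_mul (right_ne_zero_of_mul (right_ne_zero_of_mul hne)))
      have := h24 (by omega)
      omega
    · intro x h0 h1 hne
      obtain ⟨a1, b1, h11, h12, h13, h14⟩ := exists_of_hb_ne_zero (left_ne_zero_of_mul hne)
      obtain ⟨a2, b2, h21, h22, h23, h24⟩ := exists_of_hb_ne_zero (left_ne_zero_of_mul
        (right_ne_zero_of_mul (left_ne_zero_of_mul (right_ne_zero_of_mul hne))))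
      exact ⟨b2.toNat, by omega, by omega⟩
    · intro i hi _
      omega
  · rw [Finset.sum_eq_zero, Finset.sum_eq_zero]
    · intro c _
      by_contra hne
      obtain ⟨a1, b1, h11, h12, -, -⟩ := exists_of_hb_ne_zero
        (left_ne_zero_of_mul (right_ne_zero_of_mul hne))
      obtain ⟨a2, b2, h21, h22, -, -⟩ := exists_of_hb_ne_zero
        (right_ne_zero_of_mul (right_ne_zero_of_mul (right_ne_zero_of_mul hne)))
      obtain ⟨a3, b3, h31, h32, -, -⟩ := exists_of_hb_ne_zero
        (right_ne_zero_of_mul (left_ne_zero_of_mul hne))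
      exact hpar ⟨⟨a1 - B + m, by omega⟩, ⟨a3 - b1, by omega⟩, ⟨a2, by omega⟩⟩
    · intro x _
      by_contra hne
      obtain ⟨a1, b1, h11, h12, -, -⟩ := exists_of_hb_ne_zero (left_ne_zero_of_mul hne)
      obtain ⟨a2, b2, h21, h22, -, -⟩ := exists_of_hb_ne_zero (left_ne_zero_of_mul
        (right_ne_zero_of_mul (left_ne_zero_of_mul (right_ne_zero_of_mul hne))))
      obtain ⟨a3, b3, h31, h32, -, -⟩ := exists_of_hb_ne_zero (right_ne_zero_of_mul
        (right_ne_zero_of_mul (left_ne_zero_of_mul (right_ne_zero_of_mul hne))))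
      obtain ⟨a4, b4, h41, h42, -, -⟩ := exists_of_hb_ne_zero (right_ne_zero_of_mul
        (right_ne_zero_of_mul hne))
      exact hpar ⟨⟨a2, by omega⟩, ⟨a3, by omega⟩, ⟨a4 + b1 - A, by omega⟩⟩

theorem chain_transform_zero {A B : ℤ} (K α β : ℤ) (hA : 0 ≤ A) (hAB : A ≤ B) :
    chain K 0 A B (fun x => hb (α + B + x) (2 * A)) (fun x => hb (β + A + x) (2 * B))
      = ∑ m ∈ Finset.Icc 0 (A + B), hb (α + β + A + B - m) (A + B - m)
        * chain K 0 m 0 (fun x => hb (α + x) (m + A - B) * hb (β + x) (m - A + B))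
          (fun _ => 1) := by
  simp only [chain]
  by_cases hpar : Even α ∧ Even β
  · obtain ⟨A, rfl⟩ := Int.eq_ofNat_of_zero_le hA
    obtain ⟨⟨p, hp⟩, ⟨r, hr⟩⟩ := hpar
    obtain rfl : α = 2 * p := by omega
    obtain rfl : β = 2 * r := by omega
    rw [sum_Icc_eq_sum_range _ 0 (A + B) (B - A) A]
    · have h := gz_kernel A B 0 p r 0
      refine Eq.symm (Eq.trans (Finset.sum_congr rfl fun i _ => ?_)
        (h.trans ((Finset.sum_eq_single_of_mem A (by simp) fun k hk hk' => ?_).trans ?_)))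
      · rw [show 2 * p + 2 * r + A + B - (2 * i + (B - A)) = 2 * (p + r - 0 + A - i) by
            ring, show (A : ℤ) + B - (2 * i + (B - A)) = 2 * (A - i) by ring,
          show 2 * p + 0 = 2 * p by ring, show 2 * r + 0 = 2 * r by ring,
          show 2 * (i : ℤ) + (B - A) + A - B = 2 * i by ring,
          show 2 * (i : ℤ) + (B - A) - A + B = 2 * (i + B - A) by ring, gz_zero_right]
        simp only [hb_two_mul]
        rw [show (((2 * (i : ℤ) + (B - A) : ℤ) : ℚ) - (0 : ℤ)) ^ 2 / 4
            = (2 * i - A + B - (0 : ℤ)) ^ 2 / 4 by push_cast; ring]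
        ring
      · rw [gz_of_neg (show 0 + (k : ℤ) - A < 0 by have := Finset.mem_range.mp hk; omega),
          mul_zero]
      · rw [show 2 * p + B + B = 2 * (p - 0 + B) by ring,
          show 2 * r + A + (A : ℤ) = 2 * (r + A) by ring, hb_two_mul, hb_two_mul,
          show 0 + (A : ℤ) - A = 0 by ring, show (A : ℤ) - A = 0 by ring, gz_zero_right,
          gz_zero_right,
          show ((A : ℚ) + B - 2 * A - (0 : ℤ)) ^ 2 / 4 = ((A : ℤ) - B) ^ 2 / 4 by push_cast; ring]
        ring
    · intro x h0 h1 hne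
      obtain ⟨a1, b1, h11, h12, h13, h14⟩ := exists_of_hb_ne_zero (left_ne_zero_of_mul hne)
      obtain ⟨a2, b2, h21, h22, h23, h24⟩ := exists_of_hb_ne_zero (left_ne_zero_of_mul
        (right_ne_zero_of_mul (left_ne_zero_of_mul (right_ne_zero_of_mul hne))))
      exact ⟨b2.toNat, by omega, by omega⟩
    · intro i hi _
      omega
  · rw [Finset.sum_eq_zero]
    · by_contra hne
      obtain ⟨a1, b1, h11, h12, -, -⟩ := exists_of_hb_ne_zero
        (right_ne_zero_of_mul (left_ne_zero_of_mul hne))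
      obtain ⟨a2, b2, h21, h22, -, -⟩ := exists_of_hb_ne_zero (right_ne_zero_of_mul hne)
      exact hpar ⟨⟨a1 - B, by omega⟩, ⟨a2 - A, by omega⟩⟩
    · intro x _
      by_contra hne
      obtain ⟨a2, b2, h21, h22, -, -⟩ := exists_of_hb_ne_zero (left_ne_zero_of_mul
        (right_ne_zero_of_mul (left_ne_zero_of_mul (right_ne_zero_of_mul hne))))
      obtain ⟨a3, b3, h31, h32, -, -⟩ := exists_of_hb_ne_zero (right_ne_zero_of_mul
        (right_ne_zero_of_mul (left_ne_zero_of_mul (right_ne_zero_of_mul hne))))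
      exact hpar ⟨⟨a2, by omega⟩, ⟨a3, by omega⟩⟩

/-- The transformation of chains: the generalized `q`-Saalschütz sum. -/
theorem chain_transform {A B K : ℤ} (n : ℕ) (α β : ℤ) (hA : 0 ≤ A) (hB : 0 ≤ B) (hK : A + B ≤ K) :
    chain K n A B (fun x => hb (α + B + x) (2 * A)) (fun x => hb (β + A + x) (2 * B))
      = ∑ m ∈ Finset.Icc 0 (A + B), hb (α + β + A + B - m) (A + B - m)
        * chain K n m 0 (fun x => hb (α + x) (m + A - B) * hb (β + x) (m - A + B))
          (fun _ => 1) := by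
  induction n generalizing A B α β with
  | zero =>
    rcases le_total A B with h | h
    · exact chain_transform_zero K α β hA h
    · rw [chain_flip, chain_transform_zero K β α hB h, add_comm B A]
      refine Finset.sum_congr rfl fun m _ => ?_
      simp only [mul_comm (hb (β + _) _)]
      ring_nf
  | succ n ih =>
    -- Reversing the chain exchanges `(A, α)` with `(B, β)`.
    wlog hAB : A ≤ B generalizing A B α β
    · rw [chain_flip, this β α hB hA (by omega) (by omega), add_comm B A]
      refine Finset.sum_congr rfl fun m _ => ?_
      simp only [mul_comm (hb (β + _) _)]
      ring_nf
    -- Split off the first link `m, y` of each chain on the right and collect the sum over `m`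
    -- inside the weight at the next entry.
    have e1 : ∑ m ∈ Finset.Icc 0 (A + B), hb (α + β + A + B - m) (A + B - m)
        * chain K (n + 1) m 0 (fun x => hb (α + x) (m + A - B) * hb (β + x) (m - A + B))
          (fun _ => 1)
        = ∑ y ∈ Finset.Icc 0 K, chain K n y 0 (fun d => ∑ x ∈ Finset.Icc 0 (A + B),
          hb (α + β + A + B - x) (A + B - x) * (qPow ((x - y) ^ 2 / 4)
          * (hb (α + y) (x + A - B) * hb (β + y) (x - A + B)) * hb (x + d) (2 * y)))
            (fun _ => 1) := by
      simp only [chain_succ_left, Finset.mul_sum, chain_sum_left, chain_mul_left]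
      exact Finset.sum_comm
    have e2 : ∀ y ∈ Finset.Icc 0 K, chain K n y 0 (fun d => ∑ x ∈ Finset.Icc 0 (A + B),
          hb (α + β + A + B - x) (A + B - x) * (qPow ((x - y) ^ 2 / 4)
          * (hb (α + y) (x + A - B) * hb (β + y) (x - A + B)) * hb (x + d) (2 * y)))
            (fun _ => 1)
        = ∑ c ∈ Finset.Icc 0 B, qPow ((B - c) ^ 2 / 4) * hb (β + A + c) (2 * B)
          * (hb (α + 2 * B - y) (A + c - y) * chain K n y 0 (fun d =>
            hb (α + B - c + d) (y + A - c) * hb (B - A + d) (y - A + c)) (fun _ => 1)) := by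
      intro y hy
      have hy0 := (Finset.mem_Icc.mp hy).1
      simp only [← chain_mul_left, ← chain_sum_left]
      refine chain_congr hy0 le_rfl fun d _ hd hd' _ _ _ => ?_
      rw [hb_kernel α β hA hAB hd (by omega)]
      simp only [show d - A + B = B - A + d by ring]
    rw [e1, Finset.sum_congr rfl e2, Finset.sum_comm, chain,
      ← Finset.sum_subset (Finset.Icc_subset_Icc_right (show B ≤ K by omega))]
    · refine Finset.sum_congr rfl fun c hc => ?_
      obtain ⟨hc0, hcB⟩ := Finset.mem_Icc.mp hc
      -- The new pair is chosen so that the induction hypothesis for the ends `A, c` has the weight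
      -- `[(d + B)/2; c]` at its last entry: this is the weight left when the last link `c, B` of
      -- the original chain is split off.
      have h := ih (α + B - c) (B - A) hA hc0 (by omega)
      simp only [show ∀ x, α + B - c + c + x = α + B + x by intro; ring,
        show ∀ x, B - A + A + x = x + B by intro; ring] at h
      rw [h, ← Finset.mul_sum]
      congr 1
      rw [← Finset.sum_subset (Finset.Icc_subset_Icc_right (show A + c ≤ K by omega))]
      · refine Finset.sum_congr rfl fun m _ => ?_
        rw [show α + B - c + (B - A) + A + c - m = α + 2 * B - m by ring]
      · intro y hy hy'
        have : hb (α + 2 * B - y) (A + c - y) = 0 := by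
          by_contra hne
          obtain ⟨a, b, h1, h2, h3, h4⟩ := exists_of_hb_ne_zero hne
          simp only [Finset.mem_Icc] at hy hy'
          omega
        rw [this, zero_mul]
    · intro c hc hc'
      -- For `c > B` the last link would violate convexity.
      rw [chain_eq_zero hA (Finset.mem_Icc.mp hc).1, mul_zero]
      intro x y _ _ hy hy' _
      have : hb (y + B) (2 * c) = 0 := by
        by_contra hne
        obtain ⟨a, b, h1, h2, h3, h4⟩ := exists_of_hb_ne_zero hne
        simp only [Finset.mem_Icc] at hc hc'
        omega
      rw [this, mul_zero]

/-! ### Chain sums as sums over integer vectors. -/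

/-- The sequence `A, μ_1, …, μ_n, B, B, …`. -/
def ext {n : ℕ} (A B : ℤ) (μ : Fin n → ℤ) (k : ℕ) : ℤ :=
  if k = 0 then A else if h : k - 1 < n then μ ⟨k - 1, h⟩ else B

theorem ext_zero {n : ℕ} (A B : ℤ) (μ : Fin n → ℤ) : ext A B μ 0 = A := by simp [ext]

theorem ext_last {n : ℕ} (A B : ℤ) (μ : Fin n → ℤ) : ext A B μ (n + 1) = B := by simp [ext]

theorem ext_succ_fin {n : ℕ} (A B : ℤ) (μ : Fin n → ℤ) (i : Fin n) :
    ext A B μ (i + 1) = μ i := by simp [ext]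

theorem ext_cons {n : ℕ} (A B c : ℤ) (ν : Fin n → ℤ) (k : ℕ) :
    ext A B (Fin.cons c ν : Fin (n + 1) → ℤ) (k + 1) = ext c B ν k := by
  cases k with
  | zero => simp [ext]
  | succ k =>
    simp only [ext, Nat.add_sub_cancel, Nat.succ_ne_zero, if_false, add_lt_add_iff_right]
    split_ifs with h
    · exact Fin.cons_succ (α := fun _ => ℤ) c ν ⟨k, h⟩
    · rfl

/-- The summand of a chain sum which belongs to the vector `μ`. -/
noncomputable def vecTerm {n : ℕ} (A B : ℤ) (f g : ℤ → QPoly) (μ : Fin n → ℤ) : QPoly :=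
  qPow (∑ k ∈ Finset.range (n + 1), ((ext A B μ k : ℚ) - ext A B μ (k + 1)) ^ 2 / 4)
    * (∏ k ∈ Finset.range n, hb (ext A B μ k + ext A B μ (k + 2)) (2 * ext A B μ (k + 1)))
    * f (ext A B μ 1) * g (ext A B μ n)

theorem vecTerm_cons {n : ℕ} (A B c : ℤ) (f g : ℤ → QPoly) (ν : Fin n → ℤ) :
    vecTerm A B f g (Fin.cons c ν : Fin (n + 1) → ℤ)
      = qPow ((A - c) ^ 2 / 4) * f c * vecTerm c B (fun d => hb (A + d) (2 * c)) g ν := by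
  simp only [vecTerm]
  rw [Finset.sum_range_succ', Finset.prod_range_succ', qPow_add]
  simp only [ext_cons, ext_zero, zero_add]
  ring

theorem sum_piFinset_succ {M : Type*} [AddCommMonoid M] {n : ℕ} (S : Finset ℤ)
    (F : (Fin (n + 1) → ℤ) → M) :
    ∑ μ ∈ Fintype.piFinset fun _ : Fin (n + 1) => S, F μ
      = ∑ c ∈ S, ∑ ν ∈ Fintype.piFinset fun _ : Fin n => S, F (Fin.cons c ν) := by
  rw [← Finset.sum_product']
  refine Finset.sum_nbij' (fun μ => (μ 0, Fin.tail μ)) (fun p => Fin.cons p.1 p.2) ?_ ?_ ?_ ?_ ?_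
  · intro μ hμ
    simp only [Fintype.mem_piFinset, Finset.mem_product] at hμ ⊢
    exact ⟨hμ 0, fun i => hμ i.succ⟩
  · intro p hp
    simp only [Fintype.mem_piFinset, Finset.mem_product] at hp ⊢
    intro i
    refine Fin.cases ?_ (fun i => ?_) i
    · exact hp.1
    · simpa using hp.2 i
  · intro μ _; exact Fin.cons_self_tail μ
  · intro p _; simp
  · intro μ _; rw [Fin.cons_self_tail]

theorem chain_eq_sum (K : ℤ) (n : ℕ) (A B : ℤ) (f g : ℤ → QPoly) :
    chain K n A B f g = ∑ μ ∈ Fintype.piFinset fun _ : Fin n => Finset.Icc 0 K,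
      vecTerm A B f g μ := by
  induction n generalizing A f with
  | zero =>
    rw [Fintype.piFinset_of_isEmpty, Finset.univ_unique, Finset.sum_singleton]
    simp [vecTerm, chain, ext]
  | succ n ih =>
    rw [chain_succ_left, sum_piFinset_succ]
    refine Finset.sum_congr rfl fun c _ => ?_
    simp only [ih, Finset.mul_sum, vecTerm_cons]

/-- A convex sequence takes its maximum at an end. Hence the support of a chain sum lies in a box
determined by `A` and `B`. -/
theorem convex_le_max {e : ℕ → ℤ} {n : ℕ} (h : ∀ k < n, 2 * e (k + 1) ≤ e k + e (k + 2)) :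
    ∀ k ≤ n + 1, e k ≤ max (e 0) (e (n + 1)) := by
  induction n with
  | zero =>
    intro k hk
    interval_cases k <;> simp
  | succ n ih =>
    have ih' := ih fun k hk => h k (by omega)
    have h1 := h n (by omega)
    have h2 := ih' n (by omega)
    intro k hk
    rcases Nat.lt_or_ge k (n + 2) with hk' | hk'
    · have h3 := ih' k (by omega)
      show e k ≤ max (e 0) (e (n + 2))
      omega
    · obtain rfl : k = n + 2 := by omega
      exact le_max_right _ _

theorem vecTerm_ne_zero {n : ℕ} {A B : ℤ} {f g : ℤ → QPoly} {μ : Fin n → ℤ}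
    (h : vecTerm A B f g μ ≠ 0) :
    f (ext A B μ 1) ≠ 0 ∧ g (ext A B μ n) ≠ 0 ∧
      ∀ k < n, hb (ext A B μ k + ext A B μ (k + 2)) (2 * ext A B μ (k + 1)) ≠ 0 := by
  refine ⟨right_ne_zero_of_mul (left_ne_zero_of_mul h), right_ne_zero_of_mul h, fun k hk => ?_⟩
  exact Finset.prod_ne_zero_iff.mp (right_ne_zero_of_mul (left_ne_zero_of_mul
    (left_ne_zero_of_mul h))) k (Finset.mem_range.mpr hk)

theorem chain_bounds {e : ℕ → ℤ} {n : ℕ} (h0 : 0 ≤ e 0) (hn : 0 ≤ e (n + 1))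
    (h : ∀ k < n, hb (e k + e (k + 2)) (2 * e (k + 1)) ≠ 0) :
    ∀ k ≤ n + 1, 0 ≤ e k ∧ e k ≤ max (e 0) (e (n + 1)) := by
  have hnn : ∀ k ≤ n + 1, 0 ≤ e k := by
    intro k hk
    rcases k with _ | k
    · exact h0
    · rcases Nat.lt_or_ge k n with hk' | hk'
      · obtain ⟨a, b, h1, h2, h3, -⟩ := exists_of_hb_ne_zero (h k hk')
        omega
      · obtain rfl : k = n := by omega
        exact hn
  have hc := convex_le_max (e := e) (n := n) fun k hk => by
    obtain ⟨a, b, h1, h2, h3, h4⟩ := exists_of_hb_ne_zero (h k hk)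
    have := hnn k (by omega)
    have := hnn (k + 2) (by omega)
    omega
  exact fun k hk => ⟨hnn k hk, hc k hk⟩

/-- The auxiliary bound `K` is immaterial once the box contains the support. -/
theorem finsum_vecTerm {n : ℕ} {A B K : ℤ} (f g : ℤ → QPoly) (hA : 0 ≤ A) (hB : 0 ≤ B)
    (hK : max A B ≤ K) : ∑ᶠ μ : Fin n → ℤ, vecTerm A B f g μ = chain K n A B f g := by
  rw [chain_eq_sum]
  refine finsum_eq_sum_of_support_subset _ fun μ hμ => ?_
  simp only [Finset.mem_coe, Fintype.mem_piFinset, Finset.mem_Icc]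
  intro i
  have h := chain_bounds (e := ext A B μ) (n := n) (by rwa [ext_zero]) (by rwa [ext_last])
    (vecTerm_ne_zero hμ).2.2 (i + 1) (by omega)
  rw [ext_succ_fin, ext_zero, ext_last] at h
  omega

/-! ### The inverse Cartan matrix and the discrete Dirichlet sum. -/

/-- The sequence `A, v_1, …, v_n, B, 0, 0, …`. -/
def extQ {n : ℕ} (A B : ℚ) (v : Fin n → ℚ) (k : ℕ) : ℚ :=
  coord v k 0 + (if k = 0 then A else 0) + (if k = n + 1 then B else 0)

theorem extQ_zero {n : ℕ} (A B : ℚ) (v : Fin n → ℚ) : extQ A B v 0 = A := by simp [extQ, coord]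

theorem extQ_last {n : ℕ} (A B : ℚ) (v : Fin n → ℚ) : extQ A B v (n + 1) = B := by
  simp [extQ, coord]

theorem extQ_fin {n : ℕ} (A B : ℚ) (v : Fin n → ℚ) (i : Fin n) : extQ A B v (i + 1) = v i := by
  simp [extQ, coord, i.isLt.ne]

theorem extQ_ratVec {n : ℕ} (A B : ℤ) (μ : Fin n → ℤ) {k : ℕ} (hk : k ≤ n + 1) :
    extQ A B (ratVec μ) k = ext A B μ k := by
  rcases k with _ | k
  · rw [extQ_zero, ext_zero]
  · rcases Nat.lt_or_ge k n with h | h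
    · exact (extQ_fin _ _ _ ⟨k, h⟩).trans (congrArg Int.cast (ext_succ_fin A B μ ⟨k, h⟩).symm)
    · obtain rfl : k = n := by omega
      rw [extQ_last, ext_last]

theorem extQ_one {n : ℕ} (A B : ℚ) (v : Fin n → ℚ) : extQ A B v 1 = coord v 1 B := by
  rcases n with _ | n <;> simp [extQ, coord]

theorem extQ_self {n : ℕ} (A B : ℚ) (v : Fin n → ℚ) : extQ A B v n = coord v n A := by
  rcases n with _ | n <;> simp [extQ, coord]

/-- The Cartan matrix is minus the second difference with zero boundary values; the unit vectors
correct for the boundary values `A` and `B`. -/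
theorem cartanA_mulVec_extQ {n : ℕ} (A B : ℚ) (v : Fin n → ℚ) (i : Fin n) :
    (cartanA n *ᵥ v) i = 2 * extQ A B v (i + 1) - extQ A B v i - extQ A B v (i + 2)
      + (A • unitVec n 1 + B • unitVec n n) i := by
  have h0 := i.isLt
  have h1 : ¬ ((i : ℕ) = n + 1) := by omega
  have h2 : ((i : ℕ) + 2 = n + 1) = ((i : ℕ) + 1 = n) := by simp
  rw [cartanA_mulVec, extQ_fin]
  simp only [extQ, h1, h2, if_false, Pi.add_apply, Pi.smul_apply, unitVec, smul_eq_mul,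
    Nat.succ_ne_zero, Nat.add_eq_right]
  split_ifs <;> ring

/-- The vector which interpolates linearly between `A` at the label `0` and `B` at `n + 1`. -/
def linVec (n : ℕ) (A B : ℚ) : Fin n → ℚ := fun i => A - (A - B) * (i + 1) / (n + 1)

theorem extQ_linVec {n : ℕ} (A B : ℚ) {k : ℕ} (hk : k ≤ n + 1) :
    extQ A B (linVec n A B) k = A - (A - B) * k / (n + 1) := by
  rcases k with _ | k
  · rw [extQ_zero]; simp
  · rcases Nat.lt_or_ge k n with h | h
    · refine (extQ_fin _ _ _ ⟨k, h⟩).trans ?_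
      simp [linVec]
    · obtain rfl : k = n := by omega
      rw [extQ_last]
      have : (k : ℚ) + 1 ≠ 0 := by positivity
      push_cast
      field_simp; ring

theorem cartanA_mulVec_linVec (n : ℕ) (A B : ℚ) :
    cartanA n *ᵥ linVec n A B = A • unitVec n 1 + B • unitVec n n := by
  funext i
  have := i.isLt
  rw [cartanA_mulVec_extQ A B, extQ_linVec A B (by omega), extQ_linVec A B (by omega),
    extQ_linVec A B (by omega)]
  push_cast; ring

theorem eq_inv_cartanA_mulVec {n : ℕ} {v w : Fin n → ℚ} (h : cartanA n *ᵥ v = w) :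
    (cartanA n)⁻¹ *ᵥ w = v := by
  rw [← h, Matrix.mulVec_mulVec, Matrix.nonsing_inv_mul _ (isUnit_det_cartanA n),
    Matrix.one_mulVec]

/-- The linear interpolation of the boundary values is discretely harmonic, so half of its
difference from `v` has the image `η` under the Cartan matrix. -/
theorem inv_cartanA_mulVec_of {n : ℕ} {A B : ℚ} {v η : Fin n → ℚ}
    (h : cartanA n *ᵥ v = (A • unitVec n 1 + B • unitVec n n) - (2 : ℚ) • η) :
    (cartanA n)⁻¹ *ᵥ η = (1 / 2 : ℚ) • (linVec n A B - v) := by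
  apply eq_inv_cartanA_mulVec
  rw [Matrix.mulVec_smul, Matrix.mulVec_sub, h, cartanA_mulVec_linVec]
  funext i
  simp

theorem coord_inv_of {n : ℕ} {A B : ℚ} {v η : Fin n → ℚ}
    (h : cartanA n *ᵥ v = (A • unitVec n 1 + B • unitVec n n) - (2 : ℚ) • η) :
    coord ((cartanA n)⁻¹ *ᵥ η) 1 0 = (A - (A - B) / (n + 1) - extQ A B v 1) / 2 := by
  rw [inv_cartanA_mulVec_of h]
  rcases n with _ | n
  · rw [extQ_last]; simp [coord]
  · have := extQ_fin A B v 0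
    simp only [Fin.val_zero, zero_add] at this
    rw [this]
    simp [coord, linVec]
    ring

/-- Summation by parts. -/
theorem sum_sq_sub (c : ℕ → ℚ) (n : ℕ) :
    ∑ k ∈ Finset.range (n + 1), (c k - c (k + 1)) ^ 2
      = ∑ k ∈ Finset.range n, c (k + 1) * (2 * c (k + 1) - c k - c (k + 2))
        + c 0 * (c 0 - c 1) + c (n + 1) * (c (n + 1) - c n) := by
  induction n with
  | zero => simp; ring
  | succ n ih => rw [Finset.sum_range_succ, ih, Finset.sum_range_succ]; ring

theorem dotProduct_inv_of {n : ℕ} {A B : ℚ} {v η : Fin n → ℚ}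
    (h : cartanA n *ᵥ v = (A • unitVec n 1 + B • unitVec n n) - (2 : ℚ) • η) :
    η ⬝ᵥ ((cartanA n)⁻¹ *ᵥ η)
      = -(A - B) ^ 2 / (4 * (n + 1))
        + ∑ k ∈ Finset.range (n + 1), (extQ A B v k - extQ A B v (k + 1)) ^ 2 / 4 := by
  rw [inv_cartanA_mulVec_of h]
  -- The deviation of `v` from the linear interpolation. It vanishes at both ends and minus its
  -- second difference is `2η`, so `η C⁻¹ η` is a quarter of its Dirichlet sum; the cross terms
  -- telescope.
  set D : ℕ → ℚ := fun k => A - (A - B) * k / (n + 1) - extQ A B v k with hD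
  have hD0 : D 0 = 0 := by simp [hD, extQ_zero]
  have hDn : D (n + 1) = 0 := by
    have : (n : ℚ) + 1 ≠ 0 := by positivity
    simp only [hD, extQ_last]; push_cast; field_simp; ring
  have h1 : η ⬝ᵥ ((1 / 2 : ℚ) • (linVec n A B - v))
      = ∑ k ∈ Finset.range n, (D (k + 1) * (2 * D (k + 1) - D k - D (k + 2))) / 4 := by
    rw [dotProduct, ← Fin.sum_univ_eq_sum_range
      (fun k => (D (k + 1) * (2 * D (k + 1) - D k - D (k + 2))) / 4)]
    refine Finset.sum_congr rfl fun i _ => ?_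
    have h2 := congrFun h i
    rw [cartanA_mulVec_extQ A B] at h2
    simp only [Pi.sub_apply, Pi.smul_apply, smul_eq_mul] at h2 ⊢
    have h3 : linVec n A B i - v i = D (i + 1) := by
      simp only [hD]
      rw [extQ_fin, linVec]; push_cast; ring
    have h4 : η i = (2 * D (i + 1) - D i - D (i + 2)) / 2 := by
      simp only [hD]; push_cast; linear_combination h2 / 2
    rw [h3, h4]; ring
  rw [h1, ← Finset.sum_div, ← Finset.sum_div]
  have h5 := sum_sq_sub D n
  rw [hD0, hDn] at h5
  have h6 : ∀ k, (D k - D (k + 1)) ^ 2 = (A - B) ^ 2 / (n + 1) ^ 2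
      + 2 * ((A - B) / (n + 1)) * (extQ A B v (k + 1) - extQ A B v k)
      + (extQ A B v k - extQ A B v (k + 1)) ^ 2 := by
    intro k
    have : D k - D (k + 1) = (A - B) / (n + 1) + (extQ A B v (k + 1) - extQ A B v k) := by
      simp only [hD]; push_cast; ring
    rw [this, ← div_pow]; ring
  simp only [h6, Finset.sum_add_distrib, ← Finset.mul_sum, Finset.sum_range_sub, extQ_zero,
    extQ_last, Finset.sum_const, Finset.card_range, nsmul_eq_mul] at h5
  have hn : (n : ℚ) + 1 ≠ 0 := by positivity
  have h7 : ((n + 1 : ℕ) : ℚ) * ((A - B) ^ 2 / (n + 1) ^ 2) = (A - B) ^ 2 / (n + 1) := by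
    push_cast; field_simp
  rw [h7] at h5
  rw [show -(A - B) ^ 2 / (4 * ((n : ℚ) + 1)) = -((A - B) ^ 2 / (n + 1)) / 4 by field_simp]
  linear_combination -h5 / 4

/-! ### From restricted sums to chain sums. -/

/-- The truncated and the polynomial convention can differ only for a negative top entry together
with a non-negative bottom entry. -/
theorem qBinom_eq_hb {a b : ℚ} {n k : ℤ} (ha : a = n / 2) (hb' : b = k / 2)
    (h : k < 0 ∨ 0 ≤ n) : qBinom a b = hb n k := by
  have hden : ∀ (x : ℚ) (z : ℤ), x = z / 2 → (x.den = 1 ↔ Even z) := by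
    intro x z hx
    rw [Rat.den_eq_one_iff, Int.even_iff]
    constructor
    · intro h
      have h2 : (z : ℚ) = ((2 * x.num : ℤ) : ℚ) := by push_cast; rw [h, hx]; ring
      have := Int.cast_injective h2
      omega
    · intro h
      obtain ⟨w, rfl⟩ : ∃ w, z = 2 * w := ⟨z / 2, by omega⟩
      have : x = (w : ℚ) := by rw [hx]; push_cast; ring
      rw [this]; simp
  rw [qBinom, hb]
  by_cases hp : Even n ∧ Even k
  · obtain ⟨⟨n, rfl⟩, ⟨k, rfl⟩⟩ := hp
    obtain rfl : a = (n : ℚ) := by rw [ha]; push_cast; ring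
    obtain rfl : b = (k : ℚ) := by rw [hb']; push_cast; ring
    rw [if_pos (show Even (n + n) ∧ Even (k + k) from ⟨⟨n, rfl⟩, ⟨k, rfl⟩⟩),
      show (n + n) / 2 = n by omega, show (k + k) / 2 = k by omega]
    split_ifs with h1
    · obtain ⟨-, -, h2, h3⟩ := h1
      have h2' : 0 ≤ k := by exact_mod_cast h2
      have h3' : k ≤ n := by exact_mod_cast h3
      rw [gz, if_neg (by omega), if_pos (by omega)]
      simp
    · simp only [Rat.den_intCast, true_and, not_and, not_le, Int.cast_lt, Int.cast_nonneg_iff] at h1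
      rcases lt_or_ge k 0 with h2 | h2
      · rw [gz_of_neg h2]
      · rw [gz_eq_zero_of_lt (by omega) (h1 h2)]
  · rw [if_neg hp, if_neg]
    rintro ⟨h1, h2, -⟩
    exact hp ⟨(hden a n ha).mp h1, (hden b k hb').mp h2⟩

theorem ext_shift_ratVec {n : ℕ} {A B : ℤ} {μ η : Fin n → ℤ}
    (h : ∀ i : Fin n, 2 * η i = ext A B μ i + ext A B μ (i + 2) - 2 * ext A B μ (i + 1)) :
    cartanA n *ᵥ ratVec μ = ((A : ℚ) • unitVec n 1 + (B : ℚ) • unitVec n n)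
      - (2 : ℚ) • ratVec η := by
  funext i
  have hi := i.isLt
  have h1 := congrArg (Int.cast (R := ℚ)) (h i)
  push_cast at h1
  rw [cartanA_mulVec_extQ (A : ℚ) B, extQ_ratVec _ _ _ (by omega), extQ_ratVec _ _ _ (by omega),
    extQ_ratVec _ _ _ (by omega)]
  simp only [Pi.sub_apply, Pi.smul_apply, smul_eq_mul, ratVec] at *
  linear_combination h1

theorem solveA_mulVec {n : ℕ} (b η : Fin n → ℚ) :
    cartanA n *ᵥ solveA b η = b - (2 : ℚ) • η := by
  rw [solveA, Matrix.mulVec_mulVec, Matrix.mul_nonsing_inv _ (isUnit_det_cartanA n),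
    Matrix.one_mulVec]

/-- The linear part of `(C⁻¹η)_1` cancels the fraction `(A - B)/(2N)`, and `(A + σ - v_1)/2`
remains. -/
theorem mem_restrictedSet_iff {n σ : ℕ} {A B : ℤ} {v : Fin n → ℚ} {η : Fin n → ℤ}
    (h : cartanA n *ᵥ v = ((A : ℚ) • unitVec n 1 + (B : ℚ) • unitVec n n)
      - (2 : ℚ) • ratVec η) :
    η ∈ restrictedSet (n + 1) σ (A - B) ↔
      ∃ z : ℤ, extQ (A : ℚ) B v 1 = ((A + σ - 2 * z : ℤ) : ℚ) := by
  have hn : (n : ℚ) + 1 ≠ 0 := by positivity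
  have h1 : (((A - B : ℤ) : ℚ) + σ * ((n + 1 : ℕ) : ℚ)) / (2 * ((n + 1 : ℕ) : ℚ))
      + coord ((cartanA n)⁻¹ *ᵥ ratVec η) 1 0 = (A + σ - extQ (A : ℚ) B v 1) / 2 := by
    rw [coord_inv_of h]; push_cast; field_simp; ring
  change (∃ z : ℤ, (((A - B : ℤ) : ℚ) + σ * ((n + 1 : ℕ) : ℚ)) / (2 * ((n + 1 : ℕ) : ℚ))
      + coord ((cartanA n)⁻¹ *ᵥ ratVec η) 1 0 = z) ↔ _
  rw [h1]
  refine exists_congr fun z => ?_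
  push_cast
  constructor <;> intro h2
  · linear_combination (-2 : ℚ) * h2
  · linear_combination (-1 / 2 : ℚ) * h2

/-- The integer vectors `μ` which belong to the vectors in `restrictedSet`. -/
def chainSet (n σ : ℕ) (A B : ℤ) : Set (Fin n → ℤ) :=
  {μ | Even (ext A B μ 1 + A + σ) ∧ ∀ k < n, Even (ext A B μ k + ext A B μ (k + 2))}

/-- The vector `η` which belongs to `μ`. -/
def toEta {n : ℕ} (A B : ℤ) (μ : Fin n → ℤ) : Fin n → ℤ := fun i =>
  (ext A B μ i + ext A B μ (i + 2)) / 2 - ext A B μ (i + 1)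

theorem two_mul_toEta {n σ : ℕ} {A B : ℤ} {μ : Fin n → ℤ} (h : μ ∈ chainSet n σ A B) (i : Fin n) :
    2 * toEta A B μ i = ext A B μ i + ext A B μ (i + 2) - 2 * ext A B μ (i + 1) := by
  obtain ⟨c, hc⟩ := h.2 i i.isLt
  rw [toEta, hc]; omega

theorem solveA_toEta {n σ : ℕ} {A B : ℤ} {μ : Fin n → ℤ} (h : μ ∈ chainSet n σ A B) :
    solveA ((A : ℚ) • unitVec n 1 + (B : ℚ) • unitVec n n) (ratVec (toEta A B μ)) = ratVec μ :=
  eq_inv_cartanA_mulVec (ext_shift_ratVec (two_mul_toEta h))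

theorem bijOn_toEta (n σ : ℕ) (A B : ℤ) :
    Set.BijOn (toEta A B) (chainSet n σ A B) (restrictedSet (n + 1) σ (A - B)) := by
  refine ⟨fun μ hμ => ?_, fun μ hμ ν hν h => ?_, fun η hη => ?_⟩
  · rw [mem_restrictedSet_iff (ext_shift_ratVec (two_mul_toEta hμ)), extQ_ratVec _ _ _ (by omega)]
    obtain ⟨c, hc⟩ := hμ.1
    exact ⟨A + σ - c, by congr 1; omega⟩
  · have h1 := solveA_toEta hμ
    rw [h, solveA_toEta hν] at h1
    funext i
    have := congrFun h1 i
    simpa [ratVec] using this.symm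
  · change Fin n → ℤ at η
    set v := solveA ((A : ℚ) • unitVec n 1 + (B : ℚ) • unitVec n n) (ratVec η) with hv
    have hCv := solveA_mulVec ((A : ℚ) • unitVec n 1 + (B : ℚ) • unitVec n n) (ratVec η)
    rw [← hv] at hCv
    obtain ⟨z, hz⟩ := (mem_restrictedSet_iff hCv).mp hη
    have hrec : ∀ i : Fin n, extQ (A : ℚ) B v (i + 2)
        = 2 * extQ (A : ℚ) B v (i + 1) - extQ (A : ℚ) B v i + 2 * η i := by
      intro i
      have := congrFun hCv i
      rw [cartanA_mulVec_extQ (A : ℚ) B] at this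
      simp only [Pi.sub_apply, Pi.smul_apply, smul_eq_mul, ratVec] at this
      linear_combination -this
    -- The entries `A` and `v_1` are integers, the latter by the congruence; the second-order
    -- recursion passes integrality along the chain.
    have hint : ∀ k ≤ n, (∃ w : ℤ, extQ (A : ℚ) B v k = w) ∧
        ∃ w : ℤ, extQ (A : ℚ) B v (k + 1) = w := by
      intro k
      induction k with
      | zero => exact fun _ => ⟨⟨A, extQ_zero _ _ _⟩, ⟨_, hz⟩⟩
      | succ k ih =>
        intro hk
        obtain ⟨⟨w1, h1⟩, ⟨w2, h2⟩⟩ := ih (by omega)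
        refine ⟨⟨w2, h2⟩, ⟨2 * w2 - w1 + 2 * η ⟨k, by omega⟩, ?_⟩⟩
        have := hrec ⟨k, by omega⟩
        simp only [h1, h2] at this
        rw [this]; push_cast; ring
    have hμ : ∀ i : Fin n, ∃ w : ℤ, v i = w := fun i => by
      obtain ⟨w, hw⟩ := (hint i (by omega)).2
      exact ⟨w, by rw [← hw, extQ_fin]⟩
    choose μ hμ using hμ
    obtain rfl' : v = ratVec μ := funext hμ
    rw [rfl'] at hrec hz
    have hrec' : ∀ i : Fin n, ext A B μ (i + 2)
        = 2 * ext A B μ (i + 1) - ext A B μ i + 2 * η i := by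
      intro i
      have hi := i.isLt
      have := hrec i
      rw [extQ_ratVec _ _ _ (by omega), extQ_ratVec _ _ _ (by omega),
        extQ_ratVec _ _ _ (by omega)] at this
      exact_mod_cast this
    rw [extQ_ratVec _ _ _ (by omega)] at hz
    have hz' : ext A B μ 1 = A + σ - 2 * z := by exact_mod_cast hz
    refine ⟨μ, ⟨⟨A + σ - z, by rw [hz']; ring⟩, fun k hk => ?_⟩, ?_⟩
    · have := hrec' ⟨k, hk⟩
      simp only at this
      exact ⟨ext A B μ (k + 1) + η ⟨k, hk⟩, by rw [this]; ring⟩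
    · funext i
      rw [toEta, hrec' i]; omega

theorem finsum_mem_eq_finsum_of_forall {α M : Type*} [AddCommMonoid M] {s : Set α} {f : α → M}
    (h : ∀ x, f x ≠ 0 → x ∈ s) : ∑ᶠ x ∈ s, f x = ∑ᶠ x, f x := by
  classical
  refine finsum_congr fun x => ?_
  rw [finsum_eq_if]
  split_ifs with hx
  · rfl
  · exact (not_not.mp (mt (h x) hx)).symm

theorem mem_chainSet_of_vecTerm_ne_zero {n σ : ℕ} {A B : ℤ} {f g : ℤ → QPoly} {μ : Fin n → ℤ}
    (hf : ∀ x : ℤ, f x ≠ 0 → Even (x + A + σ)) (h : vecTerm A B f g μ ≠ 0) :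
    μ ∈ chainSet n σ A B := by
  obtain ⟨h1, -, h3⟩ := vecTerm_ne_zero h
  refine ⟨hf _ h1, fun k hk => ?_⟩
  obtain ⟨a, b, h4, -⟩ := exists_of_hb_ne_zero (h3 k hk)
  exact ⟨a, by omega⟩

theorem invForm_toEta {n σ : ℕ} {A B : ℤ} {μ : Fin n → ℤ} (h : μ ∈ chainSet n σ A B) :
    invForm (toEta A B μ) = -((A : ℚ) - B) ^ 2 / (4 * (n + 1))
      + ∑ k ∈ Finset.range (n + 1), ((ext A B μ k : ℚ) - ext A B μ (k + 1)) ^ 2 / 4 := by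
  rw [invForm, dotProduct_inv_of (ext_shift_ratVec (two_mul_toEta h))]
  congr 1
  refine Finset.sum_congr rfl fun k hk => ?_
  have := Finset.mem_range.mp hk
  rw [extQ_ratVec _ _ _ (by omega), extQ_ratVec _ _ _ (by omega)]

/-- The symmetry of the Gaussian polynomials replaces the bottom entry `η_k` by `μ_k`. If some `μ_k`
is negative, both products contain a zero factor. -/
theorem prod_qBinom_toEta {n σ : ℕ} {A B : ℤ} {μ : Fin n → ℤ} (hA : 0 ≤ A) (hB : 0 ≤ B)
    (h : μ ∈ chainSet n σ A B) :
    ∏ k, qBinom (ratVec μ k + toEta A B μ k) (toEta A B μ k)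
      = ∏ k ∈ Finset.range n, hb (ext A B μ k + ext A B μ (k + 2)) (2 * ext A B μ (k + 1)) := by
  rw [← Fin.prod_univ_eq_prod_range
    (fun k => hb (ext A B μ k + ext A B μ (k + 2)) (2 * ext A B μ (k + 1)))]
  have key : ∀ k : Fin n, ext A B μ k + ext A B μ (k + 2) = 2 * (μ k + toEta A B μ k) ∧
      qBinom (ratVec μ k + toEta A B μ k) (toEta A B μ k)
        = if 0 ≤ μ k then hb (2 * (μ k + toEta A B μ k)) (2 * toEta A B μ k) else 0 := by
    intro k
    have h1 := two_mul_toEta h k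
    rw [ext_succ_fin] at h1
    refine ⟨by linarith, ?_⟩
    split_ifs with h2
    · refine qBinom_eq_hb ?_ ?_ ?_
      · simp [ratVec]
      · simp
      · omega
    · rw [qBinom, if_neg]
      rintro ⟨-, -, -, h3⟩
      simp only [ratVec, le_add_iff_nonneg_left, Int.cast_nonneg_iff] at h3
      exact h2 h3
  by_cases hμ : ∀ k, 0 ≤ μ k
  · have hext : ∀ k, 0 ≤ ext A B μ k := by
      intro k
      rw [ext]; split_ifs
      · exact hA
      · exact hμ _
      · exact hB
    refine Finset.prod_congr rfl fun k _ => ?_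
    have h1 := hext k
    have h2 := hext (k + 2)
    rw [(key k).2, if_pos (hμ k), (key k).1, ext_succ_fin, hb_two_mul, hb_two_mul, ← gz_symm]
    · congr 1; ring
    · have := (key k).1; omega
  · push Not at hμ
    obtain ⟨k, hk⟩ := hμ
    rw [Finset.prod_eq_zero (Finset.mem_univ k), Finset.prod_eq_zero (Finset.mem_univ k)]
    · rw [ext_succ_fin, (key k).1, hb_two_mul, gz_of_neg hk]
    · rw [(key k).2, if_neg (by omega)]

/-- A sum over `restrictedSet` as a chain sum. -/
theorem finsum_restrictedSet {n σ : ℕ} {A B K : ℤ} (F G : ℚ → QPoly) (hA : 0 ≤ A) (hB : 0 ≤ B)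
    (hK : max A B ≤ K) (hF : ∀ x : ℤ, F x ≠ 0 → Even (x + A + σ)) :
    (∑ᶠ η ∈ restrictedSet (n + 1) σ (A - B),
      qPow (invForm η) * (∏ k, qBinom (solveA ((A : ℚ) • unitVec n 1 + (B : ℚ) • unitVec n n)
          (ratVec η) k + η k) (η k))
        * F (coord (solveA ((A : ℚ) • unitVec n 1 + (B : ℚ) • unitVec n n) (ratVec η)) 1 B)
        * G (coord (solveA ((A : ℚ) • unitVec n 1 + (B : ℚ) • unitVec n n) (ratVec η)) n A))
      = qPow (-((A : ℚ) - B) ^ 2 / (4 * (n + 1))) * chain K n A B (fun x => F x) (fun x => G x) := by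
  rw [← finsum_vecTerm (fun x => F x) (fun x => G x) hA hB hK, mul_finsum,
    ← finsum_mem_eq_finsum_of_forall (s := chainSet n σ A B)]
  · symm
    refine finsum_mem_eq_of_bijOn (toEta A B) (bijOn_toEta n σ A B) fun μ hμ => ?_
    rw [solveA_toEta hμ, invForm_toEta hμ, prod_qBinom_toEta hA hB hμ, vecTerm, qPow_add,
      ← extQ_one, ← extQ_self, extQ_ratVec _ _ _ (by omega), extQ_ratVec _ _ _ (by omega)]
    ring
  -- The parity of `μ_1` need not be imposed: by `hF` the weight at `μ_1` vanishes for the wrong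
  -- parity.
  · intro μ hμ
    exact mem_chainSet_of_vecTerm_ne_zero hF (right_ne_zero_of_mul hμ)

/-! ### Truncated binomials and the inner sum at level `N`. -/

/-- The truncated version of `hb`: it is zero for a negative top entry. -/
noncomputable def tb (n k : ℤ) : QPoly := if 0 ≤ n then hb n k else 0

theorem tb_of_nonneg {n : ℤ} (h : 0 ≤ n) (k : ℤ) : tb n k = hb n k := if_pos h

theorem tb_of_neg {n : ℤ} (h : n < 0) (k : ℤ) : tb n k = 0 := if_neg (by omega)

theorem exists_of_tb_ne_zero {n k : ℤ} (h : tb n k ≠ 0) :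
    ∃ a b, n = 2 * a ∧ k = 2 * b ∧ 0 ≤ b ∧ b ≤ a := by
  rw [tb] at h
  split_ifs at h with h'
  · obtain ⟨a, b, h1, h2, h3, h4⟩ := exists_of_hb_ne_zero h
    exact ⟨a, b, h1, h2, h3, h4 (by omega)⟩
  · exact absurd rfl h

theorem qBinom_eq_tb {a b : ℚ} {n k : ℤ} (ha : a = n / 2) (hb' : b = k / 2) :
    qBinom a b = tb n k := by
  rcases lt_or_ge n 0 with h | h
  · rw [tb_of_neg h, qBinom, if_neg]
    rintro ⟨-, -, h1, h2⟩
    have : (n : ℚ) < 0 := by exact_mod_cast h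
    rw [ha] at h2
    linarith
  · rw [tb_of_nonneg h, qBinom_eq_hb ha hb' (Or.inr h)]

theorem hb_symm {n : ℤ} (hn : 0 ≤ n) (k : ℤ) : hb n (n - k) = hb n k := by
  by_cases h : Even n ∧ Even k
  · obtain ⟨⟨a, rfl⟩, ⟨b, rfl⟩⟩ := h
    rw [show a + a - (b + b) = 2 * (a - b) by ring, show a + a = 2 * a by ring,
      show b + b = 2 * b by ring, hb_two_mul, hb_two_mul, gz_symm (by omega)]
  · rw [hb, hb, if_neg h, if_neg]
    rintro ⟨h1, h2⟩
    exact h ⟨h1, (Int.even_sub.mp h2).mp h1⟩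

/-- Truncation is not harmless in general: a negative top entry with a non-negative bottom entry
separates the conventions. The inequality on `α - β` ensures that such terms have another zero
factor. -/
theorem chain_transform_tb_of_le {A B K : ℤ} (n : ℕ) (α β : ℤ) (hB : 0 ≤ B) (hK : A + B ≤ K)
    (hBA : B ≤ A) (hαβ : α - β ≤ 2 * (A - B)) :
    chain K n A B (fun x => tb (α + B + x) (2 * A)) (fun x => tb (β + A + x) (2 * B))
      = ∑ m ∈ Finset.Icc 0 (A + B), tb (α + β + A + B - m) (α + β)
        * chain K n m 0 (fun x => tb (α + x) (m + A - B) * tb (β + x) (m - A + B))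
          (fun _ => 1) := by
  have hA := hB.trans hBA
  -- On the left, adding the two constraints on the end binomials and using `x + y ≤ A + B` gives `α
  -- + β ≥ 0`; on the right, `α + β` is twice a bottom entry.
  rcases lt_or_ge (α + β) 0 with hS | hS
  · rw [chain_eq_zero hA hB, Finset.sum_eq_zero]
    · intro m _
      rw [not_not.mp (mt exists_of_tb_ne_zero _), zero_mul]
      rintro ⟨a, b, h1, h2, h3, h4⟩
      omega
    · intro x y hx hx' hy hy' hxy
      by_contra hne
      obtain ⟨a, b, h1, h2, h3, h4⟩ := exists_of_tb_ne_zero (left_ne_zero_of_mul hne)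
      obtain ⟨c, d, h5, h6, h7, h8⟩ := exists_of_tb_ne_zero (right_ne_zero_of_mul hne)
      omega
  rcases lt_or_ge α 0 with hα | hα
  · rw [chain_eq_zero hA hB, Finset.sum_eq_zero]
    · intro m hm
      rw [chain_eq_zero (Finset.mem_Icc.mp hm).1 le_rfl, mul_zero]
      intro x y hx hx' _ _ _
      by_contra hne
      obtain ⟨a, b, h1, h2, h3, h4⟩ := exists_of_tb_ne_zero
        (left_ne_zero_of_mul (left_ne_zero_of_mul hne))
      have := (Finset.mem_Icc.mp hm).1
      omega
    · intro x y hx hx' hy hy' hxy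
      by_contra hne
      obtain ⟨a, b, h1, h2, h3, h4⟩ := exists_of_tb_ne_zero (left_ne_zero_of_mul hne)
      omega
  have h := chain_transform n α β hA hB hK
  rw [← chain_congr (f := fun x => tb (α + B + x) (2 * A)) (g := fun x => tb (β + A + x) (2 * B))
    hA hB] at h
  · rw [h]
    refine Finset.sum_congr rfl fun m hm => ?_
    obtain ⟨hm0, hm1⟩ := Finset.mem_Icc.mp hm
    rw [tb_of_nonneg (by omega), ← hb_symm (by omega) (α + β),
      show α + β + A + B - m - (α + β) = A + B - m by ring]
    congr 1
    refine chain_congr hm0 le_rfl fun x y hx hx' _ _ _ => ?_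
    congr 1
    rw [tb_of_nonneg (n := α + x) (by omega)]
    -- Here non-zero factors would give `α + x ≥ m + A - B ≥ 2(A - B)`, hence `α - β > 2(A - B)`,
    -- against the hypothesis.
    rcases lt_or_ge (β + x) 0 with hx2 | hx2
    · rw [tb_of_neg hx2, mul_zero]
      by_contra hne
      obtain ⟨a, b, h1, h2, h3, h4⟩ := exists_of_hb_ne_zero (left_ne_zero_of_mul hne)
      obtain ⟨c, d, h5, h6, h7, h8⟩ := exists_of_hb_ne_zero (right_ne_zero_of_mul hne)
      omega
    · rw [tb_of_nonneg hx2]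
  · intro x y hx _ hy _ _
    rw [tb_of_nonneg (by omega), tb_of_nonneg (by omega)]

theorem chain_transform_tb {A B K : ℤ} (n : ℕ) (α β : ℤ) (hA : 0 ≤ A) (hB : 0 ≤ B)
    (hK : A + B ≤ K)
    (h : (B ≤ A ∧ α - β ≤ 2 * (A - B)) ∨ (A ≤ B ∧ β - α ≤ 2 * (B - A))) :
    chain K n A B (fun x => tb (α + B + x) (2 * A)) (fun x => tb (β + A + x) (2 * B))
      = ∑ m ∈ Finset.Icc 0 (A + B), tb (α + β + A + B - m) (α + β)
        * chain K n m 0 (fun x => tb (α + x) (m + A - B) * tb (β + x) (m - A + B))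
          (fun _ => 1) := by
  rcases h with ⟨h1, h2⟩ | ⟨h1, h2⟩
  · exact chain_transform_tb_of_le n α β hB hK h1 h2
  · rw [chain_flip, chain_transform_tb_of_le n β α hA (by omega) h1 h2, add_comm B A]
    refine Finset.sum_congr rfl fun m _ => ?_
    simp only [mul_comm (tb (β + _) _)]
    ring_nf

theorem qBinom_of_neg {a b : ℚ} (h : b < 0) : qBinom a b = 0 := by
  rw [qBinom, if_neg]
  rintro ⟨-, -, h', -⟩
  linarith

theorem levelInner_of_neg {N σ : ℕ} {A B : ℤ} {t₁ t₂ : ℚ} (h : ¬ (0 ≤ A ∧ 0 ≤ B)) :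
    levelInner N σ A B t₁ t₂ = 0 := by
  refine (finsum_mem_congr rfl fun η _ => ?_).trans (finsum_mem_zero _)
  rcases not_and_or.mp h with h | h
  · simp only [qBinom_of_neg (show (A : ℚ) < 0 by exact_mod_cast not_le.mp h), mul_zero, zero_mul]
  · simp only [qBinom_of_neg (show (B : ℚ) < 0 by exact_mod_cast not_le.mp h), mul_zero]

/-- The inner sum of the level-`N` polynomials as a sum over shorter chains. -/
theorem levelInner_eq {n σ : ℕ} {M l k z K : ℤ} {L : ℚ} (hL : 2 * L = z) (hz : Even (z + σ))
    (hK : 2 * M ≤ K) (hlk : (0 ≤ l ∧ 0 ≤ k) ∨ (l ≤ 0 ∧ k ≤ 0)) :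
    levelInner (n + 1) σ (M + l) (M - l) (M + L - k) (M + L + k)
      = qPow (-(l : ℚ) ^ 2 / (n + 1)) * ∑ i ∈ Finset.Icc 0 M, qBinom (2 * L + M - i) (2 * L)
        * chain K n (2 * i) 0 (fun x => qBinom (L + x / 2 - k + l) (i + l)
          * qBinom (L + x / 2 + k - l) (i - l)) (fun _ => 1) := by
  have hL' : L = z / 2 := by linarith
  by_cases hAB : 0 ≤ M + l ∧ 0 ≤ M - l
  · obtain ⟨hA, hB⟩ := hAB
    have h1 := finsum_restrictedSet (n := n) (σ := σ) (K := K)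
      (fun x => qBinom (M + L - k - ((M - l : ℤ) - x) / 2) (M + l : ℤ))
      (fun x => qBinom (M + L + k - ((M + l : ℤ) - x) / 2) (M - l : ℤ)) hA hB (by omega) (by
        intro x hx
        rw [qBinom_eq_tb (n := z - 2 * k + (M + l) + x) (k := 2 * (M + l)) (by
          rw [hL']; push_cast; ring) (by push_cast; ring)] at hx
        obtain ⟨a, b, h1, -⟩ := exists_of_tb_ne_zero hx
        obtain ⟨c, hc⟩ := hz
        exact ⟨a + k + c - z, by omega⟩)
    refine h1.trans ?_
    clear h1
    congr 1
    · congr 1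
      have : (n : ℚ) + 1 ≠ 0 := by positivity
      push_cast; field_simp; ring
    -- Here `A - B = 2l` and `α - β = 4(l - k)`, so the required inequality reduces to `l` and `k`
    -- having compatible signs.
    have h2 := chain_transform_tb (K := K) n (z - 2 * k + 2 * l) (z + 2 * k - 2 * l) hA hB
      (by omega) (by omega)
    refine Eq.trans ?_ (h2.trans ?_)
    · congr 1
      · funext x
        refine qBinom_eq_tb ?_ ?_
        · rw [hL']; push_cast; ring
        · push_cast; ring
      · funext x
        refine qBinom_eq_tb ?_ ?_
        · rw [hL']; push_cast; ring
        · push_cast; ring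
    -- Since `α + β = 2z`, the binomial in front vanishes for odd `m`; write `m = 2i`.
    · rw [sum_Icc_eq_sum_range _ 0 (M + l + (M - l)) 0 M.toNat]
      · symm
        refine Finset.sum_nbij' (fun i => i.toNat) (fun i => (i : ℤ)) ?_ ?_ ?_ ?_ ?_
        · intro i hi; simp only [Finset.mem_Icc, Finset.mem_range] at *; omega
        · intro i hi; simp only [Finset.mem_Icc, Finset.mem_range] at *; omega
        · intro i hi; simp only [Finset.mem_Icc] at hi; simp [hi.1]
        · intro i _; simp
        · intro i hi
          have hi0 : ((i.toNat : ℕ) : ℤ) = i := Int.toNat_of_nonneg (Finset.mem_Icc.mp hi).1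
          rw [hi0, add_zero]
          congr 1
          · refine qBinom_eq_tb ?_ ?_
            · rw [hL']; push_cast; ring
            · rw [hL']; push_cast; ring
          · congr 1
            funext x
            congr 1
            · refine qBinom_eq_tb ?_ ?_
              · rw [hL']; push_cast; ring
              · push_cast; ring
            · refine qBinom_eq_tb ?_ ?_
              · rw [hL']; push_cast; ring
              · push_cast; ring
      · intro x hx hx' hne
        obtain ⟨a, b, h1, -⟩ := exists_of_tb_ne_zero (left_ne_zero_of_mul hne)
        exact ⟨(x / 2).toNat, by omega, by omega⟩
      · intro i hi _; omega
  · rw [levelInner_of_neg hAB, Finset.sum_eq_zero, mul_zero]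
    intro i hi
    obtain ⟨hi0, hi1⟩ := Finset.mem_Icc.mp hi
    rw [chain_eq_zero (by omega) le_rfl, mul_zero]
    intro x y _ _ _ _ _
    rcases lt_or_ge (i + l) 0 with h | h
    · rw [qBinom_of_neg (b := i + l) (by exact_mod_cast h)]; ring
    · rw [mul_comm (qBinom _ _), qBinom_of_neg (b := i - l)
        (by exact_mod_cast (show i - l < 0 by omega))]; ring

/-! ### The level-`N` Burge transform. -/

/-- Burge's polynomial with a rational argument, as a finite sum. -/
noncomputable def burgeSum (J p p' r s M : ℤ) (L : ℚ) : QPoly :=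
  ∑ j ∈ Finset.Icc (-J) J,
    (qPow (j * (p * p' * j + p' * r - p * s))
        * (qBinom (M + L - (p' - p) * j) (M + p * j) * qBinom (M + L + (p' - p) * j) (M - p * j))
      - qPow ((p * j + r) * (p' * j + s))
        * (qBinom (M + L - (p' - p) * j + r - s) (M + p * j + r)
          * qBinom (M + L + (p' - p) * j - r + s) (M - p * j - r)))

/-- The two bottom entries are non-negative only for `|pj + r| ≤ M`, so one interval serves both
halves of every sum over `j`. -/
theorem mem_Icc_of_nonneg {J M p r j : ℤ} (hJ : M + 1 ≤ J) (hp : 1 ≤ p) (hr : 0 ≤ r)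
    (hrp : r ≤ p) (h1 : 0 ≤ M + p * j + r) (h2 : 0 ≤ M - p * j - r) :
    j ∈ Finset.Icc (-J) J := by
  rw [Finset.mem_Icc]
  constructor
  · by_contra h
    nlinarith [mul_le_mul_of_nonneg_right hp (show 0 ≤ -j - 1 by omega)]
  · by_contra h
    nlinarith [mul_le_mul_of_nonneg_right hp (show 0 ≤ j by omega)]

theorem burgeX_eq_burgeSum {J p p' r s M L : ℤ} (hJ : M + 1 ≤ J) (hp : 1 ≤ p) (hr : 0 ≤ r)
    (hrp : r ≤ p) : burgeX p p' r s M L M L = burgeSum J p p' r s M L := by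
  rw [burgeX, finsum_eq_sum_of_support_subset (s := Finset.Icc (-J) J)]
  · rw [burgeSum]
    refine Finset.sum_congr rfl fun j _ => ?_
    simp only [sub_self, zero_add, add_zero, mul_assoc]
  · intro j hj
    by_contra hj'
    apply hj
    have h1 : ¬ (0 ≤ M + p * j + r ∧ 0 ≤ M - p * j - r) := fun h =>
      hj' (mem_Icc_of_nonneg hJ hp hr hrp h.1 h.2)
    have h2 : ¬ (0 ≤ M + p * j + 0 ∧ 0 ≤ M - p * j - 0) := fun h =>
      hj' (mem_Icc_of_nonneg hJ hp le_rfl (by omega) h.1 h.2)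
    have h3 : qBinom ((M : ℚ) + L - (p' - p) * j + r - s) (M + p * j + r)
        * qBinom (M + L + (p' - p) * j - r + s) (M - p * j - r) = 0 := by
      rcases not_and_or.mp h1 with h | h
      · rw [qBinom_of_neg (by exact_mod_cast not_le.mp h), zero_mul]
      · rw [mul_comm, qBinom_of_neg (by exact_mod_cast not_le.mp h), zero_mul]
    have h4 : qBinom ((M : ℚ) + L - (p' - p) * j) (M + p * j)
        * qBinom (M + L + (p' - p) * j) (M - p * j) = 0 := by
      rw [add_zero, sub_zero] at h2
      rcases not_and_or.mp h2 with h | h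
      · rw [qBinom_of_neg (by exact_mod_cast not_le.mp h), zero_mul]
      · rw [mul_comm, qBinom_of_neg (by exact_mod_cast not_le.mp h), zero_mul]
    simp only [mul_assoc, h3, h4, mul_zero, sub_zero]

theorem levelXsymm_eq_sum {J p p' r s M : ℤ} {N σ : ℕ} {L : ℚ} (hJ : M + 1 ≤ J) (hp : 1 ≤ p)
    (hr : 0 ≤ r) (hrp : r ≤ p) :
    levelXsymm N p p' r s σ M L = ∑ j ∈ Finset.Icc (-J) J,
      (qPow ((j : ℚ) / N * (p * p' * j + p' * r - p * s))
        * levelInner N σ (M + p * j) (M - p * j)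
          (M + L - (p' - p) * j / N) (M + L + (p' - p) * j / N)
      - qPow (1 / N * (p * j + r) * (p' * j + s))
        * levelInner N σ (M + p * j + r) (M - p * j - r)
          (M + L - ((p' - p) * j - r + s) / N) (M + L + ((p' - p) * j - r + s) / N)) := by
  rw [levelXsymm, levelX, finsum_eq_sum_of_support_subset (s := Finset.Icc (-J) J),
    finsum_eq_sum_of_support_subset (s := Finset.Icc (-J) J), Finset.sum_sub_distrib]
  · simp only [sub_self, zero_add, add_zero]
  · intro j hj
    by_contra hj'
    apply hj
    have h1 : ¬ (0 ≤ M + p * j + r ∧ 0 ≤ M - p * j - r) := fun h =>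
      hj' (mem_Icc_of_nonneg hJ hp hr hrp h.1 h.2)
    simp only [levelInner_of_neg h1, mul_zero]
  · intro j hj
    by_contra hj'
    apply hj
    have h2 : ¬ (0 ≤ M + p * j + 0 ∧ 0 ≤ M - p * j - 0) := fun h =>
      hj' (mem_Icc_of_nonneg hJ hp le_rfl (by omega) h.1 h.2)
    rw [add_zero, sub_zero] at h2
    simp only [levelInner_of_neg h2, mul_zero]

/-- The level-`N` Burge transform. -/
theorem levelXsymm_eq_burge {n σ : ℕ} {J K p p' r s M z : ℤ} {L : ℚ} (hL : 2 * L = z)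
    (hz : Even (z + σ)) (hK : 2 * M ≤ K) (hJ : M + 1 ≤ J) (hp : 1 ≤ p) (hp' : 0 ≤ p')
    (hr : 0 ≤ r) (hrp : r ≤ p) (hs : 0 ≤ s) (hsp : s ≤ p') :
    levelXsymm (n + 1) p ((n + 1) * p' + p) r ((n + 1) * s + r) σ M L
      = ∑ i ∈ Finset.Icc 0 M, qBinom (2 * L + M - i) (2 * L)
        * chain K n (2 * i) 0 (fun x => burgeSum J p p' r s i (L - i + x / 2)) (fun _ => 1) := by
  have hn : (n : ℚ) + 1 ≠ 0 := by positivity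
  rw [levelXsymm_eq_sum hJ hp hr hrp]
  simp only [burgeSum, chain_sum_left, chain_sub_left, Finset.mul_sum]
  rw [Finset.sum_comm]
  refine Finset.sum_congr rfl fun j _ => ?_
  simp only [chain_mul_left, mul_sub, Finset.sum_sub_distrib]
  congr 1
  -- The parameters `l = pj` and `k = p'j` have compatible signs, and the factor `q^{-l²/N}` reduces
  -- the exponent to that of the level-one polynomial.
  · have h := levelInner_eq (n := n) (σ := σ) (M := M) (l := p * j) (k := p' * j) (K := K) hL hz hK
      (by
        rcases le_total 0 j with hj | hj
        · exact Or.inl ⟨by positivity, by positivity⟩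
        · exact Or.inr ⟨by nlinarith, by nlinarith⟩)
    have e1 : ((((n : ℤ) + 1) * p' + p : ℤ) - p : ℚ) * j / (n + 1 : ℕ) = (p' * j : ℤ) := by
      push_cast; field_simp; ring
    rw [e1, h, ← mul_assoc, ← qPow_add, Finset.mul_sum]
    refine Finset.sum_congr rfl fun i _ => ?_
    rw [mul_left_comm]
    congr 2
    · congr 1
      push_cast; field_simp; ring
    · congr 1
      funext x
      congr 2 <;> push_cast <;> ring
  -- Now `l = pj + r` and `k = p'j + s`; the bounds on `r` and `s` keep the signs compatible for
  -- negative `j`.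
  · have h := levelInner_eq (n := n) (σ := σ) (M := M) (l := p * j + r) (k := p' * j + s) (K := K)
      hL hz hK
      (by
        rcases le_or_gt 0 j with hj | hj
        · exact Or.inl ⟨by positivity, by positivity⟩
        · exact Or.inr ⟨by nlinarith, by nlinarith⟩)
    have e1 : (((((n : ℤ) + 1) * p' + p : ℤ) - p : ℚ) * j - r + (((n : ℤ) + 1) * s + r : ℤ))
        / (n + 1 : ℕ) = (p' * j + s : ℤ) := by
      push_cast; field_simp; ring
    rw [e1, add_assoc M, sub_sub M, h, ← mul_assoc, ← qPow_add, Finset.mul_sum]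
    refine Finset.sum_congr rfl fun i _ => ?_
    rw [mul_left_comm]
    congr 2
    · congr 1
      push_cast; field_simp; ring
    · congr 1
      funext x
      congr 2 <;> push_cast <;> ring

theorem levelInner_one (A B : ℤ) (h : Even (A - B)) (t₁ t₂ : ℚ) :
    levelInner 1 0 A B t₁ t₂ = qBinom t₁ A * qBinom t₂ B := by
  have hS : restrictedSet 1 0 (A - B) = Set.univ := by
    obtain ⟨c, hc⟩ := h
    refine Set.eq_univ_of_forall fun η => ⟨c, ?_⟩
    rw [hc]
    simp [coord]
  rw [levelInner, hS, finsum_mem_univ]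
  change ∑ᶠ η : Fin 0 → ℤ, _ = _
  rw [finsum_unique]
  simp [coord, invForm, qPow_zero]

theorem levelXsymm_one {p p' r s M L : ℤ} (hp : 1 ≤ p) (hr : 0 ≤ r) (hrp : r ≤ p) :
    levelXsymm 1 p p' r s 0 M L = burgeX p p' r s M L M L := by
  rw [levelXsymm_eq_sum le_rfl hp hr hrp, burgeX_eq_burgeSum le_rfl hp hr hrp, burgeSum]
  refine Finset.sum_congr rfl fun j _ => ?_
  rw [levelInner_one _ _ ⟨p * j, by ring⟩, levelInner_one _ _ ⟨p * j + r, by ring⟩]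
  push_cast
  simp only [div_one, one_mul]
  congr 4 <;> ring_nf

/-- The Burge transform. -/
theorem burgeX_eq_burge {p p' r s M L : ℤ} (hp : 1 ≤ p) (hp' : 0 ≤ p')
    (hr : 0 ≤ r) (hrp : r ≤ p) (hs : 0 ≤ s) (hsp : s ≤ p') :
    burgeX p (p' + p) r (s + r) M L M L
      = ∑ i ∈ Finset.Icc 0 M, qBinom (2 * L + M - i) (2 * L)
        * (qPow (i ^ 2) * burgeX p p' r s i (L - i) i (L - i)) := by
  have h := levelXsymm_eq_burge (n := 0) (σ := 0) (J := M + 1) (K := 2 * M) (L := L) (z := 2 * L)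
    (M := M) (by push_cast; ring) ⟨L, by push_cast; ring⟩ le_rfl le_rfl hp hp' hr hrp hs hsp
  simp only [CharP.cast_eq_zero, zero_add, one_mul] at h
  rw [levelXsymm_one hp hr hrp] at h
  rw [h]
  refine Finset.sum_congr rfl fun i hi => ?_
  have := (Finset.mem_Icc.mp hi).2
  rw [burgeX_eq_burgeSum (J := M + 1) (by omega) hp hr hrp, chain]
  congr 1
  rw [mul_one]
  congr 2
  · push_cast; ring
  · push_cast; ring

/-! ### The initial identity for `(p, p') = (1, 2)`. -/

theorem qBinom_intCast (n k : ℤ) : qBinom (n : ℚ) (k : ℚ) = if 0 ≤ n then gz n k else 0 := by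
  rw [qBinom_eq_tb (n := 2 * n) (k := 2 * k) (by push_cast; ring) (by push_cast; ring), tb,
    hb_two_mul]
  simp

/-- The truncated Gaussian polynomial with integer entries. -/
noncomputable def qb (n k : ℤ) : QPoly := qBinom (n : ℚ) (k : ℚ)

theorem qBinom_eq_qb {a b : ℚ} {n k : ℤ} (ha : a = n) (hb' : b = k) : qBinom a b = qb n k := by
  rw [ha, hb', qb]

theorem qb_eq_zero {n k : ℤ} (h : n < 0 ∨ k < 0 ∨ n < k) : qb n k = 0 := by
  rw [qb, qBinom_intCast]
  split_ifs with hn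
  · rcases lt_or_ge k 0 with hk | hk
    · exact gz_of_neg hk
    · exact gz_eq_zero_of_lt hn (by omega)
  · rfl

theorem qb_zero_right {n : ℤ} (h : 0 ≤ n) : qb n 0 = 1 := by
  rw [qb, qBinom_intCast, if_pos h, gz_zero_right]

theorem qb_symm (n k : ℤ) : qb n (n - k) = qb n k := by
  rw [qb, qb, qBinom_intCast, qBinom_intCast]
  split_ifs with h
  · exact gz_symm h k
  · rfl

/-- The only failure of the truncated rule is at `n' = k' = 0`, where the left side is `1` and the
right side is `0`. -/
theorem qb_pascal {n k n' k' : ℤ} (hn : n' = n + 1) (hk : k' = k + 1) (h : n' ≠ 0 ∨ k' ≠ 0) :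
    qb n' k' = qPow (n - k) * qb n k + qb n k' := by
  subst hn hk
  rcases lt_trichotomy n (-1) with h1 | rfl | h1
  · rw [qb_eq_zero (by omega), qb_eq_zero (by omega), qb_eq_zero (by omega)]; simp
  · rw [qb_eq_zero (n := -1) (by omega), qb_eq_zero (n := -1) (by omega),
      qb_eq_zero (by omega)]; simp
  · simp only [qb, qBinom_intCast]
    rw [if_pos (by omega), if_pos (by omega), if_pos (by omega), gz_pascal']

theorem sum_Icc_neg {M : Type*} [AddCommMonoid M] (f : ℤ → M) (J : ℤ) :
    ∑ j ∈ Finset.Icc (-J) J, f (-j) = ∑ j ∈ Finset.Icc (-J) J, f j := by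
  refine Finset.sum_nbij' (fun j => -j) (fun j => -j) ?_ ?_ ?_ ?_ ?_ <;> intro j hj <;>
    simp only [Finset.mem_Icc, neg_neg] at * <;> omega

theorem sum_Icc_shift {M : Type*} [AddCommMonoid M] (f : ℤ → M) {a b : ℤ} (ha : f a = 0)
    (hb : f (b + 1) = 0) :
    ∑ j ∈ Finset.Icc a b, f (j + 1) = ∑ j ∈ Finset.Icc a b, f j := by
  have h1 : ∑ j ∈ Finset.Icc a b, f (j + 1) = ∑ j ∈ Finset.Icc (a + 1) (b + 1), f j := by
    refine Finset.sum_nbij' (fun j => j + 1) (fun j => j - 1) ?_ ?_ ?_ ?_ ?_ <;> intro j hj <;>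
      simp only [Finset.mem_Icc, add_sub_cancel_right, sub_add_cancel] at * <;> omega
  have h2 : ∑ j ∈ Finset.Icc (a + 1) b, f j = ∑ j ∈ Finset.Icc (a + 1) (b + 1), f j :=
    Finset.sum_subset (Finset.Icc_subset_Icc_right (by omega)) fun j hj hj' => by
      simp only [Finset.mem_Icc] at hj hj'
      rw [show j = b + 1 by omega, hb]
  have h3 : ∑ j ∈ Finset.Icc (a + 1) b, f j = ∑ j ∈ Finset.Icc a b, f j :=
    Finset.sum_subset (Finset.Icc_subset_Icc_left (by omega)) fun j hj hj' => by
      simp only [Finset.mem_Icc] at hj hj'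
      rw [show j = a by omega, ha]
  rw [h1, ← h2, h3]

/-- Reflecting `j` in the subtracted half gives both halves the same power of `q`. -/
theorem burgeX_one_two_eq {M L J : ℤ} (hJ : M + 1 ≤ J) :
    burgeX 1 2 0 1 M L M L = ∑ j ∈ Finset.Icc (-J) J, qPow (j * (2 * j - 1))
      * (qb (M + L - j) (M + j) * qb (M + L + j) (M - j)
        - qb (M + L - j + 1) (M + j) * qb (M + L + j - 1) (M - j)) := by
  rw [burgeX_eq_burgeSum hJ le_rfl le_rfl (by omega), burgeSum, Finset.sum_sub_distrib]
  rw [← sum_Icc_neg (fun j : ℤ => qPow (((1 : ℤ) * j + (0 : ℤ)) * ((2 : ℤ) * j + (1 : ℤ)))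
        * (qBinom ((M : ℚ) + L - ((2 : ℤ) - (1 : ℤ)) * j + (0 : ℤ) - (1 : ℤ))
            (M + (1 : ℤ) * j + (0 : ℤ))
          * qBinom (M + L + ((2 : ℤ) - (1 : ℤ)) * j - (0 : ℤ) + (1 : ℤ))
            (M - (1 : ℤ) * j - (0 : ℤ)))), ← Finset.sum_sub_distrib]
  refine Finset.sum_congr rfl fun j _ => ?_
  rw [mul_sub (qPow _)]
  congr 1
  · congr 1
    · congr 1; push_cast; ring
    · congr 1 <;> refine qBinom_eq_qb ?_ ?_ <;> push_cast <;> ring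
  · congr 1
    · congr 1; push_cast; ring
    · rw [mul_comm]
      congr 1 <;> refine qBinom_eq_qb ?_ ?_ <;> push_cast <;> ring

/-- Two rounds of the Pascal rule. In each round the difference of products has a common term, which
cancels. The exceptional case of the rule does not occur, because the relevant entries have a
positive sum. -/
theorem burgeX_one_two_succ {M L : ℤ} (hM : 1 ≤ M) (hL : 0 ≤ L) :
    burgeX 1 2 0 1 M L M L = qPow (2 * L) * burgeX 1 2 0 1 (M - 1) L (M - 1) L := by
  rw [burgeX_one_two_eq (J := M + 2) (by omega), burgeX_one_two_eq (J := M + 2) (by omega)]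
  have h1 : ∀ j ∈ Finset.Icc (-(M + 2)) (M + 2), qPow (j * (2 * j - 1))
      * (qb (M + L - j) (M + j) * qb (M + L + j) (M - j)
        - qb (M + L - j + 1) (M + j) * qb (M + L + j - 1) (M - j))
      = qPow (2 * j ^ 2 + j + L) * (qb (M + L - j) (M + j) * qb (M + L + j - 1) (M - j - 1))
        - qPow (2 * j ^ 2 - 3 * j + L + 1)
          * (qb (M + L - j) (M + j - 1) * qb (M + L + j - 1) (M - j)) := by
    intro j hj
    rw [qb_pascal (n := M + L - j) (k := M + j - 1) (n' := M + L - j + 1) (k' := M + j) (by ring)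
        (by ring) (by omega),
      qb_pascal (n := M + L + j - 1) (k := M - j - 1) (n' := M + L + j) (k' := M - j) (by ring)
        (by ring) (by omega),
      show (2 : ℚ) * j ^ 2 + j + L
        = j * (2 * j - 1) + ((M + L + j - 1 : ℤ) - (M - j - 1 : ℤ)) by push_cast; ring,
      show (2 : ℚ) * j ^ 2 - 3 * j + L + 1
        = j * (2 * j - 1) + ((M + L - j : ℤ) - (M + j - 1 : ℤ)) by push_cast; ring,
      qPow_add, qPow_add]
    ring
  -- After `j` is shifted in the subtracted sum the powers of `q` agree, and the second round of
  -- Pascal applies.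
  have h2 : ∀ j ∈ Finset.Icc (-(M + 2)) (M + 2),
      qPow (2 * j ^ 2 + j + L) * (qb (M + L - j) (M + j) * qb (M + L + j - 1) (M - j - 1))
        - qPow (2 * (j + 1 : ℤ) ^ 2 - 3 * (j + 1 : ℤ) + L + 1)
          * (qb (M + L - (j + 1)) (M + (j + 1) - 1) * qb (M + L + (j + 1) - 1) (M - (j + 1)))
      = qPow (2 * L) * (qPow (j * (2 * j - 1))
          * (qb (M - 1 + L - j) (M - 1 + j) * qb (M - 1 + L + j) (M - 1 - j)))
        - qPow (2 * L) * (qPow ((j + 1 : ℤ) * (2 * (j + 1 : ℤ) - 1))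
          * (qb (M - 1 + L - (j + 1) + 1) (M - 1 + (j + 1))
            * qb (M - 1 + L + (j + 1) - 1) (M - 1 - (j + 1)))) := by
    intro j hj
    rw [show M + L - (j + 1) = M + L - j - 1 by ring, show M + (j + 1) - 1 = M + j by ring,
      show M + L + (j + 1) - 1 = M + L + j by ring, show M - (j + 1) = M - j - 1 by ring,
      show M - 1 + L - (j + 1) + 1 = M + L - j - 1 by ring,
      show M - 1 + (j + 1) = M + j by ring, show M - 1 + L + (j + 1) - 1 = M + L + j - 1 by ring,
      show M - 1 - (j + 1) = M - j - 2 by ring, show M - 1 + L - j = M + L - j - 1 by ring,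
      show M - 1 + j = M + j - 1 by ring, show M - 1 + L + j = M + L + j - 1 by ring,
      show M - 1 - j = M - j - 1 by ring,
      qb_pascal (n := M + L - j - 1) (k := M + j - 1) (n' := M + L - j) (k' := M + j) (by ring)
        (by ring) (by omega),
      qb_pascal (n := M + L + j - 1) (k := M - j - 2) (n' := M + L + j) (k' := M - j - 1)
        (by ring) (by ring) (by omega)]
    have e1 : qPow (2 * L) * qPow (j * (2 * j - 1)) = qPow (2 * j ^ 2 + j + L)
        * qPow ((M + L - j - 1 : ℤ) - (M + j - 1 : ℤ)) := by
      rw [← qPow_add, ← qPow_add]; congr 1; push_cast; ring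
    have e2 : qPow (2 * L) * qPow ((j + 1 : ℤ) * (2 * (j + 1 : ℤ) - 1)) = qPow (2 * j ^ 2 + j + L)
        * qPow ((M + L + j - 1 : ℤ) - (M - j - 2 : ℤ)) := by
      rw [← qPow_add, ← qPow_add]; congr 1; push_cast; ring
    have e3 : qPow (2 * (j + 1 : ℤ) ^ 2 - 3 * (j + 1 : ℤ) + L + 1) = qPow (2 * j ^ 2 + j + L) := by
      congr 1; push_cast; ring
    rw [e3]
    linear_combination qb (M + L - j - 1) (M + j) * qb (M + L + j - 1) (M - j - 2) * e2
      - qb (M + L - j - 1) (M + j - 1) * qb (M + L + j - 1) (M - j - 1) * e1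
  rw [Finset.sum_congr rfl h1, Finset.sum_sub_distrib,
    ← sum_Icc_shift (fun j : ℤ => qPow (2 * j ^ 2 - 3 * j + L + 1)
      * (qb (M + L - j) (M + j - 1) * qb (M + L + j - 1) (M - j))) _ _,
    ← Finset.sum_sub_distrib, Finset.sum_congr rfl h2, Finset.sum_sub_distrib,
    sum_Icc_shift (fun j : ℤ => qPow (2 * L) * (qPow (j * (2 * j - 1))
          * (qb (M - 1 + L - j + 1) (M - 1 + j) * qb (M - 1 + L + j - 1) (M - 1 - j)))) _ _, ← Finset.sum_sub_distrib, Finset.mul_sum]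
  · refine Finset.sum_congr rfl fun j _ => ?_
    ring
  · rw [qb_eq_zero (k := M - 1 + -(M + 2)) (by omega)]; simp
  · rw [qb_eq_zero (k := M - 1 - (M + 2 + 1)) (by omega)]; simp
  · rw [qb_eq_zero (k := M + -(M + 2) - 1) (by omega)]; simp
  · rw [qb_eq_zero (k := M - (M + 2 + 1)) (by omega)]; simp

/-- The initial identity. -/
theorem burgeX_one_two {M : ℤ} (L : ℤ) (hM : 0 ≤ M) :
    burgeX 1 2 0 1 M L M L = if L = 0 then 1 else 0 := by
  rcases lt_or_ge L 0 with hL | hL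
  · rw [burgeX_one_two_eq le_rfl, if_neg (by omega), Finset.sum_eq_zero]
    intro j _
    have h1 : qb (M + L - j) (M + j) * qb (M + L + j) (M - j) = 0 := by
      rcases lt_or_ge (L - 2 * j) 0 with h | h
      · rw [qb_eq_zero (by omega), zero_mul]
      · rw [qb_eq_zero (n := M + L + j) (by omega), mul_zero]
    have h2 : qb (M + L - j + 1) (M + j) * qb (M + L + j - 1) (M - j) = 0 := by
      rcases lt_or_ge (L - 2 * j + 1) 0 with h | h
      · rw [qb_eq_zero (by omega), zero_mul]
      · rw [qb_eq_zero (n := M + L + j - 1) (by omega), mul_zero]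
    rw [h1, h2]; simp
  · obtain ⟨M, rfl⟩ := Int.eq_ofNat_of_zero_le hM
    induction M with
    | zero =>
      rw [burgeX_one_two_eq le_rfl, Finset.sum_eq_single 0]
      · simp only [Nat.cast_zero, zero_add, sub_zero, add_zero]
        rw [qb_zero_right hL, qb_zero_right (by omega)]
        split_ifs with h
        -- At `M = 0` the value is `1 - [L - 1; 0]`. The truncated convention makes the last
        -- binomial zero at `L = 0`, which is the source of the delta.
        · rw [qb_eq_zero (n := L - 1) (by omega)]; simp [qPow_zero]
        · rw [qb_zero_right (by omega)]; simp
      · intro j _ hj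
        rcases lt_or_gt_of_ne hj with h | h
        · rw [qb_eq_zero (n := _ - j) (k := _ + j) (by simp; omega),
            qb_eq_zero (n := _ - j + 1) (k := _ + j) (by simp; omega)]; simp
        · rw [qb_eq_zero (n := _ + j) (k := _ - j) (by simp; omega),
            qb_eq_zero (n := _ + j - 1) (k := _ - j) (by simp; omega)]; simp
      · simp
    | succ M ih =>
      rw [burgeX_one_two_succ (by omega) hL]
      have : ((M + 1 : ℕ) : ℤ) - 1 = M := by simp
      rw [this, ih (by simp)]
      split_ifs with h
      · rw [h]; simp [qPow_zero]
      · simp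

/-! ### Duality and the closed forms at level one. -/

theorem burgeX_of_neg {p p' r s M L : ℤ} (hM : M < 0) : burgeX p p' r s M L M L = 0 := by
  rw [burgeX]
  refine (finsum_congr fun j => ?_).trans finsum_zero
  have h1 : ∀ x, (M : ℚ) + x < 0 ∨ (M : ℚ) - x < 0 := fun x => by
    have : (M : ℚ) < 0 := by exact_mod_cast hM
    by_contra h
    push Not at h
    linarith [h.1, h.2]
  have h2 : ∀ a b c x, a * qBinom b (M + x) * qBinom c (M - x) = 0 := by
    intro a b c x
    rcases h1 x with h | h
    · rw [qBinom_of_neg h]; simp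
    · rw [qBinom_of_neg h]; simp
  rw [add_assoc (M : ℚ) (p * j), sub_sub (M : ℚ) (p * j), h2, h2, sub_zero]

/-- The duality of Burge's polynomials. -/
theorem burgeX_dual {p p' r s M L : ℤ} (hp : 1 ≤ p) (hp' : 1 ≤ p') (hr : 0 ≤ r) (hrp : r ≤ p)
    (hs : 0 ≤ s) (hsp : s ≤ p') : burgeX p p' r s M L M L = burgeX p' p s r L M L M := by
  have hsymm : ∀ {a b c d : ℚ} {n k : ℤ}, a = n → b = k → c = n → d = n - k →
      qBinom a b = qBinom c d := by
    intro a b c d n k ha hb' hc hd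
    rw [qBinom_eq_qb ha hb', qBinom_eq_qb (n := n) (k := n - k) hc (by rw [hd]; push_cast; ring),
      qb_symm]
  rw [burgeX_eq_burgeSum (le_max_left (M + 1) (L + 1)) hp hr hrp,
    burgeX_eq_burgeSum (le_max_right (M + 1) (L + 1)) hp' hs hsp, burgeSum, burgeSum,
    Finset.sum_sub_distrib, Finset.sum_sub_distrib, ← sum_Icc_neg (fun j : ℤ =>
      qPow (j * (p * p' * j + p' * r - p * s)) * (qBinom (M + L - (p' - p) * j) (M + p * j)
        * qBinom (M + L + (p' - p) * j) (M - p * j)))]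
  congr 1
  · refine Finset.sum_congr rfl fun j _ => ?_
    congr 1
    · congr 1; push_cast; ring
    · congr 1
      · exact hsymm (n := M + L + (p' - p) * j) (k := M - p * j) (by push_cast; ring)
          (by push_cast; ring) (by push_cast; ring) (by push_cast; ring)
      · exact hsymm (n := M + L - (p' - p) * j) (k := M + p * j) (by push_cast; ring)
          (by push_cast; ring) (by push_cast; ring) (by push_cast; ring)
  · refine Finset.sum_congr rfl fun j _ => ?_
    rw [mul_comm (qBinom _ _)]
    congr 1
    · congr 1; ring
    · congr 1
      · exact hsymm (n := M + L + (p' - p) * j - r + s) (k := M - p * j - r) (by push_cast; ring)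
          (by push_cast; ring) (by push_cast; ring) (by push_cast; ring)
      · exact hsymm (n := M + L - (p' - p) * j + r - s) (k := M + p * j + r) (by push_cast; ring)
          (by push_cast; ring) (by push_cast; ring) (by push_cast; ring)

theorem burgeX_two_one (M L : ℤ) :
    burgeX 2 1 1 0 M L M L = if M = 0 ∧ 0 ≤ L then 1 else 0 := by
  rw [burgeX_dual (by omega) le_rfl (by omega) (by omega) le_rfl (by omega)]
  rcases lt_or_ge L 0 with h | h
  · rw [burgeX_of_neg h, if_neg (by omega)]
  · rw [burgeX_one_two M h]; simp [h]

/-- The Burge transform of `(1,2)`: the delta selects `i = L`. -/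
theorem burgeX_one_three (M L : ℤ) :
    burgeX 1 3 0 1 M L M L = qPow (L ^ 2) * qBinom (L + M) (2 * L) := by
  have h := burgeX_eq_burge (p := 1) (p' := 2) (r := 0) (s := 1) (M := M) (L := L) le_rfl
    (by omega) le_rfl (by omega) (by omega) (by omega)
  norm_num only at h
  rw [h, Finset.sum_congr rfl fun i hi => by
    rw [burgeX_one_two (L - i) (Finset.mem_Icc.mp hi).1]]
  by_cases hL : L ∈ Finset.Icc 0 M
  · rw [Finset.sum_eq_single_of_mem L hL fun i _ hi => by rw [if_neg (by omega)]; simp]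
    rw [if_pos (sub_self L), mul_one, mul_comm]
    congr 2; ring
  · rw [Finset.sum_eq_zero fun i hi => by
        rw [if_neg (fun h' => hL (by rwa [show L = i by omega]))]; simp,
      qBinom_eq_qb (n := L + M) (k := 2 * L) (by push_cast; ring) (by push_cast; ring),
      qb_eq_zero, mul_zero]
    rw [Finset.mem_Icc] at hL
    omega

theorem burgeX_three_one (M L : ℤ) :
    burgeX 3 1 1 0 M L M L = qPow (M ^ 2) * qBinom (L + M) (2 * M) := by
  rw [burgeX_dual (by omega) le_rfl (by omega) (by omega) le_rfl (by omega), burgeX_one_three,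
    add_comm (L : ℚ)]

/-- The Burge transform of `(2,1)`: only `i = 0` contributes. -/
theorem burgeX_two_three (M L : ℤ) :
    burgeX 2 3 1 1 M L M L = qBinom (2 * L + M) (2 * L) := by
  have h := burgeX_eq_burge (p := 2) (p' := 1) (r := 1) (s := 0) (M := M) (L := L) (by omega)
    (by omega) (by omega) (by omega) (by omega) (by omega)
  norm_num only at h
  simp only [h, burgeX_two_one]
  by_cases hM : 0 ≤ M ∧ 0 ≤ L
  · rw [Finset.sum_eq_single_of_mem 0 (by simp [hM.1]) fun i _ hi => by
      rw [if_neg (by omega)]; simp]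
    simp [qPow_zero, hM.2]
  · rw [Finset.sum_eq_zero, qBinom_eq_qb (n := 2 * L + M) (k := 2 * L) (by push_cast; ring)
        (by push_cast; ring), qb_eq_zero (by omega)]
    intro i hi
    rw [if_neg, mul_zero, mul_zero]
    rw [Finset.mem_Icc] at hi
    omega

/-! ### The families for `(2, N+2)` and `(2, 3N+2)`. -/

/-- For odd `w` every top entry is a proper half-integer. Thus the weight at `μ_1` enforces the
parity of `μ_1` in the transform. -/
theorem burgeSum_half {J p p' r s M w : ℤ} (hJ : M + 1 ≤ J) (hp : 1 ≤ p) (hr : 0 ≤ r)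
    (hrp : r ≤ p) : burgeSum J p p' r s M ((w : ℚ) / 2)
      = if Even w then burgeX p p' r s M (w / 2) M (w / 2) else 0 := by
  split_ifs with hw
  · obtain ⟨y, rfl⟩ := hw
    rw [show (y + y) / 2 = y by omega, burgeX_eq_burgeSum hJ hp hr hrp]
    congr 1; push_cast; ring
  · have hz : ∀ {a b : ℚ} {n k : ℤ}, a = ((w + 2 * n : ℤ) : ℚ) / 2 → b = k → qBinom a b = 0 := by
      intro a b n k ha hb'
      rw [qBinom_eq_tb (n := w + 2 * n) (k := 2 * k) ha (by rw [hb']; push_cast; ring)]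
      refine not_not.mp (mt exists_of_tb_ne_zero ?_)
      rintro ⟨c, d, h1, -⟩
      exact hw ⟨c - n, by omega⟩
    rw [burgeSum]
    refine Finset.sum_eq_zero fun j _ => ?_
    rw [hz (a := M + (w : ℚ) / 2 - (p' - p) * j) (n := M - (p' - p) * j) (k := M + p * j)
        (by push_cast; ring) (by push_cast; ring),
      hz (a := M + (w : ℚ) / 2 - (p' - p) * j + r - s) (n := M - (p' - p) * j + r - s)
        (k := M + p * j + r) (by push_cast; ring) (by push_cast; ring)]
    simp

theorem chain_zero_zero (K : ℤ) (n : ℕ) (f g : ℤ → QPoly) (hK : 0 ≤ K) :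
    chain K n 0 0 f g = f 0 * g 0 := by
  induction n generalizing g with
  | zero => simp [chain, qPow_zero]
  | succ n ih =>
    rw [chain, Finset.sum_eq_single_of_mem 0 (by simp [hK])]
    · rw [ih]
      simp only [mul_zero, add_zero, hb_zero_right (show Even (0 : ℤ) by simp)]
      simp [qPow_zero]; ring
    · intro c hc hc0
      have hc' := (Finset.mem_Icc.mp hc).1
      rw [chain_eq_zero le_rfl hc', mul_zero]
      intro x y _ _ hy hy' _
      by_contra hne
      obtain ⟨a, b, h1, h2, h3, h4⟩ := exists_of_hb_ne_zero (right_ne_zero_of_mul hne)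
      omega

theorem qBinom_of_lt {a b : ℚ} (h : a < b) : qBinom a b = 0 := by
  rw [qBinom, if_neg]
  rintro ⟨-, -, -, h'⟩
  linarith

/-- The closed form of `levelXsymm` for `p = 2`, `p' = N + 2`. -/
theorem levelXsymm_two {n σ : ℕ} {M z : ℤ} {L : ℚ} (hL : 2 * L = z) (hz : Even (z + σ))
    (hσ : σ = 0 ∨ σ = 1) :
    levelXsymm (n + 1) 2 (n + 1 + 2) 1 1 σ M L
      = qBinom (2 * L + M) (2 * L) * (if σ = 0 then 1 else 0) := by
  have h := levelXsymm_eq_burge (n := n) (σ := σ) (p := 2) (p' := 1) (r := 1) (s := 0) (M := M)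
    hL hz le_rfl le_rfl (by omega) (by omega) (by omega) (by omega) (by omega) (by omega)
  simp only [mul_one, mul_zero, zero_add] at h
  rw [h]
  have hf : ∀ i ∈ Finset.Icc 0 M, (fun x : ℤ => burgeSum (M + 1) 2 1 1 0 i (L - i + x / 2))
      = fun x => if Even (z - 2 * i + x) ∧ i = 0 ∧ 0 ≤ z - 2 * i + x then 1 else 0 := by
    intro i hi
    funext x
    rw [Finset.mem_Icc] at hi
    rw [show L - i + x / 2 = ((z - 2 * i + x : ℤ) : ℚ) / 2 by push_cast; rw [← hL]; ring,
      burgeSum_half (by omega) (by omega) (by omega) (by omega), burgeX_two_one]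
    by_cases he : Even (z - 2 * i + x)
    · obtain ⟨c, hc⟩ := he
      rw [if_pos ⟨c, hc⟩]
      refine if_congr ⟨fun h => ⟨⟨c, hc⟩, h.1, ?_⟩, fun h => ⟨h.2.1, ?_⟩⟩ rfl rfl <;> omega
    · rw [if_neg he, if_neg (by tauto)]
  rw [Finset.sum_congr rfl fun i hi => by rw [hf i hi]]
  by_cases hMz : 0 ≤ M ∧ 0 ≤ z
  · rw [Finset.sum_eq_single_of_mem 0 (by simp [hMz.1])]
    -- Only the zero chain is left, so `μ_1 = 0` and the parity condition says that `2L` is even,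
    -- that is, `σ = 0`.
    · rw [mul_zero, chain_zero_zero _ _ _ _ (by omega)]
      simp only [Int.cast_zero, sub_zero, mul_one]
      congr 1
      obtain ⟨c, hc⟩ := hz
      refine if_congr ?_ rfl rfl
      constructor
      · rintro ⟨⟨d, hd⟩, -⟩
        omega
      · rintro rfl
        exact ⟨⟨c, by push_cast at hc; omega⟩, trivial, by omega⟩
    · intro i hi hi0
      rw [chain_eq_zero (by have := (Finset.mem_Icc.mp hi).1; omega) le_rfl, mul_zero]
      intro x y _ _ _ _ _
      rw [if_neg (by tauto), zero_mul]
  · have h0 : qBinom (2 * L + M) (2 * L) = 0 := by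
      rcases not_and_or.mp hMz with h | h
      · have : (M : ℚ) < 0 := by exact_mod_cast not_le.mp h
        exact qBinom_of_lt (by linarith)
      · have : (z : ℚ) < 0 := by exact_mod_cast not_le.mp h
        exact qBinom_of_neg (by linarith)
    rw [h0, zero_mul]
    refine Finset.sum_eq_zero fun i hi => ?_
    rcases not_and_or.mp hMz with h | h
    · rw [Finset.mem_Icc] at hi; omega
    · have : (z : ℚ) < 0 := by exact_mod_cast not_le.mp h
      rw [qBinom_of_neg (by linarith), zero_mul]

/-- The Gordon type form of `levelXsymm`. -/
theorem levelXsymm_gordon {n σ : ℕ} {M z : ℤ} {L : ℚ} (hL : 2 * L = z) (hz : Even (z + σ)) :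
    levelXsymm (n + 1) 2 (3 * (n + 1) + 2) 1 (n + 1 + 1) σ M L = gordonForm (n + 1) σ M L := by
  have h := levelXsymm_eq_burge (n := n) (σ := σ) (p := 2) (p' := 3) (r := 1) (s := 1) (M := M)
    hL hz le_rfl le_rfl (by omega) (by omega) (by omega) (by omega) (by omega) (by omega)
  simp only [mul_one, mul_comm ((n : ℤ) + 1) 3] at h
  rw [h, gordonForm]
  refine Finset.sum_congr rfl fun i hi => ?_
  rw [Finset.mem_Icc] at hi
  -- With `y = L - i + x/2` the closed form is `[2y + i; 2y] = [2y + i; i]`, and `2y + i = 2L - i +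
  -- x`.
  have hF : ∀ x : ℤ, burgeSum (M + 1) 2 3 1 1 i (L - i + x / 2)
      = if Even (x + 2 * i + σ) then qBinom (2 * L - i + x) i else 0 := by
    intro x
    rw [show L - i + x / 2 = ((z - 2 * i + x : ℤ) : ℚ) / 2 by push_cast; rw [← hL]; ring,
      burgeSum_half (by omega) (by omega) (by omega) (by omega), burgeX_two_three]
    obtain ⟨c, hc⟩ := hz
    refine if_ctx_congr ?_ (fun hx => ?_) fun _ => rfl
    · constructor
      · rintro ⟨d, hd⟩; exact ⟨d - z + 2 * i + c, by omega⟩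
      · rintro ⟨d, hd⟩; exact ⟨d + z - 2 * i - c, by omega⟩
    · obtain ⟨d, hd⟩ := hx
      have : (z - 2 * i + x) / 2 = d + z - 2 * i - c := by omega
      rw [this, qBinom_eq_qb (n := z - i + x) (k := z - i + x - i)
          (by have : 2 * (d + z - 2 * i - c) + i = z - i + x := by omega
              rw [← this]; push_cast; ring)
          (by have : 2 * (d + z - 2 * i - c) = z - i + x - i := by omega
              rw [← this]; push_cast; ring), qb_symm,
        qBinom_eq_qb (n := z - i + x) (k := i) (by rw [hL]; push_cast; ring) rfl]
  have h1 := finsum_restrictedSet (n := n) (σ := σ) (A := 2 * i) (B := 0) (K := 2 * M)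
    (fun x => burgeSum (M + 1) 2 3 1 1 i (L - i + x / 2)) (fun _ => 1) (by omega) le_rfl (by omega)
    (by
      intro x hx
      by_contra hne
      rw [hF, if_neg hne] at hx
      exact hx rfl)
  -- Insert `q^{i²/N} q^{-i²/N} = 1`: the second power is the one needed to turn the chain from `2i`
  -- to `0` back into a restricted sum.
  have h2 : chain (2 * M) n (2 * i) 0
      (fun x => burgeSum (M + 1) 2 3 1 1 i (L - i + x / 2)) (fun _ => 1)
      = qPow ((i : ℚ) ^ 2 / (n + 1)) * (qPow (-(((2 * i : ℤ) : ℚ) - (0 : ℤ)) ^ 2 / (4 * (n + 1)))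
        * chain (2 * M) n (2 * i) 0
      (fun x => burgeSum (M + 1) 2 3 1 1 i (L - i + x / 2)) (fun _ => 1)) := by
    rw [← mul_assoc, ← qPow_add]
    have : (i : ℚ) ^ 2 / (n + 1) + -(((2 * i : ℤ) : ℚ) - (0 : ℤ)) ^ 2 / (4 * (n + 1)) = 0 := by
      have : (n : ℚ) + 1 ≠ 0 := by positivity
      push_cast; field_simp; ring
    rw [this, qPow_zero, one_mul]
  rw [h2, ← h1, mul_left_comm, ← mul_assoc]
  have e1 : ((n + 1 : ℕ) : ℚ) = n + 1 := by push_cast; ring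
  rw [e1, sub_zero]
  congr 1
  refine finsum_mem_congr rfl fun η hη => ?_
  change Fin n → ℤ at η
  have e2 : ((2 * i : ℤ) : ℚ) • unitVec n 1 + ((0 : ℤ) : ℚ) • unitVec n n
      = (2 * (i : ℚ)) • unitVec n 1 := by push_cast; simp
  have hC := solveA_mulVec (((2 * i : ℤ) : ℚ) • unitVec n 1 + ((0 : ℤ) : ℚ) • unitVec n n)
    (ratVec η)
  rw [← sub_zero (2 * i), mem_restrictedSet_iff hC] at hη
  obtain ⟨w, hw⟩ := hη
  rw [extQ_one] at hw
  have h3 : burgeSum (M + 1) 2 3 1 1 i (L - i + coord (solveA (((2 * i : ℤ) : ℚ) • unitVec n 1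
      + ((0 : ℤ) : ℚ) • unitVec n n) (ratVec η)) 1 ((0 : ℤ) : ℚ) / 2)
      = qBinom (2 * L - i + coord (solveA (((2 * i : ℤ) : ℚ) • unitVec n 1
      + ((0 : ℤ) : ℚ) • unitVec n n) (ratVec η)) 1 ((0 : ℤ) : ℚ)) i := by
    rw [hw, hF, if_pos ⟨2 * i + σ - w, by ring⟩]
  rw [h3, mul_one, e2, Int.cast_zero]
  rfl

/-! ### The family attached to `A_N`. -/

theorem ext_nonneg {n : ℕ} {A B : ℤ} {m : Fin n → ℤ} (hA : 0 ≤ A) (hB : 0 ≤ B)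
    (hm : ∀ k, 0 ≤ m k) (k : ℕ) : 0 ≤ ext A B m k := by
  rw [ext]; split_ifs
  · exact hA
  · exact hm _
  · exact hB

/-- The end `A` is required to be non-negative only when all `m_k` are, because in the tadpole case
it depends on `m_1`. -/
theorem prod_qBinom_ext {n : ℕ} {A B : ℤ} (m : Fin n → ℤ) (hA : (∀ k, 0 ≤ m k) → 0 ≤ A)
    (hB : 0 ≤ B) :
    ∏ k : Fin n, qBinom (((ext A B m k : ℚ) + ext A B m (k + 2)) / 2) (m k)
      = ∏ k ∈ Finset.range n, hb (ext A B m k + ext A B m (k + 2)) (2 * ext A B m (k + 1)) := by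
  rw [← Fin.prod_univ_eq_prod_range
    (fun k => hb (ext A B m k + ext A B m (k + 2)) (2 * ext A B m (k + 1)))]
  have key : ∀ k : Fin n, qBinom (((ext A B m k : ℚ) + ext A B m (k + 2)) / 2) (m k)
      = tb (ext A B m k + ext A B m (k + 2)) (2 * ext A B m (k + 1)) := by
    intro k
    refine qBinom_eq_tb ?_ ?_
    · push_cast; ring
    · rw [ext_succ_fin]; push_cast; ring
  by_cases hμ : ∀ k, 0 ≤ m k
  · have hext := ext_nonneg (hA hμ) hB hμ
    refine Finset.prod_congr rfl fun k _ => ?_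
    rw [key, tb_of_nonneg (add_nonneg (hext _) (hext _))]
  · push Not at hμ
    obtain ⟨k, hk⟩ := hμ
    rw [Finset.prod_eq_zero (Finset.mem_univ k), Finset.prod_eq_zero (Finset.mem_univ k)]
    · rw [ext_succ_fin]
      refine not_not.mp (mt exists_of_hb_ne_zero ?_)
      rintro ⟨a, b, -, h1, h2, -⟩
      omega
    · exact qBinom_of_neg (by exact_mod_cast hk)

theorem incA_mulVec_extQ {n : ℕ} (A B : ℚ) (v : Fin n → ℚ) (i : Fin n) :
    (incA n *ᵥ v) i = extQ A B v i + extQ A B v (i + 2)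
      - (A • unitVec n 1 + B • unitVec n n) i := by
  rw [incA, Matrix.sub_mulVec, Matrix.smul_mulVec, Matrix.one_mulVec, Pi.sub_apply,
    cartanA_mulVec_extQ A B, Pi.smul_apply, smul_eq_mul, extQ_fin]
  ring

theorem dotProduct_cartanA {n : ℕ} (A : ℤ) (m : Fin n → ℤ) :
    ratVec m ⬝ᵥ (cartanA n *ᵥ ratVec m)
      = ∑ k ∈ Finset.range (n + 1), ((ext A 0 m k : ℚ) - ext A 0 m (k + 1)) ^ 2
        - A ^ 2 + 2 * A * ext A 0 m 1 := by
  rw [sum_sq_sub (fun k => (ext A 0 m k : ℚ)), ext_zero, ext_last, dotProduct,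
    ← Fin.sum_univ_eq_sum_range (fun k => (ext A 0 m (k + 1) : ℚ)
      * (2 * ext A 0 m (k + 1) - ext A 0 m k - ext A 0 m (k + 2)))]
  have h1 : ∀ i : Fin n, ratVec m i * (cartanA n *ᵥ ratVec m) i
      = (ext A 0 m (i + 1) : ℚ) * (2 * ext A 0 m (i + 1) - ext A 0 m i - ext A 0 m (i + 2))
        + A * (ext A 0 m (i + 1) * unitVec n 1 i) := by
    intro i
    have hi := i.isLt
    rw [cartanA_mulVec_extQ (A : ℚ) (0 : ℤ), extQ_ratVec _ _ _ (by omega),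
      extQ_ratVec _ _ _ (by omega), extQ_ratVec _ _ _ (by omega), ext_succ_fin]
    simp only [Pi.add_apply, Pi.smul_apply, smul_eq_mul, ratVec]
    push_cast; ring
  have h2 : ∑ i : Fin n, (ext A 0 m (i + 1) : ℚ) * unitVec n 1 i = ext A 0 m 1 := by
    rcases n with _ | n
    · rw [ext_last]; simp
    · rw [Fin.sum_univ_succ]
      simp [unitVec]
  rw [Finset.sum_congr rfl fun i _ => h1 i, Finset.sum_add_distrib, ← Finset.mul_sum, h2]
  push_cast; ring

/-- Integral top entries force neighbours at distance two to have equal parity, so the parities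
alternate between those of `A` and `m_1`. -/
theorem even_ext {n : ℕ} {A B : ℤ} {m : Fin n → ℤ}
    (h : ∀ k < n, hb (ext A B m k + ext A B m (k + 2)) (2 * ext A B m (k + 1)) ≠ 0) :
    ∀ k ≤ n + 1, Even (ext A B m k - if Even k then A else ext A B m 1) := by
  intro k
  induction k using Nat.twoStepInduction with
  | zero => intro _; simp [ext_zero]
  | one => intro _; simp
  | more k ih _ =>
    intro hk
    obtain ⟨c, hc⟩ := ih (by omega)
    obtain ⟨a, b, h1, -⟩ := exists_of_hb_ne_zero (h k (by omega))
    have : Even (k + 2) ↔ Even k := by simp [Nat.even_add]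
    simp only [this]
    exact ⟨a - ext A B m k + c, by omega⟩

/-- The entry `m_0 = 2L` has the parity of `σ`, and the binomial with `m_1/2` makes `m_1` even;
hence the congruences on `m` hold automatically on the support. -/
theorem typeAForm_eq_chain {n σ : ℕ} {K M z : ℤ} {L : ℚ} (hL : 2 * L = z) (hz : Even (z + σ))
    (hz0 : 0 ≤ z) (hK : z ≤ K) :
    typeAForm n σ M L = chain K n z 0 (fun x => qPow (-(z : ℚ) ^ 2 / 4 + z * x / 2)
      * qBinom (2 * L + M - x / 2) (2 * L)) (fun _ => 1) := by
  rw [← finsum_vecTerm _ _ hz0 le_rfl (by omega), typeAForm]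
  have hterm : ∀ m : Fin n → ℤ, vecTerm z 0 (fun x => qPow (-(z : ℚ) ^ 2 / 4 + z * x / 2)
      * qBinom (2 * L + M - x / 2) (2 * L)) (fun _ => 1) m
      = qPow (1 / 4 * (ratVec m ⬝ᵥ (cartanA n *ᵥ ratVec m)))
      * qBinom (2 * L + M - coord (ratVec m) 1 0 / 2) (2 * L)
      * ∏ k, qBinom (m k + ((1 / 2 : ℚ) • (incA n *ᵥ ratVec m + (2 * L) • unitVec n 1)
        - ratVec m) k) (m k) := by
    intro m
    have h1 : ∀ k : Fin n, (m k : ℚ) + ((1 / 2 : ℚ) • (incA n *ᵥ ratVec m + (2 * L) • unitVec n 1)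
        - ratVec m) k = ((ext z 0 m k : ℚ) + ext z 0 m (k + 2)) / 2 := by
      intro k
      have hk := k.isLt
      simp only [Pi.sub_apply, Pi.smul_apply, Pi.add_apply, smul_eq_mul]
      rw [incA_mulVec_extQ (z : ℚ) (0 : ℤ), extQ_ratVec _ _ _ (by omega),
        extQ_ratVec _ _ _ (by omega)]
      simp only [Pi.smul_apply, Pi.add_apply, smul_eq_mul, ratVec, hL]
      push_cast; ring
    have h2 : coord (ratVec m) 1 0 = ext z 0 m 1 := by
      rw [← extQ_ratVec _ _ _ (by omega), extQ_one, Int.cast_zero]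
    simp only [h1]
    rw [prod_qBinom_ext m (fun _ => hz0) le_rfl, dotProduct_cartanA z m, h2, vecTerm, ← Finset.sum_div]
    have e : qPow (1 / 4 * (∑ k ∈ Finset.range (n + 1), ((ext z 0 m k : ℚ) - ext z 0 m (k + 1)) ^ 2
        - z ^ 2 + 2 * z * ext z 0 m 1))
        = qPow ((∑ k ∈ Finset.range (n + 1), ((ext z 0 m k : ℚ) - ext z 0 m (k + 1)) ^ 2) / 4)
          * qPow (-(z : ℚ) ^ 2 / 4 + z * ext z 0 m 1 / 2) := by
      rw [← qPow_add]; congr 1; ring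
    rw [e]; ring
  simp only [← hterm]
  refine finsum_mem_eq_finsum_of_forall fun m hm => ?_
  obtain ⟨h1, -, h3⟩ := vecTerm_ne_zero hm
  have heven := even_ext h3
  intro k
  have hk := k.isLt
  have hx := heven (k + 1) (by omega)
  rw [ext_succ_fin] at hx
  replace h1 := right_ne_zero_of_mul h1
  have hm1 : Even (ext z 0 m 1) := by
    rw [qBinom_eq_tb (n := 2 * z + 2 * M - ext z 0 m 1) (k := 2 * z) (by rw [hL]; push_cast; ring)
      (by rw [hL]; push_cast; ring)] at h1
    obtain ⟨a, b, h4, -⟩ := exists_of_tb_ne_zero h1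
    exact ⟨z + M - a, by omega⟩
  obtain ⟨c, hc⟩ := hm1
  obtain ⟨d, hd⟩ := hz
  obtain ⟨e, he⟩ := hx
  by_cases hpar : Even ((k : ℕ) + 1)
  · rw [if_pos hpar] at he ⊢
    exact (Int.modEq_iff_dvd.mpr ⟨σ - d - e, by omega⟩)
  · rw [if_neg hpar] at he ⊢
    exact (Int.modEq_iff_dvd.mpr ⟨- c - e, by omega⟩)

theorem sum_Icc_even {A : Type*} [AddCommMonoid A] (F : ℤ → A) {M K : ℤ} (hK : 2 * M ≤ K)
    (h : ∀ x, 0 ≤ x → x ≤ K → F x ≠ 0 → Even x ∧ x ≤ 2 * M) :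
    ∑ x ∈ Finset.Icc 0 K, F x = ∑ i ∈ Finset.Icc 0 M, F (2 * i) := by
  symm
  refine Finset.sum_bij_ne_zero (fun i _ _ => 2 * i) ?_ ?_ ?_ ?_
  · intro i hi _
    rw [Finset.mem_Icc] at *
    omega
  · intro i _ _ j _ _ h; omega
  · intro x hx hne
    rw [Finset.mem_Icc] at hx
    obtain ⟨⟨c, hc⟩, hM⟩ := h x hx.1 hx.2 hne
    have : 2 * c = x := by omega
    subst this
    exact ⟨c, by rw [Finset.mem_Icc]; omega, hne, rfl⟩
  · intro i _ _; rfl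

/-- The form of `levelXsymm` attached to `A_N`. -/
theorem levelXsymm_typeA {n σ : ℕ} {M z : ℤ} {L : ℚ} (hL : 2 * L = z) (hz : Even (z + σ)) :
    levelXsymm (n + 1) 3 (n + 1 + 3) 1 1 σ M L = typeAForm (n + 1) σ M L := by
  rcases lt_or_ge z 0 with hz0 | hz0
  · have : (z : ℚ) < 0 := by exact_mod_cast hz0
    have h := levelXsymm_eq_burge (n := n) (σ := σ) (p := 3) (p' := 1) (r := 1) (s := 0) (M := M)
      hL hz le_rfl le_rfl (by omega) (by omega) (by omega) (by omega) (by omega) (by omega)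
    simp only [mul_one, mul_zero, zero_add] at h
    rw [h, Finset.sum_eq_zero fun i _ => by rw [qBinom_of_neg (by linarith), zero_mul], typeAForm]
    refine ((finsum_mem_congr rfl fun m _ => ?_).trans (finsum_mem_zero _)).symm
    simp only [qBinom_of_neg (show 2 * L < 0 by linarith), mul_zero, zero_mul]
  have h := levelXsymm_eq_burge (n := n) (σ := σ) (p := 3) (p' := 1) (r := 1) (s := 0) (M := M)
    (K := max (2 * M) z) hL hz (le_max_left _ _) le_rfl (by omega) (by omega) (by omega) (by omega)
    (by omega) (by omega)
  simp only [mul_one, mul_zero, zero_add] at h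
  -- Splitting off `m_1 = 2i` leaves a chain with one entry fewer from `2i` to `0`, with weight `[(z
  -- + x)/2; 2i]`. This is the transform of `(3,1)`; the remaining power of `q` is `q^{i²}`.
  rw [h, typeAForm_eq_chain hL hz hz0 (le_max_right (2 * M) z), chain_succ_left,
    sum_Icc_even _ (le_max_left (2 * M) z)]
  · refine Finset.sum_congr rfl fun i hi => ?_
    rw [Finset.mem_Icc] at hi
    have hF : ∀ x : ℤ, burgeSum (M + 1) 3 1 1 0 i (L - i + x / 2)
        = qPow ((i : ℚ) ^ 2) * tb (z + x) (2 * (2 * i)) := by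
      intro x
      rw [show L - i + x / 2 = ((z - 2 * i + x : ℤ) : ℚ) / 2 by push_cast; rw [← hL]; ring,
        burgeSum_half (by omega) (by omega) (by omega) (by omega), burgeX_three_one]
      split_ifs with hx
      · obtain ⟨c, hc⟩ := hx
        rw [show (z - 2 * i + x) / 2 = c by omega]
        congr 1
        refine qBinom_eq_tb ?_ ?_
        · rw [show z + x = 2 * c + 2 * i by omega]; push_cast; ring
        · push_cast; ring
      · rw [not_not.mp (mt exists_of_tb_ne_zero _), mul_zero]
        rintro ⟨a, b, h1, -⟩
        exact hx ⟨a - i, by omega⟩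
    simp only [hF, chain_mul_left]
    rw [chain_congr (f := fun x => tb (z + x) (2 * (2 * i)))
      (f' := fun x => hb (z + x) (2 * (2 * i))) (g := fun _ => 1) (g' := fun _ => 1)
      (by omega) le_rfl (fun x y hx _ _ _ _ => by rw [tb_of_nonneg (by omega)])]
    have e : qPow (((z : ℚ) - (2 * i : ℤ)) ^ 2 / 4) * qPow (-(z : ℚ) ^ 2 / 4 + z * (2 * i : ℤ) / 2)
        = qPow ((i : ℚ) ^ 2) := by
      rw [← qPow_add]; congr 1; push_cast; ring
    rw [← mul_assoc (qPow (((z : ℚ) - (2 * i : ℤ)) ^ 2 / 4)), e,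
      show 2 * L + M - ((2 * i : ℤ) : ℚ) / 2 = 2 * L + M - i by push_cast; ring]
    ring
  · intro x hx0 hxK hne
    have h1 := right_ne_zero_of_mul (right_ne_zero_of_mul (left_ne_zero_of_mul hne))
    rw [qBinom_eq_tb (n := 2 * z + 2 * M - x) (k := 2 * z) (by rw [hL]; push_cast; ring)
      (by rw [hL]; push_cast; ring)] at h1
    obtain ⟨a, b, h4, h5, h6, h7⟩ := exists_of_tb_ne_zero h1
    exact ⟨⟨z + M - a, by omega⟩, by omega⟩

/-! ### The tadpole family. -/

theorem ext_one {n : ℕ} (A A' B : ℤ) (m : Fin n → ℤ) : ext A B m 1 = ext A' B m 1 := by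
  simp [ext]

theorem incT_mulVec {n : ℕ} (v : Fin n → ℚ) :
    incT n *ᵥ v = incA n *ᵥ v + coord v 1 0 • unitVec n 1 := by
  rw [incT, Matrix.add_mulVec]
  congr 1
  funext i
  have hi := i.isLt
  simp only [Matrix.mulVec, dotProduct, Matrix.of_apply, Pi.smul_apply, smul_eq_mul, unitVec,
    ite_mul, one_mul, zero_mul]
  rw [Finset.sum_eq_single i (fun j _ hj => if_neg fun h => hj h.1.symm) (by simp)]
  by_cases h : i.val + 1 = 1
  · rw [if_pos ⟨rfl, h⟩, if_pos h, mul_one, coord, dif_pos ⟨le_rfl, by omega⟩]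
    congr 1
    ext
    simp; omega
  · rw [if_neg fun h' => h h'.2, if_neg h, mul_zero]

theorem dotProduct_unitVec_one {n : ℕ} (v : Fin n → ℚ) : v ⬝ᵥ unitVec n 1 = coord v 1 0 := by
  rcases n with _ | n
  · simp [coord]
  · rw [dotProduct, Fin.sum_univ_succ]
    simp [unitVec, coord]

theorem dotProduct_cartanT {n : ℕ} (v : Fin n → ℚ) :
    v ⬝ᵥ (cartanT n *ᵥ v) = v ⬝ᵥ (cartanA n *ᵥ v) - coord v 1 0 ^ 2 := by
  have h : cartanT n *ᵥ v = cartanA n *ᵥ v - coord v 1 0 • unitVec n 1 := by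
    rw [cartanT, Matrix.sub_mulVec, incT_mulVec, incA, Matrix.sub_mulVec]
    abel
  rw [h, dotProduct_sub, dotProduct_smul, dotProduct_unitVec_one, smul_eq_mul, sq]

theorem coord_ratVec_one {n : ℕ} (A : ℤ) (m : Fin n → ℤ) :
    coord (ratVec m) 1 0 = ext A 0 m 1 := by
  rw [← extQ_ratVec _ _ _ (by omega), extQ_one, Int.cast_zero]

theorem nonneg_of_hb_ne_zero {n : ℕ} {A B : ℤ} {m : Fin n → ℤ}
    (h : ∀ k < n, hb (ext A B m k + ext A B m (k + 2)) (2 * ext A B m (k + 1)) ≠ 0) (k : Fin n) :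
    0 ≤ m k := by
  obtain ⟨a, b, -, h2, h3, -⟩ := exists_of_hb_ne_zero (h k k.isLt)
  rw [ext_succ_fin] at h2
  omega

/-- The summand of `tadpoleForm`, written as the summand of a chain sum. -/
theorem tadpole_summand {n : ℕ} {M z : ℤ} {L : ℚ} (hL : 2 * L = z) (hz0 : 0 ≤ z)
    (m : Fin n → ℤ) :
    qPow (L ^ 2) * (qPow (1 / 4 * (ratVec m ⬝ᵥ (cartanT n *ᵥ ratVec m)))
      * qBinom (L + M - coord (ratVec m) 1 0 / 2) (2 * L)
      * ∏ k, qBinom (m k + ((1 / 2 : ℚ) • (incT n *ᵥ ratVec m + (2 * L) • unitVec n 1)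
        - ratVec m) k) (m k))
    = qBinom (2 * L + M - ((z + ext 0 0 m 1 : ℤ) : ℚ) / 2) (2 * L)
      * vecTerm (z + ext 0 0 m 1) 0 (fun _ => 1) (fun _ => 1) m := by
  -- The loop of the tadpole at node `1` is absorbed in the left end of the chain, which becomes `A
  -- = 2L + m_1`; completing the square accounts for `q^{L²}`.
  set A := z + ext 0 0 m 1 with hA
  have h1 : ∀ k : Fin n, (m k : ℚ) + ((1 / 2 : ℚ) • (incT n *ᵥ ratVec m + (2 * L) • unitVec n 1)
      - ratVec m) k = ((ext A 0 m k : ℚ) + ext A 0 m (k + 2)) / 2 := by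
    intro k
    have hk := k.isLt
    simp only [Pi.sub_apply, Pi.smul_apply, Pi.add_apply, smul_eq_mul, incT_mulVec]
    rw [incA_mulVec_extQ (A : ℚ) (0 : ℤ), extQ_ratVec _ _ _ (by omega),
      extQ_ratVec _ _ _ (by omega), coord_ratVec_one 0]
    simp only [Pi.smul_apply, Pi.add_apply, smul_eq_mul, ratVec, hL, hA]
    push_cast; ring
  simp only [h1]
  rw [prod_qBinom_ext m (fun hm => add_nonneg hz0 (ext_nonneg le_rfl le_rfl hm 1)) le_rfl,
    dotProduct_cartanT, dotProduct_cartanA A m, coord_ratVec_one 0, vecTerm, ← Finset.sum_div,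
    ext_one A 0]
  have hLz : L = z / 2 := by rw [← hL]; ring
  have e : qPow (L ^ 2) * qPow (1 / 4 *
      (∑ k ∈ Finset.range (n + 1), ((ext A 0 m k : ℚ) - ext A 0 m (k + 1)) ^ 2
        - A ^ 2 + 2 * A * ext 0 0 m 1 - ext 0 0 m 1 ^ 2))
      = qPow ((∑ k ∈ Finset.range (n + 1), ((ext A 0 m k : ℚ) - ext A 0 m (k + 1)) ^ 2) / 4) := by
    rw [← qPow_add]; congr 1; rw [hLz, hA]; push_cast; ring
  rw [← e, show L + M - (ext 0 0 m 1 : ℚ) / 2 = 2 * L + M - (A : ℚ) / 2 by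
    rw [hA, hLz]; push_cast; ring]
  ring

/-- The tadpole form of `levelXsymm` from `(p, p', r, s) = (1, 2, 0, 1)`. -/
theorem levelXsymm_tadpole {n σ : ℕ} {M z : ℤ} {L : ℚ} (hL : 2 * L = z) (hz : Even (z + σ)) :
    levelXsymm (n + 1) 1 (2 * (n + 1) + 1) 0 (n + 1) σ M L = tadpoleForm (n + 1) σ M L := by
  have h := levelXsymm_eq_burge (n := n) (σ := σ) (p := 1) (p' := 2) (r := 0) (s := 1) (M := M)
    hL hz le_rfl le_rfl (by omega) (by omega) (by omega) (by omega) (by omega) (by omega)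
  simp only [mul_one, add_zero, mul_comm ((n : ℤ) + 1) 2] at h
  rcases lt_or_ge z 0 with hz0 | hz0
  · have : (z : ℚ) < 0 := by exact_mod_cast hz0
    rw [h, Finset.sum_eq_zero fun i _ => by rw [qBinom_of_neg (by linarith), zero_mul],
      tadpoleForm]
    rw [(finsum_mem_congr rfl fun m _ => ?_).trans (finsum_mem_zero _), mul_zero]
    simp only [qBinom_of_neg (show 2 * L < 0 by linarith), mul_zero, zero_mul]
  set U : (Fin n → ℤ) → QPoly := fun m =>
    qBinom (2 * L + M - ((z + ext 0 0 m 1 : ℤ) : ℚ) / 2) (2 * L)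
      * vecTerm (z + ext 0 0 m 1) 0 (fun _ => 1) (fun _ => 1) m with hU
  have hne : ∀ m, U m ≠ 0 → ∃ i ∈ Finset.Icc 0 M, z + ext 0 0 m 1 = 2 * i := by
    intro m hm
    have h1 := left_ne_zero_of_mul hm
    have h2 := ext_nonneg le_rfl le_rfl
      (nonneg_of_hb_ne_zero (vecTerm_ne_zero (right_ne_zero_of_mul hm)).2.2) (A := 0) (B := 0) 1
    rw [qBinom_eq_tb (n := 2 * z + 2 * M - (z + ext 0 0 m 1)) (k := 2 * z)
      (by rw [hL]; push_cast; ring) (by rw [hL]; push_cast; ring)] at h1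
    obtain ⟨a, b, h4, h5, h6, h7⟩ := exists_of_tb_ne_zero h1
    exact ⟨z + M - a, by rw [Finset.mem_Icc]; omega, by omega⟩
  have hR : tadpoleForm (n + 1) σ M L = ∑ᶠ m, U m := by
    have hT := tadpole_summand (n := n) (M := M) hL hz0
    rw [tadpoleForm, finsum_mem_eq_finsum_of_forall, mul_finsum]
    · exact finsum_congr hT
    -- The left end of the chain is the even number `2i`, so even labels carry even entries, and
    -- `m_1 = 2i - 2L` has the parity of `σ`.
    · intro m hm0 k
      have hm : U m ≠ 0 := by
        rw [hU]
        exact (hT m).symm.trans_ne (mul_ne_zero (qPow_ne_zero _) hm0)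
      obtain ⟨i, -, hi⟩ := hne m hm
      have hx := even_ext (vecTerm_ne_zero (right_ne_zero_of_mul hm)).2.2 (k + 1)
        (by have := k.isLt; change (k : ℕ) + 1 ≤ n + 1; omega)
      erw [ext_succ_fin] at hx
      rw [ext_one (z + ext 0 0 m 1) 0] at hx
      obtain ⟨d, hd⟩ := hz
      obtain ⟨e, he⟩ := hx
      by_cases hpar : Even ((k : ℕ) + 1)
      · rw [if_pos hpar] at he
        rw [if_neg (by simpa using hpar)]
        exact Int.modEq_iff_dvd.mpr ⟨-i - e, by omega⟩
      · rw [if_neg hpar] at he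
        rw [if_pos (by simpa using hpar)]
        exact Int.modEq_iff_dvd.mpr ⟨d - i - e, by omega⟩
  have hbox : Function.support U ⊆ (Fintype.piFinset fun _ : Fin n => Finset.Icc 0 (2 * M)) := by
    intro m hm
    obtain ⟨i, hi, hi'⟩ := hne m hm
    rw [Finset.mem_Icc] at hi
    simp only [Finset.mem_coe, Fintype.mem_piFinset, Finset.mem_Icc]
    intro k
    have hb := chain_bounds (by rw [ext_zero]; omega) (by rw [ext_last])
      (vecTerm_ne_zero (right_ne_zero_of_mul hm)).2.2 (k + 1) (by omega)
    rw [ext_succ_fin, ext_zero, ext_last] at hb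
    omega
  rw [h, hR, finsum_eq_sum_of_support_subset U hbox]
  simp only [chain_eq_sum, Finset.mul_sum]
  rw [Finset.sum_comm]
  refine Finset.sum_congr rfl fun m _ => ?_
  -- The delta from `(1,2)` demands `L - i + m_1/2 = 0`, which identifies the left end `2i` with `2L
  -- + m_1`.
  have hterm : ∀ i ∈ Finset.Icc 0 M, qBinom (2 * L + M - i) (2 * L) * vecTerm (2 * i) 0
      (fun x => burgeSum (M + 1) 1 2 0 1 i (L - i + x / 2)) (fun _ => 1) m
      = if z + ext 0 0 m 1 = 2 * i then U m else 0 := by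
    intro i hi
    rw [Finset.mem_Icc] at hi
    rw [vecTerm, ext_one _ 0, show L - i + (ext 0 0 m 1 : ℚ) / 2
        = ((z - 2 * i + ext 0 0 m 1 : ℤ) : ℚ) / 2 by push_cast; rw [← hL]; ring,
      burgeSum_half (by omega) le_rfl le_rfl (by omega), burgeX_one_two _ hi.1]
    by_cases hc : z + ext 0 0 m 1 = 2 * i
    · rw [if_pos hc, show z - 2 * i + ext 0 0 m 1 = 0 by omega, if_pos (by simp), if_pos (by simp),
        hU]
      simp only [hc, vecTerm]
      rw [show ((2 * i : ℤ) : ℚ) / 2 = i by push_cast; ring]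
    · rw [if_neg hc]
      split_ifs with h1 h2
      · obtain ⟨c, hc'⟩ := h1
        omega
      · simp
      · simp
  rw [Finset.sum_congr rfl hterm]
  by_cases hm : U m = 0
  · rw [hm]; simp
  · obtain ⟨i, hi, hi'⟩ := hne m hm
    rw [Finset.sum_eq_single_of_mem i hi fun j _ hj => if_neg (by omega), if_pos hi']

/-! ### The fourth family at level two. -/

theorem inv_cartanA_one : (cartanA 1)⁻¹ = (1 / 2 : ℚ) • (1 : Matrix (Fin 1) (Fin 1) ℚ) := by
  refine Matrix.inv_eq_right_inv ?_
  ext i j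
  fin_cases i; fin_cases j
  simp [cartanA, CartanMatrix.A]

/-- The Gordon type form at level two. -/
theorem gordonForm_two (σ : ℕ) (M : ℤ) (L : ℚ) : gordonForm 2 σ M L = slaterForm σ M L := by
  rw [gordonForm, slaterForm]
  refine Finset.sum_congr rfl fun i hi => ?_
  rw [Finset.mem_Icc] at hi
  set e : ℤ → (Fin 1 → ℤ) := fun n _ => n with he
  have hset : ∀ n : ℤ, e n ∈ restrictedSet 2 σ (2 * i) ↔ Even (n + i + σ) := by
    intro n
    have : (((2 * i : ℤ) : ℚ) + σ * (2 : ℕ)) / (2 * (2 : ℕ))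
        + coord ((cartanA 1)⁻¹ *ᵥ ratVec (e n)) 1 0 = ((n + i + σ : ℤ) : ℚ) / 2 := by
      rw [inv_cartanA_one, Matrix.smul_mulVec, Matrix.one_mulVec, coord, dif_pos ⟨le_rfl, le_rfl⟩]
      simp [ratVec, he]; ring
    constructor
    · rintro ⟨w, hw⟩
      have hw' := this.symm.trans hw
      rw [div_eq_iff (by norm_num)] at hw'
      exact ⟨w, by exact_mod_cast (by rw [hw']; push_cast; ring :
        ((n + i + σ : ℤ) : ℚ) = ((w + w : ℤ) : ℚ))⟩
    · rintro ⟨w, hw⟩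
      exact ⟨w, this.trans (by rw [hw]; push_cast; ring)⟩
  have hm : ∀ n : ℤ, solveA ((2 * (i : ℚ)) • unitVec 1 1) (ratVec (e n)) = fun _ => (i : ℚ) - n := by
    intro n
    rw [solveA, inv_cartanA_one, Matrix.smul_mulVec, Matrix.one_mulVec]
    funext k
    simp [unitVec, ratVec, he]
    ring
  have hq : ∀ n : ℤ, invForm (e n) = (n : ℚ) ^ 2 / 2 := by
    intro n
    rw [invForm, inv_cartanA_one, Matrix.smul_mulVec, Matrix.one_mulVec]
    simp [ratVec, he, dotProduct]
    ring
  have hbij : Set.BijOn e {n | Even (n + i + σ)} (restrictedSet 2 σ (2 * i)) := by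
    refine ⟨fun n hn => (hset n).mpr hn, fun a _ b _ h => congrFun h 0, fun v hv => ?_⟩
    have hv' : e (v 0) = v := by funext k; rw [Subsingleton.elim k 0]
    exact ⟨v 0, (hset _).mp (by rwa [hv']), hv'⟩
  have key : (∑ᶠ n ∈ restrictedSet 2 σ (2 * i),
      let m : Fin 1 → ℚ := solveA ((2 * (i : ℚ)) • unitVec 1 1) (ratVec n)
      qPow (invForm n) * (∏ k, qBinom (m k + n k) (n k)) * qBinom (2 * L - i + coord m 1 0) i)
      = ∑ n ∈ (Finset.Icc (0 : ℤ) i).filter (fun n => Even (n + i + σ)),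
        qPow ((n : ℚ) ^ 2 / 2) * qBinom i n * qBinom (2 * L - n) i := by
    rw [← finsum_mem_eq_of_bijOn (f := fun n : ℤ => qPow ((n : ℚ) ^ 2 / 2) * qBinom i n
      * qBinom (2 * L - n) i) e hbij]
    · refine finsum_mem_eq_sum_of_inter_support_eq _ ?_
      ext n
      simp only [Set.mem_inter_iff, Set.mem_ofPred_eq, Function.mem_support, Finset.coe_filter,
        Finset.mem_Icc, and_congr_left_iff]
      intro hne
      refine (and_iff_right ?_).symm
      have h1 := right_ne_zero_of_mul (left_ne_zero_of_mul hne)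
      constructor
      · by_contra hc
        exact h1 (qBinom_of_neg (by exact_mod_cast not_le.mp hc))
      · by_contra hc
        exact h1 (qBinom_of_lt (by exact_mod_cast not_le.mp hc))
    · intro n _
      simp only [hm, hq, Fin.prod_univ_one, coord, le_refl, and_self, dite_true]
      simp only [he, sub_add_cancel]
      rw [show 2 * L - i + (i - n) = 2 * L - n by ring]
  refine (congrArg _ key).trans ?_
  rw [Finset.mul_sum]
  refine Finset.sum_congr rfl fun n _ => ?_
  rw [show ((i : ℚ) ^ 2 + (n : ℚ) ^ 2) / 2 = (i : ℚ) ^ 2 / (2 : ℕ) + (n : ℚ) ^ 2 / 2 by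
    push_cast; ring, qPow_add]
  ring

/-! ### A finite `q`-Gauss sum and Bailey's lemma over the reals. -/

/-- The finite product `(1 - c) (1 - c q) ⋯ (1 - c q^{n-1})`. -/
noncomputable def poch (c q : ℝ) (n : ℕ) : ℝ := ∏ j ∈ Finset.range n, (1 - c * q ^ j)

theorem poch_zero (c q : ℝ) : poch c q 0 = 1 := by simp [poch]

theorem poch_succ (c q : ℝ) (n : ℕ) : poch c q (n + 1) = poch c q n * (1 - c * q ^ n) :=
  Finset.prod_range_succ _ _

theorem poch_add (c q : ℝ) (m n : ℕ) : poch c q (m + n) = poch c q m * poch (c * q ^ m) q n := by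
  simp only [poch, Finset.prod_range_add, pow_add, mul_assoc]

theorem poch_self_ne_zero {q : ℝ} (hq : |q| < 1) (n : ℕ) : poch q q n ≠ 0 := by
  refine Finset.prod_ne_zero_iff.mpr fun j _ h => ?_
  have h1 : |q ^ (j + 1)| < 1 := by
    rw [abs_pow]; exact pow_lt_one₀ (abs_nonneg q) hq (by omega)
  rw [pow_succ', ← sub_eq_zero.mp h] at h1
  simp at h1

theorem poch_self_succ_div {q : ℝ} (hq : |q| < 1) (n : ℕ) :
    (1 - q ^ (n + 1)) / poch q q (n + 1) = 1 / poch q q n := by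
  have h := poch_self_ne_zero hq (n + 1)
  rw [poch_succ, ← pow_succ'] at *
  have h1 := left_ne_zero_of_mul h
  have h2 := right_ne_zero_of_mul h
  field_simp

/-- The product `∏_{j < k} (u q^{2j} - b q^j)`. -/
noncomputable def mixedPoch (u b q : ℝ) (k : ℕ) : ℝ :=
  ∏ j ∈ Finset.range k, (u * q ^ (2 * j) - b * q ^ j)

theorem mixedPoch_add (u b q : ℝ) (m n : ℕ) :
    mixedPoch u b q (m + n) = mixedPoch u b q m * mixedPoch (u * q ^ (2 * m)) (b * q ^ m) q n := by
  simp only [mixedPoch, Finset.prod_range_add, pow_add, mul_assoc, mul_add]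

theorem mixedPoch_succ' (u b q : ℝ) (k : ℕ) :
    mixedPoch u b q (k + 1) = (u - b) * q ^ k * mixedPoch (u * q) b q k := by
  have h : ∀ j, u * q ^ (2 * (j + 1)) - b * q ^ (j + 1) = q * (u * q * q ^ (2 * j) - b * q ^ j) :=
    fun j => by ring
  simp only [mixedPoch, Finset.prod_range_succ', h, Finset.prod_mul_distrib, Finset.prod_const,
    Finset.card_range]
  ring

/-- A finite form of the `q`-Gauss sum. -/
theorem sum_mixedPoch {q : ℝ} (hq : |q| < 1) (n : ℕ) (u b : ℝ) :
    ∑ p ∈ Finset.HasAntidiagonal.antidiagonal n, mixedPoch u b q p.1 * poch (u * q ^ p.1) q p.2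
      / (poch q q p.1 * poch q q p.2) = poch b q n / poch q q n := by
  induction n generalizing u b with
  | zero => simp [mixedPoch, poch]
  | succ n ih =>
    have hne : 1 - q ^ (n + 1) ≠ 0 := by
      have h := poch_self_ne_zero hq (n + 1)
      rw [poch_succ, ← pow_succ'] at h
      exact right_ne_zero_of_mul h
    refine mul_left_cancel₀ hne ?_
    rw [Finset.mul_sum, mul_div_left_comm, poch_self_succ_div hq]
    -- Split `1 - q^{n+1} = (1 - q^j) + q^j (1 - q^i)` for `i + j = n + 1`. The two parts are the
    -- sums of order `n` for `u` and `uq`, with coefficients `1 - uq^n` and `(u - b)q^n` adding up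
    -- to `1 - bq^n`.
    have hsplit : ∀ p ∈ Finset.HasAntidiagonal.antidiagonal (n + 1),
        (1 - q ^ (n + 1)) * (mixedPoch u b q p.1 * poch (u * q ^ p.1) q p.2
          / (poch q q p.1 * poch q q p.2))
        = mixedPoch u b q p.1 * poch (u * q ^ p.1) q p.2 / poch q q p.1
            * ((1 - q ^ p.2) / poch q q p.2)
          + q ^ p.2 * mixedPoch u b q p.1 * poch (u * q ^ p.1) q p.2 / poch q q p.2
            * ((1 - q ^ p.1) / poch q q p.1) := by
      intro p hp
      rw [← Finset.HasAntidiagonal.mem_antidiagonal.mp hp, pow_add]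
      field_simp
      ring
    rw [Finset.sum_congr rfl hsplit, Finset.sum_add_distrib, Finset.Nat.sum_antidiagonal_succ',
      Finset.Nat.sum_antidiagonal_succ]
    simp only [pow_zero, sub_self, zero_div, mul_zero, zero_add, poch_self_succ_div hq]
    have h1 : ∀ p ∈ Finset.HasAntidiagonal.antidiagonal n,
        mixedPoch u b q p.1 * poch (u * q ^ p.1) q (p.2 + 1) / poch q q p.1 * (1 / poch q q p.2)
        = (1 - u * q ^ n) * (mixedPoch u b q p.1 * poch (u * q ^ p.1) q p.2
          / (poch q q p.1 * poch q q p.2)) := by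
      intro p hp
      rw [poch_succ, mul_assoc u, ← pow_add, Finset.HasAntidiagonal.mem_antidiagonal.mp hp]
      field_simp
    have h2 : ∀ p ∈ Finset.HasAntidiagonal.antidiagonal n,
        q ^ p.2 * mixedPoch u b q (p.1 + 1) * poch (u * q ^ (p.1 + 1)) q p.2 / poch q q p.2
          * (1 / poch q q p.1)
        = (u - b) * q ^ n * (mixedPoch (u * q) b q p.1 * poch (u * q * q ^ p.1) q p.2
          / (poch q q p.1 * poch q q p.2)) := by
      intro p hp
      rw [mixedPoch_succ', pow_succ', ← mul_assoc u, ← Finset.HasAntidiagonal.mem_antidiagonal.mp hp, pow_add]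
      field_simp
    rw [Finset.sum_congr rfl h1, Finset.sum_congr rfl h2, ← Finset.mul_sum, ← Finset.mul_sum, ih,
      ih, poch_succ]
    field_simp
    ring

/-- The reciprocal of `(q)_m`, which vanishes for negative `m`. -/
noncomputable def recPoch (q : ℝ) (m : ℤ) : ℝ := if 0 ≤ m then 1 / poch q q m.toNat else 0

theorem recPoch_natCast (q : ℝ) (n : ℕ) : recPoch q n = 1 / poch q q n := by simp [recPoch]

theorem recPoch_of_neg (q : ℝ) {m : ℤ} (h : m < 0) : recPoch q m = 0 := if_neg (by omega)

/-- The basic step of Bailey's lemma. -/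
theorem sum_bailey {q : ℝ} (hq : |q| < 1) (b : ℝ) (M r : ℕ) :
    ∑ i ∈ Finset.range (M + 1), mixedPoch q b q i * recPoch q (M - i)
        * (recPoch q (i - r) * recPoch q (i + r))
      = mixedPoch q b q r * poch (b * q ^ r) q (M - r) * (recPoch q (M - r) * recPoch q (M + r)) := by
  rcases lt_or_ge M r with h | h
  · rw [recPoch_of_neg q (by omega : (M : ℤ) - r < 0), zero_mul, mul_zero]
    refine Finset.sum_eq_zero fun i hi => ?_
    rw [Finset.mem_range] at hi
    rw [recPoch_of_neg q (by omega : (i : ℤ) - r < 0), zero_mul, mul_zero]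
  obtain ⟨n, rfl⟩ := Nat.exists_eq_add_of_le h
  rw [add_assoc, Finset.sum_range_add, Finset.sum_eq_zero, zero_add,
    ← Finset.Nat.sum_antidiagonal_eq_sum_range_succ_mk
      (f := fun p => mixedPoch q b q (r + p.1) * recPoch q ((r + n : ℕ) - (r + p.1 : ℕ))
        * (recPoch q ((r + p.1 : ℕ) - r) * recPoch q ((r + p.1 : ℕ) + r)))]
  · have hF := sum_mixedPoch hq n (q * q ^ (2 * r)) (b * q ^ r)
    have e1 : ((r + n : ℕ) : ℤ) - r = n := by push_cast; ring
    have e2 : ((r + n : ℕ) : ℤ) + r = (2 * r + n : ℕ) := by push_cast; ring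
    rw [e1, e2, recPoch_natCast, recPoch_natCast, Nat.add_sub_cancel_left,
      show mixedPoch q b q r * poch (b * q ^ r) q n * (1 / poch q q n * (1 / poch q q (2 * r + n)))
        = mixedPoch q b q r * (1 / poch q q (2 * r + n)) * (poch (b * q ^ r) q n / poch q q n) by
        ring, ← hF, Finset.mul_sum]
    refine Finset.sum_congr rfl fun p hp => ?_
    have hp' := Finset.HasAntidiagonal.mem_antidiagonal.mp hp
    have e3 : ((r + n : ℕ) : ℤ) - (r + p.1 : ℕ) = p.2 := by push_cast; omega
    have e4 : ((r + p.1 : ℕ) : ℤ) - r = p.1 := by push_cast; ring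
    have e5 : ((r + p.1 : ℕ) : ℤ) + r = (2 * r + p.1 : ℕ) := by push_cast; ring
    rw [e3, e4, e5, recPoch_natCast, recPoch_natCast, recPoch_natCast, mixedPoch_add, ← hp',
      ← add_assoc, poch_add q q (2 * r + p.1), pow_add q (2 * r), ← mul_assoc q]
    have h1 := poch_self_ne_zero hq (2 * r + p.1 + p.2)
    rw [poch_add, pow_add, ← mul_assoc q] at h1
    have h2 := left_ne_zero_of_mul h1
    have h3 := right_ne_zero_of_mul h1
    field_simp
  · intro i hi
    rw [Finset.mem_range] at hi
    rw [recPoch_of_neg q (by omega : (i : ℤ) - r < 0), zero_mul, mul_zero]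

/-- Bailey's lemma. -/
theorem bailey_lemma {q : ℝ} (hq : |q| < 1) (b : ℝ) {M J : ℕ} {α : ℤ → ℝ} {β : ℕ → ℝ}
    (hβ : ∀ i ≤ M, β i = ∑ r ∈ Finset.Icc (-J : ℤ) J, α r * (recPoch q (i - r) * recPoch q (i + r))) :
    ∑ i ∈ Finset.range (M + 1), mixedPoch q b q i * recPoch q (M - i) * β i
      = ∑ r ∈ Finset.Icc (-J : ℤ) J, α r * (mixedPoch q b q r.natAbs
        * poch (b * q ^ r.natAbs) q (M - r.natAbs)) * (recPoch q (M - r) * recPoch q (M + r)) := by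
  have habs : ∀ (m r : ℤ), recPoch q (m - r) * recPoch q (m + r)
      = recPoch q (m - r.natAbs) * recPoch q (m + r.natAbs) := by
    intro m r
    rcases abs_choice r with h | h
    · rw [Int.natCast_natAbs, h]
    · rw [Int.natCast_natAbs, h, sub_neg_eq_add, ← sub_eq_add_neg, mul_comm]
  have h1 : ∀ i ∈ Finset.range (M + 1), mixedPoch q b q i * recPoch q (M - i) * β i
      = ∑ r ∈ Finset.Icc (-J : ℤ) J, α r * (mixedPoch q b q i * recPoch q (M - i)
        * (recPoch q (i - r.natAbs) * recPoch q (i + r.natAbs))) := by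
    intro i hi
    rw [hβ i (by rw [Finset.mem_range] at hi; omega), Finset.mul_sum]
    exact Finset.sum_congr rfl fun r _ => by rw [habs]; ring
  rw [Finset.sum_congr rfl h1, Finset.sum_comm]
  refine Finset.sum_congr rfl fun r _ => ?_
  rw [← Finset.mul_sum, sum_bailey hq, habs M r]
  ring

/-! ### Finite triple product and finite form of Slater's identity. -/

/-- The term `(-z)^r q^{r(r-1)/2}` of the theta series. -/
noncomputable def thetaTerm (z q : ℝ) (r : ℤ) : ℝ := (-z) ^ r * q ^ (r * (r - 1) / 2)

theorem thetaTerm_succ {z q : ℝ} (hz : z ≠ 0) (hq : q ≠ 0) (r : ℤ) :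
    thetaTerm z q (r + 1) = thetaTerm z q r * (-z * q ^ r) := by
  have h : (r + 1) * (r + 1 - 1) / 2 = r * (r - 1) / 2 + r := by
    rw [show (r + 1) * (r + 1 - 1) = r * (r - 1) + r * 2 by ring,
      Int.add_mul_ediv_right _ _ (by norm_num)]
  rw [thetaTerm, thetaTerm, h, zpow_add_one₀ (neg_ne_zero.mpr hz), zpow_add₀ hq]
  ring

theorem thetaTerm_zero (z q : ℝ) : thetaTerm z q 0 = 1 := by simp [thetaTerm]

/-- For `1 ≤ j ≤ m` one has `1 - zq^{-j} = -zq^{-j}(1 - q^j/z)`; the theta term absorbs the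
monomials. -/
theorem thetaTerm_neg_mul_poch {z q : ℝ} (hz : z ≠ 0) (hq : q ≠ 0) (m n : ℕ) :
    thetaTerm z q (-m) * poch (z * q ^ (-m : ℤ)) q (m + n) = poch (q / z) q m * poch z q n := by
  induction m with
  | zero => simp [thetaTerm_zero, poch_zero]
  | succ m ih =>
    have h1 := thetaTerm_succ hz hq (-(m + 1 : ℕ))
    rw [show (-(m + 1 : ℕ) : ℤ) + 1 = -m by push_cast; ring] at h1
    have h2 : poch (z * q ^ (-(m + 1 : ℕ) : ℤ)) q (m + 1 + n)
        = (1 - z * q ^ (-(m + 1 : ℕ) : ℤ)) * poch (z * q ^ (-m : ℤ)) q (m + n) := by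
      rw [show m + 1 + n = 1 + (m + n) by ring, poch_add]
      congr 1
      · simp [poch]
      · rw [pow_one, mul_assoc, ← zpow_add_one₀ hq]
        congr 3
        push_cast; ring
    have h3 : z * q ^ (-(m + 1 : ℕ) : ℤ) * (q / z * q ^ m) = 1 := by
      rw [zpow_neg, zpow_natCast, pow_succ]
      field_simp
    rw [h2, poch_succ, mul_right_comm, ← ih, h1]
    linear_combination -thetaTerm z q (-(m + 1 : ℕ)) * poch (z * q ^ (-m : ℤ)) q (m + n) * h3

theorem mixedPoch_zero_mul_thetaTerm {z q : ℝ} (hz : z ≠ 0) (hq : q ≠ 0) (m : ℤ) (k : ℕ) :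
    thetaTerm z q (-m) * mixedPoch 0 (z * q ^ (-m)) q k = thetaTerm z q (k - m) := by
  induction k with
  | zero => simp [mixedPoch]
  | succ k ih =>
    rw [mixedPoch, Finset.prod_range_succ, ← mixedPoch, ← mul_assoc, ih, Nat.cast_succ,
      show (k : ℤ) + 1 - m = k - m + 1 by ring, thetaTerm_succ hz hq, sub_eq_add_neg (k : ℤ),
      zpow_add₀ hq, zpow_natCast]
    ring

/-- A finite form of Jacobi's triple product identity. -/
theorem sum_thetaTerm {z q : ℝ} (hz : z ≠ 0) (hq : q ≠ 0) (hq1 : |q| < 1) {m J : ℕ} (hJ : m ≤ J) :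
    ∑ r ∈ Finset.Icc (-J : ℤ) J, thetaTerm z q r * (recPoch q (m - r) * recPoch q (m + r))
      = poch (q / z) q m * poch z q m / poch q q (2 * m) := by
  -- The finite Gauss sum with `u = 0` and `b = zq^{-m}`, indexed by `r = p.1 - m`.
  rw [← thetaTerm_neg_mul_poch hz hq, ← two_mul, mul_div_assoc, ← sum_mixedPoch hq1 (2 * m) 0,
    Finset.mul_sum]
  symm
  refine Finset.sum_bij_ne_zero (fun p _ _ => (p.1 : ℤ) - m) ?_ ?_ ?_ ?_
  · intro p hp _
    rw [Finset.HasAntidiagonal.mem_antidiagonal] at hp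
    rw [Finset.mem_Icc]
    omega
  · intro p hp _ p' hp' _ h
    rw [Finset.HasAntidiagonal.mem_antidiagonal] at hp hp'
    ext <;> omega
  · intro r hr hne
    have h1 : 0 ≤ m - r := by
      by_contra hc
      exact hne (by rw [recPoch_of_neg q (not_le.mp hc)]; ring)
    have h2 : 0 ≤ m + r := by
      by_contra hc
      exact hne (by rw [recPoch_of_neg q (not_le.mp hc)]; ring)
    refine ⟨((m + r).toNat, (m - r).toNat), ?_, ?_, ?_⟩
    · rw [Finset.HasAntidiagonal.mem_antidiagonal]; omega
    · rw [zero_mul, ← mul_div_assoc, ← mul_assoc, mixedPoch_zero_mul_thetaTerm hz hq]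
      rw [recPoch, recPoch, if_pos h1, if_pos h2] at hne
      rw [Int.toNat_of_nonneg h2, show (m : ℤ) + r - m = r by ring]
      convert hne using 1
      simp [poch]; ring
    · simp only; omega
  · intro p hp _
    rw [Finset.HasAntidiagonal.mem_antidiagonal] at hp
    rw [zero_mul, ← mul_div_assoc, ← mul_assoc, mixedPoch_zero_mul_thetaTerm hz hq,
      show (m : ℤ) - (p.1 - m) = p.2 by omega, show (m : ℤ) + (p.1 - m) = p.1 by ring,
      recPoch_natCast, recPoch_natCast]
    simp [poch]; ring

theorem mixedPoch_zero_right (q : ℝ) (k : ℕ) : mixedPoch q 0 q k = q ^ (k ^ 2) := by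
  induction k with
  | zero => simp [mixedPoch]
  | succ k ih =>
    rw [mixedPoch, Finset.prod_range_succ, ← mixedPoch, ih]
    ring

theorem mixedPoch_sq (x : ℝ) (k : ℕ) :
    mixedPoch (x ^ 2) (-x) (x ^ 2) k = x ^ (k ^ 2) * poch (-x) (x ^ 2) k := by
  induction k with
  | zero => simp [mixedPoch, poch]
  | succ k ih =>
    rw [mixedPoch, Finset.prod_range_succ, ← mixedPoch, ih, poch_succ]
    ring

/-- The Bailey pair which is obtained from the unit Bailey pair. -/
theorem recPoch_eq_sum {q : ℝ} (hq : q ≠ 0) (hq1 : |q| < 1) {n J : ℕ} (hJ : n ≤ J) :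
    recPoch q n = ∑ r ∈ Finset.Icc (-J : ℤ) J,
      thetaTerm 1 q r * q ^ (r.natAbs ^ 2) * (recPoch q (n - r) * recPoch q (n + r)) := by
  -- The finite triple product at `z = 1` vanishes for `m > 0`: this is the unit Bailey pair. The
  -- step with `b = 0` multiplies `α_r` by `q^{r²}`.
  have h := bailey_lemma (M := n) (J := J) (α := thetaTerm 1 q)
    (β := fun i => if i = 0 then 1 else 0) hq1 0 (by
      intro i hi
      rw [sum_thetaTerm one_ne_zero hq hq1 (hi.trans hJ)]
      rcases i with _ | i
      · simp [poch]
      · have : poch 1 q (i + 1) = 0 := by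
          rw [add_comm, poch_add]; simp [poch]
        rw [this]; simp)
  simp only [mul_ite, mul_one, mul_zero, Finset.sum_ite_eq', Finset.mem_range, Nat.succ_pos,
    if_true, mixedPoch_zero_right, zero_mul, Nat.cast_zero, sub_zero] at h
  simp only [zero_pow two_ne_zero, pow_zero, one_mul] at h
  rw [h]
  refine Finset.sum_congr rfl fun r _ => ?_
  simp [poch]

/-- A finite form of Slater's identity. -/
theorem slater_finite {x : ℝ} (hx : x ≠ 0) (hx1 : |x| < 1) (M : ℕ) :
    ∑ i ∈ Finset.range (M + 1), x ^ (i ^ 2) * poch (-x) (x ^ 2) i / poch (x ^ 2) (x ^ 2) i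
        * recPoch (x ^ 2) (M - i)
      = poch (-x) (x ^ 2) M * ∑ r ∈ Finset.Icc (-M : ℤ) M, thetaTerm (x ^ 3) (x ^ 8) r
        * (recPoch (x ^ 2) (M - r) * recPoch (x ^ 2) (M + r)) := by
  have hq : x ^ 2 ≠ 0 := pow_ne_zero _ hx
  have hq1 : |x ^ 2| < 1 := by
    rw [abs_pow]; exact pow_lt_one₀ (abs_nonneg x) hx1 two_ne_zero
  -- The second step has base `x²` and `b = -x`, which produces `x^{i²}(-x; x²)_i`.
  have h := bailey_lemma (M := M) (J := M) hq1 (-x) (β := fun i => recPoch (x ^ 2) i)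
    (fun i hi => recPoch_eq_sum hq hq1 hi)
  have h1 : ∀ i : ℕ, x ^ (i ^ 2) * poch (-x) (x ^ 2) i / poch (x ^ 2) (x ^ 2) i
        * recPoch (x ^ 2) (M - i)
      = mixedPoch (x ^ 2) (-x) (x ^ 2) i * recPoch (x ^ 2) (M - i) * recPoch (x ^ 2) i := by
    intro i
    rw [mixedPoch_sq, recPoch_natCast]; ring
  rw [Finset.sum_congr rfl fun i _ => h1 i, h, Finset.mul_sum]
  refine Finset.sum_congr rfl fun r hr => ?_
  rw [Finset.mem_Icc] at hr
  have h2 : r.natAbs + (M - r.natAbs) = M := by omega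
  rw [mixedPoch_sq, mul_assoc (x ^ _), ← poch_add, h2]
  -- Both exponents of `x` are `4r² - r`.
  have h3 : thetaTerm 1 (x ^ 2) r * (x ^ 2) ^ (r.natAbs ^ 2) * x ^ (r.natAbs ^ 2)
      = thetaTerm (x ^ 3) (x ^ 8) r := by
    obtain ⟨c, hc⟩ := Int.even_mul_pred_self r
    have hc' : r * (r - 1) / 2 = c := by omega
    have hsq : ((r.natAbs ^ 2 : ℕ) : ℤ) = r ^ 2 := by push_cast; exact sq_abs r
    rw [thetaTerm, thetaTerm, hc', neg_eq_neg_one_mul (x ^ 3), mul_zpow, mul_assoc, mul_assoc,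
      mul_assoc]
    congr 1
    rw [← pow_mul x 2]
    simp only [← zpow_natCast x, ← zpow_mul, ← zpow_add₀ hx]
    rw [Nat.cast_mul, hsq]
    congr 1
    push_cast
    linarith [hc]
  rw [← h3]
  ring

/-! ### Infinite products, limits and Slater's identity. -/

theorem summable_mul_pow {q : ℝ} (c : ℝ) (hq : |q| < 1) : Summable fun j : ℕ => ‖-(c * q ^ j)‖ := by
  simp only [norm_neg, norm_mul, norm_pow, Real.norm_eq_abs]
  exact (summable_geometric_of_lt_one (abs_nonneg q) hq).mul_left _

theorem multipliable_poch {q : ℝ} (c : ℝ) (hq : |q| < 1) :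
    Multipliable fun j : ℕ => 1 - c * q ^ j := by
  simpa only [sub_eq_add_neg] using multipliable_one_add_of_summable (summable_mul_pow c hq)

/-- The infinite product `(1 - c) (1 - c q) (1 - c q²) ⋯`. -/
noncomputable def pochInf (c q : ℝ) : ℝ := ∏' j : ℕ, (1 - c * q ^ j)

theorem tendsto_poch {q : ℝ} (c : ℝ) (hq : |q| < 1) :
    Filter.Tendsto (poch c q) Filter.atTop (nhds (pochInf c q)) :=
  (multipliable_poch c hq).hasProd.tendsto_prod_nat

theorem pochInf_ne_zero {c q : ℝ} (hc : |c| < 1) (hq : |q| < 1) : pochInf c q ≠ 0 := by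
  have h := tprod_one_add_ne_zero_of_summable (f := fun j : ℕ => -(c * q ^ j)) (fun j h => ?_)
    (summable_mul_pow c hq)
  · simpa only [pochInf, sub_eq_add_neg] using h
  · have h1 : |c * q ^ j| < 1 := by
      rw [abs_mul, abs_pow]
      exact mul_lt_one_of_nonneg_of_lt_one_left (abs_nonneg c) hc
        (pow_le_one₀ (abs_nonneg q) hq.le)
    rw [show c * q ^ j = 1 by linarith] at h1
    simp at h1

theorem tendsto_recPoch {q : ℝ} (hq : |q| < 1) :
    Filter.Tendsto (recPoch q) Filter.atTop (nhds (1 / pochInf q q)) := by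
  have h : Filter.Tendsto (fun m : ℤ => 1 / poch q q m.toNat) Filter.atTop
      (nhds (1 / pochInf q q)) :=
    tendsto_const_nhds.div ((tendsto_poch q hq).comp
      (Filter.tendsto_atTop_atTop.mpr fun b => ⟨b, fun a ha => by omega⟩)) (pochInf_ne_zero hq hq)
  refine h.congr' ?_
  filter_upwards [Filter.eventually_ge_atTop 0] with m hm
  rw [recPoch, if_pos hm]

theorem exists_abs_poch_le {q : ℝ} (c : ℝ) (hq : |q| < 1) : ∃ C, 0 ≤ C ∧ ∀ n, |poch c q n| ≤ C := by
  obtain ⟨C, hC⟩ := (Metric.isBounded_range_of_tendsto _ (tendsto_poch c hq)).exists_norm_le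
  exact ⟨C, (norm_nonneg _).trans (hC _ ⟨0, rfl⟩), fun n => hC _ ⟨n, rfl⟩⟩

theorem exists_abs_recPoch_le {q : ℝ} (hq : |q| < 1) : ∃ C, 0 ≤ C ∧ ∀ m, |recPoch q m| ≤ C := by
  have h : Filter.Tendsto (fun n : ℕ => recPoch q n) Filter.atTop (nhds (1 / pochInf q q)) :=
    (tendsto_recPoch hq).comp tendsto_natCast_atTop_atTop
  obtain ⟨C, hC⟩ := (Metric.isBounded_range_of_tendsto _ h).exists_norm_le
  refine ⟨C, (norm_nonneg _).trans (hC _ ⟨0, rfl⟩), fun m => ?_⟩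
  rcases lt_or_ge m 0 with hm | hm
  · rw [recPoch_of_neg q hm, abs_zero]
    exact (norm_nonneg _).trans (hC _ ⟨0, rfl⟩)
  · exact hC _ ⟨m.toNat, by simp only [Int.toNat_of_nonneg hm]⟩

theorem tendsto_sum_recPoch {q : ℝ} (hq : |q| < 1) {a : ℕ → ℝ} (ha : Summable a) :
    Filter.Tendsto (fun M : ℕ => ∑ i ∈ Finset.range (M + 1), a i * recPoch q (M - i))
      Filter.atTop (nhds ((∑' i, a i) * (1 / pochInf q q))) := by
  obtain ⟨C, hC0, hC⟩ := exists_abs_recPoch_le hq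
  have h := tendsto_tsum_of_dominated_convergence (𝓕 := Filter.atTop)
    (f := fun (M : ℕ) (i : ℕ) => a i * recPoch q (M - i)) (g := fun i => a i * (1 / pochInf q q))
    (bound := fun i => |a i| * C) (ha.abs.mul_right C)
    (fun i => ((tendsto_recPoch hq).comp (Filter.tendsto_atTop_add_const_right _ (-(i : ℤ))
      tendsto_natCast_atTop_atTop)).const_mul _)
    (Filter.Eventually.of_forall fun M i => by
      rw [norm_mul]
      exact mul_le_mul_of_nonneg_left (hC _) (abs_nonneg _))
  rw [tsum_mul_right] at h
  refine h.congr fun M => tsum_eq_sum fun i hi => ?_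
  rw [Finset.mem_range] at hi
  rw [recPoch_of_neg q (by omega), mul_zero]

theorem tendsto_sum_recPoch_mul_recPoch {q : ℝ} (hq : |q| < 1) {a : ℤ → ℝ} (ha : Summable a) :
    Filter.Tendsto (fun M : ℕ => ∑ r ∈ Finset.Icc (-M : ℤ) M,
        a r * (recPoch q (M - r) * recPoch q (M + r)))
      Filter.atTop (nhds ((∑' r, a r) * (1 / pochInf q q * (1 / pochInf q q)))) := by
  obtain ⟨C, hC0, hC⟩ := exists_abs_recPoch_le hq
  have h := tendsto_tsum_of_dominated_convergence (𝓕 := Filter.atTop)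
    (f := fun (M : ℕ) (r : ℤ) => a r * (recPoch q (M - r) * recPoch q (M + r)))
    (g := fun r => a r * (1 / pochInf q q * (1 / pochInf q q)))
    (bound := fun r => |a r| * (C * C)) (ha.abs.mul_right _)
    (fun r => (((tendsto_recPoch hq).comp (Filter.tendsto_atTop_add_const_right _ (-r)
      tendsto_natCast_atTop_atTop)).mul ((tendsto_recPoch hq).comp
      (Filter.tendsto_atTop_add_const_right _ r tendsto_natCast_atTop_atTop))).const_mul _)
    (Filter.Eventually.of_forall fun M r => by
      rw [norm_mul, norm_mul]
      exact mul_le_mul_of_nonneg_left (mul_le_mul (hC _) (hC _) (abs_nonneg _) hC0) (abs_nonneg _))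
  rw [tsum_mul_right] at h
  refine h.congr fun M => tsum_eq_sum fun r hr => ?_
  rw [Finset.mem_Icc, not_and_or] at hr
  rcases hr with hr | hr
  · rw [recPoch_of_neg q (by omega : (M : ℤ) + r < 0), mul_zero, mul_zero]
  · rw [recPoch_of_neg q (by omega : (M : ℤ) - r < 0), zero_mul, mul_zero]

theorem summable_thetaTerm {x : ℝ} (hx : x ≠ 0) (hx1 : |x| < 1) :
    Summable (thetaTerm (x ^ 3) (x ^ 8)) := by
  have hgeo := summable_geometric_of_lt_one (abs_nonneg x) hx1
  have hb : Summable fun r : ℤ => |x| ^ r.natAbs := by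
    refine Summable.of_nat_of_neg ?_ ?_ <;> simpa using hgeo
  refine Summable.of_norm_bounded hb fun r => ?_
  obtain ⟨c, hc⟩ := Int.even_mul_pred_self r
  have hx0 : |x| ≠ 0 := abs_ne_zero.mpr hx
  have h1 : ‖thetaTerm (x ^ 3) (x ^ 8) r‖ = |x| ^ (3 * r + 8 * c) := by
    rw [thetaTerm, show r * (r - 1) / 2 = c by omega, norm_mul, norm_zpow, norm_zpow, norm_neg,
      norm_pow, norm_pow, Real.norm_eq_abs, zpow_add₀ hx0, zpow_mul, zpow_mul]
    rfl
  rw [h1, ← zpow_natCast]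
  refine zpow_le_zpow_right_of_le_one₀ (abs_pos.mpr hx) hx1.le ?_
  -- The exponent is `3r + 8c = 4r² - r` with `2c = r(r - 1)`, and this is at least `|r|`.
  have h2 : |r| ≤ r ^ 2 := by rw [← sq_abs]; exact Int.le_self_sq _
  rw [Int.natCast_natAbs]
  nlinarith [le_abs_self r]

theorem slaterTerm_eq (x : ℝ) (n : ℕ) :
    slaterTerm x n = x ^ (n ^ 2) * poch (-x) (x ^ 2) n / poch (x ^ 2) (x ^ 2) n := by
  rw [slaterTerm, poch, poch]
  congr 2
  · exact Finset.prod_congr rfl fun k _ => by ring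
  · funext k; ring

theorem abs_pow_lt_one_of_abs_lt_one {x : ℝ} (hx : |x| < 1) {k : ℕ} (hk : k ≠ 0) : |x ^ k| < 1 := by
  rw [abs_pow]; exact pow_lt_one₀ (abs_nonneg x) hx hk

theorem summable_slaterTerm {x : ℝ} (hx : |x| < 1) : Summable (slaterTerm x) := by
  have hq := abs_pow_lt_one_of_abs_lt_one hx two_ne_zero
  obtain ⟨C, hC0, hC⟩ := exists_abs_poch_le (-x) hq
  obtain ⟨D, hD0, hD⟩ := exists_abs_recPoch_le hq
  refine Summable.of_norm_bounded
    ((summable_geometric_of_lt_one (abs_nonneg x) hx).mul_right (C * D)) fun n => ?_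
  rw [slaterTerm_eq, div_eq_mul_one_div, ← recPoch_natCast, norm_mul, norm_mul, norm_pow, mul_assoc]
  refine mul_le_mul ?_ (mul_le_mul (hC n) (hD n) (abs_nonneg _) hC0)
    (mul_nonneg (abs_nonneg _) (abs_nonneg _)) (pow_nonneg (abs_nonneg x) n)
  exact pow_le_pow_of_le_one (abs_nonneg x) hx.le (Nat.le_self_pow two_ne_zero n)

theorem tsum_slaterTerm {x : ℝ} (hx : x ≠ 0) (hx1 : |x| < 1) :
    (∑' n, slaterTerm x n) * pochInf (x ^ 2) (x ^ 2)
      = pochInf (-x) (x ^ 2) * ∑' r, thetaTerm (x ^ 3) (x ^ 8) r := by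
  have hq := abs_pow_lt_one_of_abs_lt_one hx1 two_ne_zero
  have h1 := tendsto_sum_recPoch hq (summable_slaterTerm hx1)
  have h2 := (tendsto_poch (-x) hq).mul
    (tendsto_sum_recPoch_mul_recPoch hq (summable_thetaTerm hx hx1))
  have h3 := tendsto_nhds_unique (h1.congr fun M => by
    rw [Finset.sum_congr rfl fun i _ => by rw [slaterTerm_eq], slater_finite hx hx1]) h2
  have h4 := pochInf_ne_zero hq hq
  field_simp at h3
  linarith

/-- Jacobi's triple product identity, for the theta series in Slater's identity. -/
theorem tsum_thetaTerm {x : ℝ} (hx : x ≠ 0) (hx1 : |x| < 1) :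
    ∑' r, thetaTerm (x ^ 3) (x ^ 8) r
      = pochInf (x ^ 5) (x ^ 8) * pochInf (x ^ 3) (x ^ 8) * pochInf (x ^ 8) (x ^ 8) := by
  have hq := abs_pow_lt_one_of_abs_lt_one hx1 (show 8 ≠ 0 by norm_num)
  have h1 := tendsto_sum_recPoch_mul_recPoch hq (summable_thetaTerm hx hx1)
  have h2 := ((tendsto_poch (x ^ 5) hq).mul (tendsto_poch (x ^ 3) hq)).div
    ((tendsto_poch (x ^ 8) hq).comp (Filter.tendsto_id.const_mul_atTop' two_pos))
    (pochInf_ne_zero hq hq)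
  have h3 := tendsto_nhds_unique (h1.congr fun M => by
    rw [sum_thetaTerm (pow_ne_zero 3 hx) (pow_ne_zero 8 hx) hq le_rfl,
      show x ^ 8 / x ^ 3 = x ^ 5 by field_simp]
    rfl) h2
  have h4 := pochInf_ne_zero hq hq
  field_simp at h3
  linarith

theorem poch_two_mul (x : ℝ) (n : ℕ) :
    poch (x ^ 2) (x ^ 2) (2 * n) = poch (x ^ 2) (x ^ 4) n * poch (x ^ 4) (x ^ 4) n := by
  induction n with
  | zero => simp [poch]
  | succ n ih =>
    rw [mul_add, mul_one, poch_succ, poch_succ, poch_succ, poch_succ, ih]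
    ring

/-- Each `1 + x^k` with odd `k` pairs with `1 - x^k` into `1 - x^{2k}`; the factors with exponents
`4` and `8` modulo `8` merge into base `x⁴`. Keeping the products finite makes this an induction on
`m`. -/
theorem poch_four_mul (x : ℝ) (m : ℕ) :
    poch (-x) (x ^ 2) (4 * m) * (poch (x ^ 5) (x ^ 8) m * poch (x ^ 3) (x ^ 8) m
        * poch (x ^ 8) (x ^ 8) m)
      * (poch (x ^ 7) (x ^ 8) m * poch (x ^ 4) (x ^ 8) m * poch (x ^ 1) (x ^ 8) m)
      = poch (x ^ 2) (x ^ 4) (4 * m) * poch (x ^ 4) (x ^ 4) (2 * m) := by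
  induction m with
  | zero => simp [poch]
  | succ m ih =>
    have e1 : 4 * (m + 1) = 4 * m + 1 + 1 + 1 + 1 := by ring
    have e2 : 2 * (m + 1) = 2 * m + 1 + 1 := by ring
    simp only [e1, e2, poch_succ]
    have hy : ∀ k, (x ^ 2) ^ (4 * m + k) = (x ^ 8) ^ m * x ^ (2 * k) := fun k => by ring
    have hz : ∀ k, (x ^ 4) ^ (4 * m + k) = ((x ^ 8) ^ m) ^ 2 * x ^ (4 * k) := fun k => by ring
    have hw : ∀ k, (x ^ 4) ^ (2 * m + k) = (x ^ 8) ^ m * x ^ (4 * k) := fun k => by ring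
    have hy0 := hy 0
    have hz0 := hz 0
    have hw0 := hw 0
    simp only [add_zero, mul_zero, pow_zero, mul_one] at hy0 hz0 hw0
    simp only [hy, hz, hw, hy0, hz0, hw0]
    generalize (x ^ 8) ^ m = y
    -- The rearrangement with the factors kept opaque; the four pairings of `1 + x^k` with `1 - x^k`
    -- enter as hypotheses.
    have key : ∀ a b c d e f g h i j k l E p5 p3 p8 p7 p4 p1 O F : ℝ,
        E * (p5 * p3 * p8) * (p7 * p4 * p1) = O * F → a * h = k → b * f = l → c * e = i → d * g = j →
        E * a * b * c * d * (p5 * e * (p3 * f) * (p8 * (1 - x ^ 8 * y)))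
          * (p7 * g * (p4 * (1 - x ^ 4 * y)) * (p1 * h))
        = O * k * l * i * j * (F * (1 - x ^ 4 * y) * (1 - x ^ 8 * y)) := by
      intro a b c d e f g h i j k l E p5 p3 p8 p7 p4 p1 O F h0 h1 h2 h3 h4
      rw [← h1, ← h2, ← h3, ← h4]
      linear_combination a * b * c * d * e * f * g * h * (1 - x ^ 8 * y) * (1 - x ^ 4 * y) * h0
    convert key (1 - -x * y) (1 - -x * (y * x ^ (2 * 1))) (1 - -x * (y * x ^ (2 * (1 + 1))))
      (1 - -x * (y * x ^ (2 * (1 + (1 + 1))))) (1 - x ^ 5 * y) (1 - x ^ 3 * y) (1 - x ^ 7 * y)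
      (1 - x ^ 1 * y) (1 - x ^ 2 * (y ^ 2 * x ^ (4 * (1 + 1))))
      (1 - x ^ 2 * (y ^ 2 * x ^ (4 * (1 + (1 + 1))))) (1 - x ^ 2 * y ^ 2)
      (1 - x ^ 2 * (y ^ 2 * x ^ (4 * 1))) _ _ _ _ _ _ _ _ _ ih (by ring) (by ring) (by ring)
      (by ring) using 3
    ring

theorem pochInf_slater {x : ℝ} (hx1 : |x| < 1) :
    pochInf (-x) (x ^ 2) * (pochInf (x ^ 5) (x ^ 8) * pochInf (x ^ 3) (x ^ 8)
        * pochInf (x ^ 8) (x ^ 8))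
      * (pochInf (x ^ 7) (x ^ 8) * pochInf (x ^ 4) (x ^ 8) * pochInf (x ^ 1) (x ^ 8))
      = pochInf (x ^ 2) (x ^ 2) := by
  have h2 := abs_pow_lt_one_of_abs_lt_one hx1 (show 2 ≠ 0 by norm_num)
  have h4 := abs_pow_lt_one_of_abs_lt_one hx1 (show 4 ≠ 0 by norm_num)
  have h8 := abs_pow_lt_one_of_abs_lt_one hx1 (show 8 ≠ 0 by norm_num)
  have hs : ∀ k : ℕ, 0 < k → Filter.Tendsto (fun m : ℕ => k * m) Filter.atTop Filter.atTop :=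
    fun k hk => Filter.tendsto_id.const_mul_atTop' hk
  have h1 := (((tendsto_poch (-x) h2).comp (hs 4 (by norm_num))).mul
    (((tendsto_poch (x ^ 5) h8).mul (tendsto_poch (x ^ 3) h8)).mul (tendsto_poch (x ^ 8) h8))).mul
    (((tendsto_poch (x ^ 7) h8).mul (tendsto_poch (x ^ 4) h8)).mul (tendsto_poch (x ^ 1) h8))
  have h3 := ((tendsto_poch (x ^ 2) h4).comp (hs 4 (by norm_num))).mul
    ((tendsto_poch (x ^ 4) h4).comp (hs 2 (by norm_num)))
  have h5 := (tendsto_poch (x ^ 2) h4).mul (tendsto_poch (x ^ 4) h4)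
  have h6 := (tendsto_poch (x ^ 2) h2).comp (hs 2 (by norm_num))
  rw [tendsto_nhds_unique (h1.congr fun m => poch_four_mul x m) h3]
  exact tendsto_nhds_unique (h5.congr fun m => (poch_two_mul x m).symm) h6

theorem hasProd_slaterFactor {x : ℝ} (hx1 : |x| < 1) :
    HasProd (slaterFactor x)
      (pochInf (x ^ 7) (x ^ 8) * pochInf (x ^ 4) (x ^ 8) * pochInf (x ^ 1) (x ^ 8))⁻¹ := by
  have h8 := abs_pow_lt_one_of_abs_lt_one hx1 (show 8 ≠ 0 by norm_num)
  have h := ((((multipliable_poch (x ^ 7) h8).hasProd.mul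
    (multipliable_poch (x ^ 4) h8).hasProd).mul (multipliable_poch (x ^ 1) h8).hasProd).inv₀
    (mul_ne_zero (mul_ne_zero (pochInf_ne_zero (abs_pow_lt_one_of_abs_lt_one hx1 (by norm_num)) h8)
      (pochInf_ne_zero (abs_pow_lt_one_of_abs_lt_one hx1 (by norm_num)) h8))
      (pochInf_ne_zero (abs_pow_lt_one_of_abs_lt_one hx1 (by norm_num)) h8)))
  refine h.congr_fun fun j => ?_
  rw [slaterFactor, one_div, pow_one]
  congr 1
  ring

/-- Slater's identity. -/
theorem slater_identity {x : ℝ} (hx1 : |x| < 1) :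
    Summable (slaterTerm x) ∧ Multipliable (slaterFactor x) ∧
      ∑' n, slaterTerm x n = ∏' j, slaterFactor x j := by
  refine ⟨summable_slaterTerm hx1, (hasProd_slaterFactor hx1).multipliable, ?_⟩
  rcases eq_or_ne x 0 with rfl | hx
  · rw [tsum_eq_single 0 fun n hn => by simp [slaterTerm, hn]]
    have : slaterFactor 0 = fun _ => 1 := by funext j; simp [slaterFactor]
    rw [this, tprod_one]
    simp [slaterTerm]
  · rw [(hasProd_slaterFactor hx1).tprod_eq]
    have h2 := abs_pow_lt_one_of_abs_lt_one hx1 (show 2 ≠ 0 by norm_num)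
    have h1 := tsum_slaterTerm hx hx1
    have h3 := pochInf_slater hx1
    have h4 := pochInf_ne_zero h2 h2
    rw [tsum_thetaTerm hx hx1] at h1
    rw [← h3] at h4
    refine (eq_inv_of_mul_eq_one_left ?_)
    refine mul_left_cancel₀ (left_ne_zero_of_mul h4) ?_
    rw [← h1] at h3 ⊢
    rw [mul_one]
    linear_combination (∑' n, slaterTerm x n) * h3

/-! ### Evaluation at a real number and the double limit. -/

/-- Evaluation at a positive real number, as a ring homomorphism. -/
noncomputable def evalHom {q : ℝ} (hq : 0 < q) : QPoly →ₐ[ℤ] ℝ :=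
  AddMonoidAlgebra.lift ℤ ℝ ℚ
    { toFun := fun a => q ^ ((Multiplicative.toAdd a : ℚ) : ℝ)
      map_one' := by simp
      map_mul' := fun a b => by rw [toAdd_mul, Rat.cast_add, Real.rpow_add hq] }

theorem evalHom_apply {q : ℝ} (hq : 0 < q) (f : QPoly) : evalHom hq f = evalAt q f := by
  rw [evalHom, AddMonoidAlgebra.lift_apply']
  rfl

theorem evalHom_qPow {q : ℝ} (hq : 0 < q) (a : ℚ) : evalHom hq (qPow a) = q ^ (a : ℝ) := by
  rw [evalHom, qPow, AddMonoidAlgebra.lift_single]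
  simp

theorem evalHom_qFac {q : ℝ} (hq : 0 < q) (n : ℕ) : evalHom hq (qFac n) = poch q q n := by
  rw [qFac, map_prod, poch]
  refine Finset.prod_congr rfl fun k _ => ?_
  rw [map_sub, map_one, evalHom_qPow, ← pow_succ', ← Real.rpow_natCast]
  push_cast
  rfl

/-- The vanishing of `recPoch` at negative arguments makes the quotient formula valid outside `0 ≤ k
≤ n` too. -/
theorem evalHom_qBinom {q : ℝ} (hq : 0 < q) (hq1 : |q| < 1) {a b : ℚ} {n k : ℤ} (ha : a = n)
    (hb : b = k) :
    evalHom hq (qBinom a b) = poch q q n.toNat * (recPoch q k * recPoch q (n - k)) := by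
  subst ha hb
  by_cases h : 0 ≤ k ∧ k ≤ n
  · lift k to ℕ using h.1
    obtain ⟨m, rfl⟩ := Int.le.dest h.2
    have hm : (k : ℤ) + m - k = m := by ring
    rw [hm, recPoch_natCast, recPoch_natCast, ← Nat.cast_add, Int.toNat_natCast, qBinom_intCast,
      if_pos (by omega), gz_natCast, ← evalHom_qFac hq (k + m), ← gauss_mul_qFac, map_mul, map_mul,
      evalHom_qFac, evalHom_qFac]
    have h1 := poch_self_ne_zero hq1 k
    have h2 := poch_self_ne_zero hq1 m
    field_simp
  · rcases not_and_or.mp h with h | h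
    · rw [recPoch_of_neg q (not_le.mp h), qBinom_of_neg (by exact_mod_cast not_le.mp h), map_zero]
      ring
    · rw [recPoch_of_neg q (by omega : n - k < 0), qBinom_of_lt (by exact_mod_cast not_le.mp h),
        map_zero]
      ring

theorem sum_Icc_zero_eq_sum_range {A : Type*} [AddCommMonoid A] (F : ℤ → A) (n : ℕ) :
    ∑ i ∈ Finset.Icc (0 : ℤ) n, F i = ∑ i ∈ Finset.range (n + 1), F i := by
  refine Finset.sum_nbij' Int.toNat Nat.cast ?_ ?_ ?_ ?_ ?_ <;> intro i hi <;>
    simp only [Finset.mem_Icc, Finset.mem_range] at hi ⊢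
  · omega
  · omega
  · omega
  · omega
  · rw [Int.toNat_of_nonneg hi.1]

theorem evalAt_slaterForm {x : ℝ} (hx0 : 0 < x) (hx1 : |x ^ 2| < 1) (σ M K : ℕ) :
    evalAt (x ^ 2) (slaterForm σ M (K + (σ : ℚ) / 2))
      = ∑ i ∈ Finset.range (M + 1), ∑ n ∈ Finset.range (i + 1), if Even (n + i + σ) then
          x ^ (i ^ 2 + n ^ 2)
          * (poch (x ^ 2) (x ^ 2) (2 * K + σ + M - i : ℤ).toNat
            * (recPoch (x ^ 2) (2 * K + σ) * recPoch (x ^ 2) (M - i)))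
          * (poch (x ^ 2) (x ^ 2) i * (recPoch (x ^ 2) n * recPoch (x ^ 2) (i - n)))
          * (poch (x ^ 2) (x ^ 2) (2 * K + σ - n : ℤ).toNat
            * (recPoch (x ^ 2) i * recPoch (x ^ 2) (2 * K + σ - n - i))) else 0 := by
  have hq : 0 < x ^ 2 := by positivity
  rw [← evalHom_apply hq, slaterForm, sum_Icc_zero_eq_sum_range, map_sum]
  refine Finset.sum_congr rfl fun i _ => ?_
  rw [Finset.sum_filter, sum_Icc_zero_eq_sum_range, map_sum]
  refine Finset.sum_congr rfl fun n _ => ?_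
  have hev : Even ((n : ℤ) + i + σ) ↔ Even (n + i + σ) := by
    rw [← Int.even_coe_nat]; push_cast; rfl
  simp only [hev]
  split_ifs
  · rw [map_mul, map_mul, map_mul, evalHom_qPow,
      evalHom_qBinom hq hx1 (n := 2 * K + σ + M - i) (k := 2 * K + σ) (by push_cast; ring)
        (by push_cast; ring),
      evalHom_qBinom hq hx1 (n := i) (k := n) rfl rfl,
      evalHom_qBinom hq hx1 (n := 2 * K + σ - n) (k := i) (by push_cast; ring) rfl,
      Int.toNat_natCast, show (2 * K + σ + M - i : ℤ) - (2 * K + σ) = M - i by ring]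
    congr 3
    rw [← Real.rpow_natCast x 2, ← Real.rpow_mul hx0.le, ← Real.rpow_natCast]
    congr 1
    push_cast
    ring
  · exact map_zero _

theorem mixedPoch_zero_left (y : ℝ) (k : ℕ) : mixedPoch 0 (-y) (y ^ 2) k = y ^ (k ^ 2) := by
  induction k with
  | zero => simp [mixedPoch]
  | succ k ih =>
    rw [mixedPoch, Finset.prod_range_succ, ← mixedPoch, ih]
    ring

/-- The `q`-binomial theorem for `(-y; y²)_i`, which is the finite Gauss sum with `u = 0`. -/
theorem slaterTerm_eq_sum {y : ℝ} (hy : |y ^ 2| < 1) (i : ℕ) :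
    slaterTerm y i = ∑ n ∈ Finset.range (i + 1),
      y ^ (i ^ 2 + n ^ 2) * (recPoch (y ^ 2) n * recPoch (y ^ 2) (i - n)) := by
  rw [slaterTerm_eq, mul_div_assoc, ← sum_mixedPoch hy i 0,
    Finset.Nat.sum_antidiagonal_eq_sum_range_succ_mk, Finset.mul_sum]
  refine Finset.sum_congr rfl fun n hn => ?_
  rw [Finset.mem_range] at hn
  rw [mixedPoch_zero_left, ← Nat.cast_sub (by omega), recPoch_natCast, recPoch_natCast, pow_add]
  simp [poch]
  ring

/-- The terms of `S(-x)` carry the sign `(-1)^{i² + n²} = (-1)^{i + n}`, so the combination doubles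
one parity class and cancels the other. -/
theorem slaterTerm_add {x : ℝ} (hx : |x ^ 2| < 1) (σ i : ℕ) :
    slaterTerm x i + (-1) ^ σ * slaterTerm (-x) i
      = 2 * ∑ n ∈ Finset.range (i + 1), if Even (n + i + σ) then
        x ^ (i ^ 2 + n ^ 2) * (recPoch (x ^ 2) n * recPoch (x ^ 2) (i - n)) else 0 := by
  rw [slaterTerm_eq_sum hx, slaterTerm_eq_sum (by rwa [neg_sq]), Finset.mul_sum, Finset.mul_sum,
    ← Finset.sum_add_distrib]
  refine Finset.sum_congr rfl fun n _ => ?_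
  rw [neg_sq, neg_pow x]
  have h : ((-1 : ℝ)) ^ σ * (-1) ^ (i ^ 2 + n ^ 2) = (-1) ^ (n + i + σ) := by
    rw [← pow_add, neg_one_pow_congr]
    simp only [Nat.even_add, Nat.even_pow' two_ne_zero]
    tauto
  split_ifs with hev
  · rw [hev.neg_one_pow] at h
    linear_combination x ^ (i ^ 2 + n ^ 2) * (recPoch (x ^ 2) n * recPoch (x ^ 2) (i - n)) * h
  · rw [(Nat.not_even_iff_odd.mp hev).neg_one_pow] at h
    linear_combination x ^ (i ^ 2 + n ^ 2) * (recPoch (x ^ 2) n * recPoch (x ^ 2) (i - n)) * h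

theorem tendsto_poch_toNat {q : ℝ} (c : ℝ) (hq : |q| < 1) :
    Filter.Tendsto (fun m : ℤ => poch c q m.toNat) Filter.atTop (nhds (pochInf c q)) :=
  (tendsto_poch c hq).comp (Filter.tendsto_atTop_atTop.mpr fun b => ⟨b, fun a ha => by omega⟩)

/-- The double limit of the level-two sums. -/
theorem tendsto_slaterForm {x : ℝ} (hx0 : 0 < x) (hx1 : x < 1) (σ : ℕ) :
    Filter.Tendsto (fun P : ℕ × ℕ => evalAt (x ^ 2) (slaterForm σ P.1 (P.2 + (σ : ℚ) / 2)))
      Filter.atTop (nhds (((∑' n, slaterTerm x n) + (-1) ^ σ * (∑' n, slaterTerm (-x) n))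
        / (2 * pochInf (x ^ 2) (x ^ 2)))) := by
  have hx : |x| < 1 := by rwa [abs_of_pos hx0]
  have hq := abs_pow_lt_one_of_abs_lt_one hx two_ne_zero
  have hP := pochInf_ne_zero hq hq
  obtain ⟨C, hC0, hC⟩ := exists_abs_poch_le (x ^ 2) hq
  obtain ⟨D, hD0, hD⟩ := exists_abs_recPoch_le hq
  set E := C * (D * D) with hE
  have hE0 : 0 ≤ E := by positivity
  have hCD : ∀ a b c, |poch (x ^ 2) (x ^ 2) a * (recPoch (x ^ 2) b * recPoch (x ^ 2) c)| ≤ E := by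
    intro a b c
    rw [abs_mul, abs_mul]
    exact mul_le_mul (hC _) (mul_le_mul (hD _) (hD _) (abs_nonneg _) hD0) (by positivity) hC0
  have hlim : ∀ f : ℕ × ℕ → ℤ, (∃ c : ℤ, ∀ P : ℕ × ℕ, (P.1 : ℤ) + c ≤ f P ∨ (P.2 : ℤ) + c ≤ f P) →
      Filter.Tendsto f Filter.atTop Filter.atTop := by
    rintro f ⟨c, hc⟩
    refine Filter.tendsto_atTop_atTop.mpr fun b => ⟨((b - c).toNat, (b - c).toNat), fun P hPb => ?_⟩
    have h1 := hPb.1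
    have h2 := hPb.2
    simp only at h1 h2
    have := hc P
    omega
  set F : ℕ × ℕ → ℕ → ℝ := fun P i => ∑ n ∈ Finset.range (i + 1), if Even (n + i + σ) then
          x ^ (i ^ 2 + n ^ 2)
          * (poch (x ^ 2) (x ^ 2) (2 * P.2 + σ + P.1 - i : ℤ).toNat
            * (recPoch (x ^ 2) (2 * P.2 + σ) * recPoch (x ^ 2) (P.1 - i)))
          * (poch (x ^ 2) (x ^ 2) i * (recPoch (x ^ 2) n * recPoch (x ^ 2) (i - n)))
          * (poch (x ^ 2) (x ^ 2) (2 * P.2 + σ - n : ℤ).toNat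
            * (recPoch (x ^ 2) i * recPoch (x ^ 2) (2 * P.2 + σ - n - i))) else 0 with hF
  -- The dominating series: `i + 1` inner terms, three products bounded by `E`, and `x^{i² + n²} ≤
  -- x^i`.
  have hsum : Summable fun i : ℕ => ((i : ℝ) + 1) * (x ^ i * E * E * E) := by
    have h1 := summable_pow_mul_geometric_of_norm_lt_one 1 (show ‖x‖ < 1 from hx)
    have h0 := summable_pow_mul_geometric_of_norm_lt_one 0 (show ‖x‖ < 1 from hx)
    refine ((h1.add h0).mul_right (E * E * E)).congr fun i => ?_
    ring
  have h := tendsto_tsum_of_dominated_convergence (𝓕 := Filter.atTop) (f := F)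
    (g := fun i => (slaterTerm x i + (-1) ^ σ * slaterTerm (-x) i)
      * (1 / (2 * pochInf (x ^ 2) (x ^ 2)))) hsum ?_ (Filter.Eventually.of_forall fun P i => ?_)
  · have hS := summable_slaterTerm hx
    have hS' := summable_slaterTerm (x := -x) (by rwa [abs_neg])
    rw [tsum_mul_right, hS.tsum_add (hS'.mul_left _), tsum_mul_left, mul_one_div] at h
    refine h.congr fun P => ?_
    rw [evalAt_slaterForm hx0 hq]
    refine tsum_eq_sum fun i hi => ?_
    rw [Finset.mem_range] at hi
    refine Finset.sum_eq_zero fun n _ => ?_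
    rw [recPoch_of_neg (x ^ 2) (by omega : (P.1 : ℤ) - i < 0)]
    simp
  · intro i
    rw [slaterTerm_add hq, mul_comm (2 : ℝ), mul_assoc, Finset.sum_mul]
    refine tendsto_finsetSum _ fun n hn => ?_
    split_ifs
    -- In the limit the first binomial becomes `1/(x²; x²)_∞` and the last one `1/(x²; x²)_i`, which
    -- cancels the numerator of the middle one.
    · have e : x ^ (i ^ 2 + n ^ 2) * (recPoch (x ^ 2) n * recPoch (x ^ 2) (i - n))
          * (2 * (1 / (2 * pochInf (x ^ 2) (x ^ 2))))
          = x ^ (i ^ 2 + n ^ 2) * (pochInf (x ^ 2) (x ^ 2) * (1 / pochInf (x ^ 2) (x ^ 2)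
            * (1 / pochInf (x ^ 2) (x ^ 2))))
          * (poch (x ^ 2) (x ^ 2) i * (recPoch (x ^ 2) n * recPoch (x ^ 2) (i - n)))
          * (pochInf (x ^ 2) (x ^ 2) * (recPoch (x ^ 2) i * (1 / pochInf (x ^ 2) (x ^ 2)))) := by
        rw [recPoch_natCast _ i]
        have := poch_self_ne_zero hq i
        field_simp
      rw [e]
      have hp := tendsto_poch_toNat (x ^ 2) hq
      have hr := tendsto_recPoch hq
      refine ((tendsto_const_nhds.mul ((hp.comp (hlim _ ⟨-i, fun P => ?_⟩)).mul
        ((hr.comp (hlim _ ⟨0, fun P => ?_⟩)).mul (hr.comp (hlim _ ⟨-i, fun P => ?_⟩))))).mul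
        tendsto_const_nhds).mul ((hp.comp (hlim _ ⟨-n, fun P => ?_⟩)).mul
        (tendsto_const_nhds.mul (hr.comp (hlim _ ⟨-n - i, fun P => ?_⟩)))) <;> omega
    · rw [zero_mul]; exact tendsto_const_nhds
  · have hle : ∀ n ∈ Finset.range (i + 1), |if Even (n + i + σ) then
          x ^ (i ^ 2 + n ^ 2)
          * (poch (x ^ 2) (x ^ 2) (2 * P.2 + σ + P.1 - i : ℤ).toNat
            * (recPoch (x ^ 2) (2 * P.2 + σ) * recPoch (x ^ 2) (P.1 - i)))
          * (poch (x ^ 2) (x ^ 2) i * (recPoch (x ^ 2) n * recPoch (x ^ 2) (i - n)))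
          * (poch (x ^ 2) (x ^ 2) (2 * P.2 + σ - n : ℤ).toNat
            * (recPoch (x ^ 2) i * recPoch (x ^ 2) (2 * P.2 + σ - n - i))) else 0|
        ≤ x ^ i * E * E * E := by
      intro n _
      split_ifs
      · rw [abs_mul, abs_mul, abs_mul, abs_of_pos (pow_pos hx0 _)]
        have hpow : x ^ (i ^ 2 + n ^ 2) ≤ x ^ i :=
          pow_le_pow_of_le_one hx0.le hx1.le
            ((Nat.le_self_pow two_ne_zero i).trans (Nat.le_add_right _ _))
        gcongr
        · exact hCD _ _ _
        · exact hCD _ _ _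
        · exact hCD _ _ _
      · rw [abs_zero]; positivity
    refine (Finset.abs_sum_le_sum_abs _ _).trans ((Finset.sum_le_sum hle).trans_eq ?_)
    rw [Finset.sum_const, Finset.card_range, nsmul_eq_mul]
    push_cast
    ring

/-! ### The main theorem. -/

theorem mainTheorem4 :
    -- the initial identity
    (∀ M L : ℤ, 0 ≤ M → burgeX 1 2 0 1 M L M L = if L = 0 then 1 else 0) ∧
    -- the four families
    (∀ (N σ : ℕ) (M : ℤ) (L : ℚ), 1 ≤ N → (σ = 0 ∨ σ = 1) → Even (σ * N) →
      (∃ z : ℤ, L + (σ : ℚ) / 2 = z) →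
        levelXsymm N 1 (2 * N + 1) 0 N σ M L = tadpoleForm N σ M L ∧
        levelXsymm N 2 (N + 2) 1 1 σ M L
          = qBinom (2 * L + M) (2 * L) * (if σ = 0 then 1 else 0) ∧
        levelXsymm N 3 (N + 3) 1 1 σ M L = typeAForm N σ M L ∧
        levelXsymm N 2 (3 * N + 2) 1 (N + 1) σ M L = gordonForm N σ M L) ∧
    -- the fourth family at level two
    (∀ (σ : ℕ) (M : ℤ) (L : ℚ), (σ = 0 ∨ σ = 1) → (∃ z : ℤ, L + (σ : ℚ) / 2 = z) →
      levelXsymm 2 2 8 1 3 σ M L = slaterForm σ M L) ∧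
    -- Slater's identity
    (∀ x : ℝ, |x| < 1 →
      Summable (slaterTerm x) ∧ Multipliable (slaterFactor x) ∧
        ∑' n, slaterTerm x n = ∏' j, slaterFactor x j) ∧
    -- it is the limit of the level-two identities, at `q = x²`
    (∀ (σ : ℕ) (x : ℝ), (σ = 0 ∨ σ = 1) → 0 < x → x < 1 →
      Multipliable (fun k : ℕ => 1 - (x ^ 2) ^ (k + 1)) ∧
      Filter.Tendsto
        (fun P : ℕ × ℕ => evalAt (x ^ 2) (levelXsymm 2 2 8 1 3 σ P.1 (P.2 + (σ : ℚ) / 2)))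
        Filter.atTop
        (nhds (((∑' n, slaterTerm x n) + (-1) ^ σ * (∑' n, slaterTerm (-x) n))
          / (2 * ∏' k : ℕ, (1 - (x ^ 2) ^ (k + 1)))))) := by

  have hcast : ∀ {σ : ℕ} {L : ℚ}, (∃ z : ℤ, L + (σ : ℚ) / 2 = z) →
      ∃ z : ℤ, 2 * L = z ∧ Even (z + σ) := by
    rintro σ L ⟨w, hw⟩
    exact ⟨2 * w - σ, by push_cast; linarith, ⟨w, by ring⟩⟩
  have hslater : ∀ (σ : ℕ) (M : ℤ) (L : ℚ), (∃ z : ℤ, L + (σ : ℚ) / 2 = z) →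
      levelXsymm 2 2 8 1 3 σ M L = slaterForm σ M L := by
    intro σ M L hL
    obtain ⟨z, hz, hev⟩ := hcast hL
    have h := levelXsymm_gordon (n := 1) (M := M) hz hev
    norm_num at h
    rw [h, gordonForm_two]
  refine ⟨fun M L hM => burgeX_one_two L hM, ?_, fun σ M L _ hL => hslater σ M L hL, ?_, ?_⟩
  · intro N σ M L hN hσ _ hL
    obtain ⟨n, rfl⟩ := Nat.exists_eq_add_of_le' hN
    obtain ⟨z, hz, hev⟩ := hcast hL
    push_cast
    exact ⟨levelXsymm_tadpole hz hev, levelXsymm_two hz hev hσ, levelXsymm_typeA hz hev,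
      levelXsymm_gordon hz hev⟩
  · exact fun x hx => slater_identity hx
  · intro σ x _ hx0 hx1
    have hx : |x| < 1 := by rwa [abs_of_pos hx0]
    have hq := abs_pow_lt_one_of_abs_lt_one hx two_ne_zero
    have hfac : (fun k : ℕ => 1 - (x ^ 2) ^ (k + 1)) = fun k => 1 - x ^ 2 * (x ^ 2) ^ k := by
      funext k; ring
    rw [hfac]
    refine ⟨multipliable_poch (x ^ 2) hq, (tendsto_slaterForm hx0 hx1 σ).congr fun P => ?_⟩
    rw [hslater σ P.1 _ ⟨P.2 + σ, by push_cast; ring⟩]
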